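/- Let $m\ge 2$ be an integer and $p\in[0,1]$. **Correlated randomness.** The binary erasure channel BEC$(p)$ has input alphabet $\{0,1\}$, output alphabet $\{0,1,e\}$ and transition law $P_{Y|X}(y|x)=p\,\mathbf 1_{(y=e)}+(1-p)\,\mathbf 1_{(y=x)}$. The binary erasure source BES$(p)$ is the law $P_{X,Y}(x,y)=\tfrac12P_{Y|X}(y|x)$. **Protocols.** Alice holds $A^k=(A_1,\dots,A_k)$ with $A_i\in\{0,1\}^m$, and Bob holds $B^k=(B_1,\dots,B_k)$ with $B_i\in\{1,\dots,m\}$; $(A^k,B^k)$ is uniformly distributed. Bob wants $G^k$, $G_i=A_{i,B_i}$ (the $B_i$-th bit of $A_i$); Alice computes a constant function $F^k=0$. Alice and Bob have local random variables $Z_A$, $Z_B$ (with arbitrary laws), and over $r$ stages they exchange messages $M^r=(M_1,\dots,M_r)$ from a countable alphabet over an error-free public channel, Alice speaking in odd stages and Bob in even stages. In an $(n,k)$-protocol for the BES$(p)$, Alice has $X^n$ and Bob has $Y^n$, where the $(X_i,Y_i)$ are iid with the law of the BES$(p)$; $Z_A$, $Z_B$, $(A^k,B^k)$, $(X^n,Y^n)$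 are mutually independent; each of Alice's messages is a function of $(A^k,X^n,Z_A)$ and the previous messages, each of Bob's of $(B^k,Y^n,Z_B)$ and the previous messages. In an $(n,k)$-protocol for the BEC$(p)$, $Z_A$, $Z_B$, $(A^k,B^k)$ are mutually independent, and $n$ uses of the memoryless channel are interspersed with the stages in an arbitrary fixed order; Alice's messages and channel inputs $X_i$ are functions of $A^k$, $Z_A$, her previous inputs and the previous messages, and Bob's messages are functions of $B^k$, $Z_B$, the previous channel outputs $Y_i$ and the previous messages. At the end Alice forms an estimate $\hat F^k$ from $(A^k,X^n,Z_A,M^r)$, and Bob forms an estimate $\hat G^k$ from $(B^k,Y^n,Z_B,M^r)$. **Rates and capacity.** A protocol is $\epsilon$-good if $\Pr[\hat F^k\ne F^k]<\epsilon$, $\Pr[\hat G^k\neq G^k]<\epsilon$, $I(A^k;Z_B,Y^n,M^r\,|\,B^k,G^k)<\epsilon$ and $I(B^k;Z_A,X^n,M^r\,|\,A^k,F^k)<\epsilon$ (information in bits). A family of protocols attains the rate $R$ if for every $\epsilon>0$ and all sufficiently large $n$ there are a $k$ with $k/n>R-\epsilon$ and an $\epsilon$-good $(n,k)$-protocol in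 the family. The $1$-out-of-$m$ sample-wise OT capacity $C_{OT,m}$ for the uniform source distribution is the largest $R>0$ attained by the family of all protocols, and $0$ if there is no such $R$. **The SWOT protocol.** For the BES$(p)$: let $S_e=\{i:Y_i=e\}$ and $S=\{1,\dots,n\}\setminus S_e$. If $k>|S|$ or $k(m-1)>|S_e|$, Bob aborts and sets $\hat G^k=0^k$. Otherwise he sends Alice a $k\times m$ matrix $U$ whose entries at the positions $(i,B_i)$ are a uniformly random selection without replacement from $S$, and whose other entries are an independent such selection from $S_e$. Alice replies with the binary matrix $C$, $C_{i,j}=A_{i,j}\oplus X_{U(i,j)}$, and Bob sets $\hat G_i=C_{i,B_i}\oplus Y_{U(i,B_i)}$. For the BEC$(p)$, Alice first transmits $n$ iid uniform bits through the channel, and then they proceed in the same way. **Statement.** 1. For the BES$(p)$, and also for the BEC$(p)$, $$C_{OT,m}=\min\Bigl(1-p,\ \frac{p}{m-1}\Bigr).$$ 2. For the BES$(p)$, and also for the BEC$(p)$, the family of SWOT protocols attains the rate $\min\bigl(1-p,\,p/(m-1)\bigr)$. 3. For the BEC$(p)$, the maximum over all input distributions $P_X$ on $\{0,1\}$ of $\min\bigl(I(X;Y),\,H(X|Y)/(m-1)\bigr)$,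 where $(X,Y)\sim P_XP_{Y|X}$ and information is measured in bits, is attained at the uniform $P_X$ and equals $\min\bigl(1-p,\,p/(m-1)\bigr)$. -/

import Mathlib

open MeasureTheory ProbabilityTheory Filter
open scoped ENNReal

namespace SFC

noncomputable section

/-! ### Discrete measurable structures -/

instance instMeasurableSpaceList {α : Type*} : MeasurableSpace (List α) := ⊤

instance instMeasurableSpaceOption {α : Type*} : MeasurableSpace (Option α) := ⊤

instance instDiscreteMeasurableSpaceOption {α : Type*} : DiscreteMeasurableSpace (Option α) :=
  ⟨fun _ => trivial⟩

/-! ### Information measures, in bits -/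

/-- The mutual information `I(U;V)` in bits: the divergence of the joint law of `(U,V)` from the
product of its marginals. -/
def mutualInfo {Ω α β : Type*} [MeasurableSpace Ω] [MeasurableSpace α] [MeasurableSpace β]
    (P : Measure Ω) (U : Ω → α) (V : Ω → β) : ℝ≥0∞ :=
  InformationTheory.klDiv (P.map fun ω => (U ω, V ω)) ((P.map U).prod (P.map V)) /
    ENNReal.ofReal (Real.log 2)

/-- The conditional mutual information `I(U;V|W)` in bits, for `W` with finitely many values. -/
def condMutualInfo {Ω α β γ : Type*} [MeasurableSpace Ω] [MeasurableSpace α] [MeasurableSpace β]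
    [Fintype γ] (P : Measure Ω) (U : Ω → α) (V : Ω → β) (W : Ω → γ) : ℝ≥0∞ :=
  ∑ w, P (W ⁻¹' {w}) * mutualInfo (P[|W ⁻¹' {w}]) U V

/-- The conditional entropy `H(U|V)` in bits, for `U` and `V` with finitely many values. -/
def condEntropy {Ω α β : Type*} [MeasurableSpace Ω] [Fintype α] [Fintype β]
    (P : Measure Ω) (U : Ω → α) (V : Ω → β) : ℝ :=
  ∑ v, P.real (V ⁻¹' {v}) *
    ∑ u, Real.negMulLog ((P[|V ⁻¹' {v}]).real (U ⁻¹' {u})) / Real.log 2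

/-! ### Correctness and privacy -/

section Security

variable {Ω 𝓐 𝓑 𝓕 𝓖 VA VB : Type*} {k : ℕ} [MeasurableSpace Ω]
  [Fintype 𝓐] [MeasurableSpace 𝓐] [Fintype 𝓑] [MeasurableSpace 𝓑] [Fintype 𝓕] [Fintype 𝓖]
  [MeasurableSpace VA] [MeasurableSpace VB]

/-- The samplewise values `(f(a_1,b_1), ..., f(a_k,b_k))`. -/
def samples {𝓡 : Type*} (f : 𝓐 → 𝓑 → 𝓡) (a : Fin k → 𝓐) (b : Fin k → 𝓑) : Fin k → 𝓡 :=
  fun i => f (a i) (b i)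

/-- Correctness and privacy with tolerance `ε` of an execution over the probability space `(Ω,P)`:
`A`, `B` are the source samples, `viewA = (Z_A, X^n, M^r)`, `viewB = (Z_B, Y^n, M^r)`, and
`Fhat`, `Ghat` are the estimates of Alice and Bob. -/
structure IsSecureExecution (f : 𝓐 → 𝓑 → 𝓕) (g : 𝓐 → 𝓑 → 𝓖) (ε : ℝ) (P : Measure Ω)
    (A : Ω → Fin k → 𝓐) (B : Ω → Fin k → 𝓑) (viewA : Ω → VA) (viewB : Ω → VB)
    (Fhat : Ω → Fin k → 𝓕) (Ghat : Ω → Fin k → 𝓖) : Prop where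
  correct_alice : P {ω | Fhat ω ≠ samples f (A ω) (B ω)} < ENNReal.ofReal ε
  correct_bob : P {ω | Ghat ω ≠ samples g (A ω) (B ω)} < ENNReal.ofReal ε
  privacy_alice :
    condMutualInfo P A viewB (fun ω => (B ω, samples g (A ω) (B ω))) < ENNReal.ofReal ε
  privacy_bob :
    condMutualInfo P B viewA (fun ω => (A ω, samples f (A ω) (B ω))) < ENNReal.ofReal ε

end Security

/-! ### Source-model protocols -/

/-- A protocol that uses `n` samples of source-model correlated randomness to compute `k` samples.
Alice speaks in the odd numbered stages `1, 3, ...` and Bob in the even numbered ones; a message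
depends on the speaker's source samples, correlated randomness, local randomness and on the list of
all previous messages. The local randomness is arbitrary; messages come from a countable
alphabet. -/
structure SourceProtocol (𝓐 𝓑 𝓧 𝓨 𝓕 𝓖 : Type) (n k : ℕ) where
  ZA : Type
  ZB : Type
  [measZA : MeasurableSpace ZA]
  [measZB : MeasurableSpace ZB]
  lawA : Measure ZA
  lawB : Measure ZB
  [probA : IsProbabilityMeasure lawA]
  [probB : IsProbabilityMeasure lawB]
  Msg : Type
  [countableMsg : Countable Msg]
  /-- the number of discussion stages -/
  r : ℕ
  aliceMsg : (Fin k → 𝓐) → (Fin n → 𝓧) → ZA → List Msg → Msg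
  bobMsg : (Fin k → 𝓑) → (Fin n → 𝓨) → ZB → List Msg → Msg
  aliceEst : (Fin k → 𝓐) → (Fin n → 𝓧) → ZA → List Msg → (Fin k → 𝓕)
  bobEst : (Fin k → 𝓑) → (Fin n → 𝓨) → ZB → List Msg → (Fin k → 𝓖)
  meas_aliceMsg : ∀ a x h c, MeasurableSet {z | aliceMsg a x z h = c}
  meas_bobMsg : ∀ b y h c, MeasurableSet {z | bobMsg b y z h = c}
  meas_aliceEst : ∀ a x h c, MeasurableSet {z | aliceEst a x z h = c}
  meas_bobEst : ∀ b y h c, MeasurableSet {z | bobEst b y z h = c}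

namespace SourceProtocol

attribute [instance] measZA measZB probA probB countableMsg

variable {𝓐 𝓑 𝓧 𝓨 𝓕 𝓖 : Type} {n k : ℕ}

/-- The messages `M_1, ..., M_i`, in this order. -/
def transcript (π : SourceProtocol 𝓐 𝓑 𝓧 𝓨 𝓕 𝓖 n k) (a : Fin k → 𝓐) (b : Fin k → 𝓑)
    (x : Fin n → 𝓧) (y : Fin n → 𝓨) (zA : π.ZA) (zB : π.ZB) : ℕ → List π.Msg
  | 0 => []
  | i + 1 =>
    let h := transcript π a b x y zA zB i
    h ++ [if Even i then π.aliceMsg a x zA h else π.bobMsg b y zB h]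

/-- The sample space: `(((A^k, B^k), (X_i, Y_i)_i), (Z_A, Z_B))`. -/
abbrev Space (π : SourceProtocol 𝓐 𝓑 𝓧 𝓨 𝓕 𝓖 n k) : Type :=
  (((Fin k → 𝓐) × (Fin k → 𝓑)) × (Fin n → 𝓧 × 𝓨)) × (π.ZA × π.ZB)

/-- All of `M^r` as a random variable. -/
def messages (π : SourceProtocol 𝓐 𝓑 𝓧 𝓨 𝓕 𝓖 n k) (ω : π.Space) : List π.Msg :=
  π.transcript ω.1.1.1 ω.1.1.2 (fun i => (ω.1.2 i).1) (fun i => (ω.1.2 i).2) ω.2.1 ω.2.2 π.r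

variable [MeasurableSpace 𝓐] [MeasurableSpace 𝓑] [MeasurableSpace 𝓧] [MeasurableSpace 𝓨]

/-- The law on the sample space: `(A^k,B^k)`, `(X^n,Y^n)`, `Z_A`, `Z_B` are independent and the
pairs `(X_i,Y_i)` are iid with law `PXY`. -/
def law (π : SourceProtocol 𝓐 𝓑 𝓧 𝓨 𝓕 𝓖 n k) (PAB : Measure ((Fin k → 𝓐) × (Fin k → 𝓑)))
    (PXY : PMF (𝓧 × 𝓨)) : Measure π.Space :=
  (PAB.prod (Measure.pi fun _ : Fin n => PXY.toMeasure)).prod (π.lawA.prod π.lawB)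

/-- Correctness and privacy with tolerance `ε` of a source-model protocol. -/
def IsSecure [Fintype 𝓐] [Fintype 𝓑] [Fintype 𝓕] [Fintype 𝓖]
    (π : SourceProtocol 𝓐 𝓑 𝓧 𝓨 𝓕 𝓖 n k) (PAB : Measure ((Fin k → 𝓐) × (Fin k → 𝓑)))
    (PXY : PMF (𝓧 × 𝓨)) (f : 𝓐 → 𝓑 → 𝓕) (g : 𝓐 → 𝓑 → 𝓖) (ε : ℝ) : Prop :=
  IsSecureExecution f g ε (π.law PAB PXY)
    (fun ω => ω.1.1.1) (fun ω => ω.1.1.2)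
    (fun ω => (ω.2.1, (fun i => (ω.1.2 i).1), π.messages ω))
    (fun ω => (ω.2.2, (fun i => (ω.1.2 i).2), π.messages ω))
    (fun ω => π.aliceEst ω.1.1.1 (fun i => (ω.1.2 i).1) ω.2.1 (π.messages ω))
    (fun ω => π.bobEst ω.1.1.2 (fun i => (ω.1.2 i).2) ω.2.2 (π.messages ω))

end SourceProtocol

/-! ### Channel-model protocols -/

/-- A step of a channel-model protocol: a discussion stage or a use of the channel. -/
inductive Step where
  | talk
  | send
  deriving DecidableEq

/-- A protocol that uses a discrete memoryless channel `n` times to compute `k` samples. The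
`schedule` intersperses the discussion stages with the `n` channel uses in an arbitrary order; as
before Alice speaks in the odd numbered discussion stages and Bob in the even numbered ones.
Alice's actions depend on her source samples, her local randomness, her previous channel inputs and
the previous messages; Bob's on his source samples, his local randomness, the previous channel
outputs and the previous messages. -/
structure ChannelProtocol (𝓐 𝓑 𝓧 𝓨 𝓕 𝓖 : Type) (n k : ℕ) where
  ZA : Type
  ZB : Type
  [measZA : MeasurableSpace ZA]
  [measZB : MeasurableSpace ZB]
  lawA : Measure ZA
  lawB : Measure ZB
  [probA : IsProbabilityMeasure lawA]
  [probB : IsProbabilityMeasure lawB]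
  Msg : Type
  [countableMsg : Countable Msg]
  schedule : List Step
  count_send : schedule.count Step.send = n
  aliceMsg : (Fin k → 𝓐) → ZA → List 𝓧 → List Msg → Msg
  bobMsg : (Fin k → 𝓑) → ZB → List 𝓨 → List Msg → Msg
  /-- the next channel input -/
  input : (Fin k → 𝓐) → ZA → List 𝓧 → List Msg → 𝓧
  aliceEst : (Fin k → 𝓐) → ZA → List 𝓧 → List Msg → (Fin k → 𝓕)
  bobEst : (Fin k → 𝓑) → ZB → List 𝓨 → List Msg → (Fin k → 𝓖)
  meas_aliceMsg : ∀ a x h c, MeasurableSet {z | aliceMsg a z x h = c}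
  meas_bobMsg : ∀ b y h c, MeasurableSet {z | bobMsg b z y h = c}
  meas_input : ∀ a x h c, MeasurableSet {z | input a z x h = c}
  meas_aliceEst : ∀ a x h c, MeasurableSet {z | aliceEst a z x h = c}
  meas_bobEst : ∀ b y h c, MeasurableSet {z | bobEst b z y h = c}

namespace ChannelProtocol

attribute [instance] measZA measZB probA probB countableMsg

variable {𝓐 𝓑 𝓧 𝓨 𝓕 𝓖 : Type} {n k : ℕ}

/-- Run the remaining steps from the current channel inputs, channel outputs and messages; the
list of functions gives the action of the remaining channel uses on their input. (The schedule has
exactly `n` channel uses, so the last case does not occur when there are `n` such functions.) -/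
def run (π : ChannelProtocol 𝓐 𝓑 𝓧 𝓨 𝓕 𝓖 n k) (a : Fin k → 𝓐) (b : Fin k → 𝓑)
    (zA : π.ZA) (zB : π.ZB) :
    List Step → List (𝓧 → 𝓨) → List 𝓧 → List 𝓨 → List π.Msg →
      List 𝓧 × List 𝓨 × List π.Msg
  | [], _, xs, ys, ms => (xs, ys, ms)
  | Step.talk :: s, ws, xs, ys, ms =>
      run π a b zA zB s ws xs ys
        (ms ++ [if Even ms.length then π.aliceMsg a zA xs ms else π.bobMsg b zB ys ms])
  | Step.send :: s, w :: ws, xs, ys, ms =>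
      run π a b zA zB s ws (xs ++ [π.input a zA xs ms]) (ys ++ [w (π.input a zA xs ms)]) ms
  | Step.send :: _, [], xs, ys, ms => (xs, ys, ms)

/-- The sample space: `(((A^k, B^k), channel noise), (Z_A, Z_B))`. The noise of the `i`-th channel
use is the function that maps each possible input `x` to the output that `x` would produce. -/
abbrev Space (π : ChannelProtocol 𝓐 𝓑 𝓧 𝓨 𝓕 𝓖 n k) : Type :=
  (((Fin k → 𝓐) × (Fin k → 𝓑)) × (Fin n → 𝓧 → 𝓨)) × (π.ZA × π.ZB)

/-- The triple `(X^n, Y^n, M^r)` as a random variable. -/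
def execution (π : ChannelProtocol 𝓐 𝓑 𝓧 𝓨 𝓕 𝓖 n k) (ω : π.Space) :
    List 𝓧 × List 𝓨 × List π.Msg :=
  π.run ω.1.1.1 ω.1.1.2 ω.2.1 ω.2.2 π.schedule (List.ofFn ω.1.2) [] [] []

variable [MeasurableSpace 𝓐] [MeasurableSpace 𝓑] [Fintype 𝓧] [MeasurableSpace 𝓨]

/-- The law on the sample space: `(A^k,B^k)`, the noise of the `n` channel uses, `Z_A` and `Z_B`
are independent. The output that an input `x` would produce has law `W x`, so that, given all that
happened before a channel use and its input `x`, its output has law `W x`. -/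
def law (π : ChannelProtocol 𝓐 𝓑 𝓧 𝓨 𝓕 𝓖 n k) (PAB : Measure ((Fin k → 𝓐) × (Fin k → 𝓑)))
    (W : 𝓧 → PMF 𝓨) : Measure π.Space :=
  (PAB.prod (Measure.pi fun _ : Fin n => Measure.pi fun x : 𝓧 => (W x).toMeasure)).prod
    (π.lawA.prod π.lawB)

/-- Correctness and privacy with tolerance `ε` of a channel-model protocol. -/
def IsSecure [Fintype 𝓐] [Fintype 𝓑] [Fintype 𝓕] [Fintype 𝓖]
    (π : ChannelProtocol 𝓐 𝓑 𝓧 𝓨 𝓕 𝓖 n k) (PAB : Measure ((Fin k → 𝓐) × (Fin k → 𝓑)))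
    (W : 𝓧 → PMF 𝓨) (f : 𝓐 → 𝓑 → 𝓕) (g : 𝓐 → 𝓑 → 𝓖) (ε : ℝ) : Prop :=
  IsSecureExecution f g ε (π.law PAB W)
    (fun ω => ω.1.1.1) (fun ω => ω.1.1.2)
    (fun ω => (ω.2.1, (π.execution ω).1, (π.execution ω).2.2))
    (fun ω => (ω.2.2, (π.execution ω).2.1, (π.execution ω).2.2))
    (fun ω => π.aliceEst ω.1.1.1 ω.2.1 (π.execution ω).1 (π.execution ω).2.2)
    (fun ω => π.bobEst ω.1.1.2 ω.2.2 (π.execution ω).2.1 (π.execution ω).2.2)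

end ChannelProtocol

/-! ### Rates and capacity -/

/-- The rate `R` is attained, where `good n k ε` says that an admissible `(n,k)`-protocol is
correct and private with tolerance `ε`. -/
def AttainsRate (good : ℕ → ℕ → ℝ → Prop) (R : ℝ) : Prop :=
  ∀ ε : ℝ, 0 < ε → ∀ᶠ n : ℕ in atTop, ∃ k : ℕ, R - ε < (k : ℝ) / n ∧ good n k ε

/-- `C` is the largest achievable rate `R > 0`, or `0` if no rate `R > 0` is achievable. -/
def IsCapacity (good : ℕ → ℕ → ℝ → Prop) (C : ℝ) : Prop :=
  IsGreatest (insert 0 {R : ℝ | 0 < R ∧ AttainsRate good R}) C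

/-! ### Sample-wise oblivious transfer -/

/-- Alice's function is constant. -/
def otF {m : ℕ} : (Fin m → Bool) → Fin m → Fin 1 := fun _ _ => 0

/-- Bob's function selects the bit with number `b`. -/
def otG {m : ℕ} : (Fin m → Bool) → Fin m → Bool := fun a b => a b

/-- The uniform distribution of `(A^k, B^k)`. -/
def uniformSource (m k : ℕ) : Measure ((Fin k → Fin m → Bool) × (Fin k → Fin m)) :=
  uniformOn Set.univ

/-- Source-model protocols for 1-out-of-`m` sample-wise OT. -/
abbrev OTSourceProtocol (𝓧 𝓨 : Type) (m n k : ℕ) : Type 1 :=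
  SourceProtocol (Fin m → Bool) (Fin m) 𝓧 𝓨 (Fin 1) Bool n k

/-- Channel-model protocols for 1-out-of-`m` sample-wise OT. -/
abbrev OTChannelProtocol (𝓧 𝓨 : Type) (m n k : ℕ) : Type 1 :=
  ChannelProtocol (Fin m → Bool) (Fin m) 𝓧 𝓨 (Fin 1) Bool n k

/-- `C` is the 1-out-of-`m` sample-wise OT capacity of source-model correlated randomness `PXY` for
the uniform source distribution. -/
def IsOTSourceCapacity {𝓧 𝓨 : Type} [MeasurableSpace 𝓧] [MeasurableSpace 𝓨] (m : ℕ)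
    (PXY : PMF (𝓧 × 𝓨)) (C : ℝ) : Prop :=
  IsCapacity (fun n k ε => ∃ π : OTSourceProtocol 𝓧 𝓨 m n k,
    π.IsSecure (uniformSource m k) PXY otF otG ε) C

/-- `C` is the 1-out-of-`m` sample-wise OT capacity of the discrete memoryless channel `W` for
the uniform source distribution. -/
def IsOTChannelCapacity {𝓧 𝓨 : Type} [Fintype 𝓧] [MeasurableSpace 𝓨] (m : ℕ)
    (W : 𝓧 → PMF 𝓨) (C : ℝ) : Prop :=
  IsCapacity (fun n k ε => ∃ π : OTChannelProtocol 𝓧 𝓨 m n k,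
    π.IsSecure (uniformSource m k) W otF otG ε) C

/-! ### The binary erasure channel and source -/

/-- The binary erasure channel with erasure probability `p`; `none` is the erasure symbol. -/
def bec (p : ℝ) (hp : p ∈ Set.Icc (0 : ℝ) 1) (x : Bool) : PMF (Option Bool) :=
  PMF.ofFintype
    (fun y => ENNReal.ofReal
      (p * (if y = none then 1 else 0) + (1 - p) * (if y = some x then 1 else 0)))
    (by
      cases x <;>
        simp [Fintype.sum_option, ← ENNReal.ofReal_add, hp.1, hp.2])

/-- The joint law of input and output of a channel for a given input distribution. -/
def jointLaw {𝓧 𝓨 : Type} (PX : PMF 𝓧) (W : 𝓧 → PMF 𝓨) : PMF (𝓧 × 𝓨) :=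
  PX.bind fun x => (W x).map fun y => (x, y)

/-- The binary erasure source with erasure probability `p`. -/
def bes (p : ℝ) (hp : p ∈ Set.Icc (0 : ℝ) 1) : PMF (Bool × Option Bool) :=
  jointLaw (PMF.uniformOfFintype Bool) (bec p hp)

/-- The quantity `min (I(X;Y), H(X|Y)/(m-1))` for `(X,Y)` with joint law `PXY`. -/
def otBound {𝓧 𝓨 : Type} [Fintype 𝓧] [MeasurableSpace 𝓧] [Fintype 𝓨] [MeasurableSpace 𝓨] (m : ℕ)
    (PXY : PMF (𝓧 × 𝓨)) : ℝ :=
  min (mutualInfo PXY.toMeasure Prod.fst Prod.snd).toReal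
    (condEntropy PXY.toMeasure Prod.fst Prod.snd / ((m : ℝ) - 1))

/-! ### The SWOT protocol -/

section SWOT

variable {m n k : ℕ}

/-- The locations of the non-erasures. -/
def nonErasures (y : Fin n → Option Bool) : Finset (Fin n) :=
  Finset.univ.filter fun i => y i ≠ none

/-- The locations of the erasures. -/
def erasures (y : Fin n → Option Bool) : Finset (Fin n) :=
  Finset.univ.filter fun i => y i = none

/-- The `k × m` matrices of distinct locations with non-erasures at the positions `(i, b i)` and
erasures at all other positions. -/
def indexMatrices (b : Fin k → Fin m) (y : Fin n → Option Bool) :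
    Finset (Fin k → Fin m → Fin n) :=
  open Classical in
  Finset.univ.filter fun U =>
    (∀ i j i' j', U i j = U i' j' → i = i' ∧ j = j') ∧
      ∀ i j, (j = b i → U i j ∈ nonErasures y) ∧ (j ≠ b i → U i j ∈ erasures y)

theorem indexMatrices_nonempty (b : Fin k → Fin m) (y : Fin n → Option Bool)
    (h : k ≤ (nonErasures y).card ∧ k * (m - 1) ≤ (erasures y).card) :
    (indexMatrices b y).Nonempty := by
  classical
  obtain ⟨e⟩ : Nonempty (Fin k ↪ nonErasures y) := by
    apply Function.Embedding.nonempty_of_card_le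
    simpa using h.1
  obtain ⟨e'⟩ : Nonempty ((Σ i : Fin k, {j : Fin m // j ≠ b i}) ↪ erasures y) := by
    apply Function.Embedding.nonempty_of_card_le
    simpa using h.2
  have hd : ∀ t, t ∈ nonErasures y → t ∉ erasures y := by
    intro t
    simp [nonErasures, erasures]
  refine ⟨fun i j => if hj : j = b i then (e i : Fin n) else (e' ⟨i, j, hj⟩ : Fin n), ?_⟩
  simp only [indexMatrices, Finset.mem_filter, Finset.mem_univ, true_and]
  refine ⟨fun i j i' j' hU => ?_, fun i j => ⟨fun hj => ?_, fun hj => ?_⟩⟩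
  · by_cases hj : j = b i <;> by_cases hj' : j' = b i'
    · simp only [hj, hj', dite_true] at hU
      have : i = i' := e.injective (Subtype.ext hU)
      subst this
      exact ⟨rfl, hj.trans hj'.symm⟩
    · simp only [hj, hj', dite_true, dite_false] at hU
      exact absurd (e' ⟨i', j', hj'⟩).2 (hd _ (hU ▸ (e i).2))
    · simp only [hj, hj', dite_true, dite_false] at hU
      exact absurd (e' ⟨i, j, hj⟩).2 (hd _ (hU ▸ (e i').2))
    · simp only [hj, hj', dite_false] at hU
      have := e'.injective (Subtype.ext hU)
      simp only [Sigma.mk.injEq] at this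
      obtain ⟨rfl, h2⟩ := this
      exact ⟨rfl, congrArg Subtype.val (eq_of_heq h2)⟩
  · simp [hj, (e i).2]
  · simp [hj, (e' ⟨i, j, hj⟩).2]

/-- The law of Bob's random matrix: uniform on `indexMatrices b y` if there are enough erasures and
non-erasures, and otherwise `none` (abort). Filling the positions `(i, b i)` and the other positions
by uniform selections without replacement from the non-erasures and from the erasures gives exactly
the uniform law on `indexMatrices b y`. -/
def indexLaw (b : Fin k → Fin m) (y : Fin n → Option Bool) :
    PMF (Option (Fin k → Fin m → Fin n)) :=
  if h : k ≤ (nonErasures y).card ∧ k * (m - 1) ≤ (erasures y).card then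
    (PMF.uniformOfFinset (indexMatrices b y) (indexMatrices_nonempty b y h)).map some
  else PMF.pure none

/-- Bob's local randomness: one random matrix for each value `(b, y)` of his data; he uses the one
that belongs to his actual data. -/
abbrev IndexTable (m n k : ℕ) : Type :=
  (Fin k → Fin m) × (Fin n → Option Bool) → Option (Fin k → Fin m → Fin n)

/-- The matrices of Bob's table are independent, that of `(b, y)` having law `indexLaw b y`. -/
def indexTableLaw (m n k : ℕ) : Measure (IndexTable m n k) :=
  Measure.pi fun q => (indexLaw q.1 q.2).toMeasure

instance instIsProbabilityMeasureIndexTableLaw :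
    IsProbabilityMeasure (indexTableLaw m n k) := by
  unfold indexTableLaw
  infer_instance

/-- The messages are matrices of locations, binary matrices, and an empty message `none`, which
in Bob's stage means that he aborts. -/
abbrev SwotMsg (m n k : ℕ) : Type :=
  Option ((Fin k → Fin m → Fin n) ⊕ (Fin k → Fin m → Bool))

/-- Alice is silent in stage 1. In stage 3 she answers a matrix `U` by `a ⊕ x_U`. -/
def swotAlice (a : Fin k → Fin m → Bool) (x : Fin n → Bool) :
    List (SwotMsg m n k) → SwotMsg m n k
  | [_, some (Sum.inl U)] => some (Sum.inr fun i j => xor (a i j) (x (U i j)))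
  | _ => none

/-- In stage 2, Bob sends his random matrix, or aborts. -/
def swotBob (b : Fin k → Fin m) (y : Fin n → Option Bool) (z : IndexTable m n k) :
    SwotMsg m n k :=
  (z (b, y)).map Sum.inl

/-- Bob's estimate: he undoes the exclusive-or at the positions `(i, b i)`, where `y_U` is not
erased; if the protocol was aborted, his estimate is `0^k`. -/
def swotEst (b : Fin k → Fin m) (y : Fin n → Option Bool) :
    List (SwotMsg m n k) → Fin k → Bool
  | [_, some (Sum.inl U), some (Sum.inr c)] =>
      fun i => xor (c i (b i)) ((y (U i (b i))).getD false)
  | _ => fun _ => false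

/-- The SWOT protocol as a source-model protocol for the binary erasure source. -/
def swotSource (m n k : ℕ) : OTSourceProtocol Bool (Option Bool) m n k where
  ZA := Unit
  ZB := IndexTable m n k
  lawA := Measure.dirac ()
  lawB := indexTableLaw m n k
  Msg := SwotMsg m n k
  r := 3
  aliceMsg a x _ h := swotAlice a x h
  bobMsg b y z _ := swotBob b y z
  aliceEst _ _ _ _ := fun _ => 0
  bobEst b y _ h := swotEst b y h
  meas_aliceMsg _ _ _ _ := MeasurableSet.of_discrete
  meas_bobMsg _ _ _ _ := MeasurableSet.of_discrete
  meas_aliceEst _ _ _ _ := MeasurableSet.of_discrete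
  meas_bobEst _ _ _ _ := MeasurableSet.of_discrete

/-- The SWOT protocol as a channel-model protocol for the binary erasure channel: Alice first
transmits `n` iid uniform bits, and then the discussion takes place as in the source model. (During
the discussion the lists of inputs and outputs have length `n`, so the default values of `getD`
play no role.) -/
def swotChannel (m n k : ℕ) : OTChannelProtocol Bool (Option Bool) m n k where
  ZA := Fin n → Bool
  ZB := IndexTable m n k
  lawA := Measure.pi fun _ => (PMF.uniformOfFintype Bool).toMeasure
  lawB := indexTableLaw m n k
  Msg := SwotMsg m n k
  schedule := List.replicate n Step.send ++ List.replicate 3 Step.talk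
  count_send := by simp
  aliceMsg a _ xs h := swotAlice a (fun i => xs.getD i false) h
  bobMsg b z ys _ := swotBob b (fun i => ys.getD i none) z
  input _ z xs _ := (List.ofFn z).getD xs.length false
  aliceEst _ _ _ _ := fun _ => 0
  bobEst b _ ys h := swotEst b (fun i => ys.getD i none) h
  meas_aliceMsg _ _ _ _ := MeasurableSet.of_discrete
  meas_bobMsg _ _ _ _ := MeasurableSet.of_discrete
  meas_input _ _ _ _ := MeasurableSet.of_discrete
  meas_aliceEst _ _ _ _ := MeasurableSet.of_discrete
  meas_bobEst _ _ _ _ := MeasurableSet.of_discrete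

end SWOT

end

end SFC

namespace SFC

set_option linter.unusedSectionVars false

/-! ### Events and the Kullback-Leibler divergence -/

/-! The converse is a pair of counting arguments about events, without entropy calculus;
achievability is an exact analysis of SWOT.

Privacy is used only to compare probabilities. If `I(U;V|W)` is small, an event about `(U,V,W)` is
unlikely under the true law exactly when it is unlikely after `U` and `V` have been made independent
given `W`, up to a factor 2 and an additive error (`measure_le_condMutualInfo_add`, `decoupled_le`).
For Bob's privacy the decoupled law has `B` uniform and independent of Alice's data, and is
therefore invariant under permutations of the values of `B`: a relation between Alice's view and `B`
that holds with high probability also holds with high probability for `B` shifted. For Alice's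
privacy, `A` given `(B,G)` is uniform on `2^(k(m-1))` values, and Bob cannot confine it to a much
shorter list (`alice_privacy_list`). The two models enter only through `ErasureExecution`: the joint
law is a factor of Alice times a factor of Bob times the channel.

Few non-erasures: replacing the channel by one whose output ignores the input costs a factor 2 for
each non-erased symbol. If at most `s` symbols survive, the messages alone confine Bob's bits to
about `2^s` values (`exists_list`). Bob's privacy gives the same for a shifted choice that differs
from `B` in every coordinate, so Bob can list about `2^s * 2^(k(m-2))` candidates for `A`. Alice's
privacy then forces `k ≤ s + 6`.

Few erasures: given `X` and the messages, a decoder on Alice's side finds the selected bits as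
reliably as Bob does (`exists_decoder`). Bob's privacy makes it work for all `m` shifts of `B`, so
`X` and the messages determine all of `A`. Bob knows `X` up to the erased positions, hence lists at
most `2^t` candidates when there are at most `t` erasures, and `k(m-1) ≤ t + 2`. Chebyshev's
inequality for the number of erasures turns both bounds into bounds on the rate.

In SWOT both leaked informations vanish. Changing unselected bits of `A` is compensated by flipping
`X` at erased locations, which Bob does not see; changing `B` is compensated by moving the erasures,
which Alice does not see. Errors occur only on aborts, which Chebyshev controls. The channel version
maps measure-preservingly onto the source version. Finally, for `P(X=1)=q` the erasure channel has
`I = (1-p)h(q)` and `H(X|Y) = p h(q)` with `h ≤ 1`, `h` being the binary entropy in bits. -/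

theorem le_klFun_add_two {x : ℝ} (hx : 0 ≤ x) : x ≤ InformationTheory.klFun x + 2 := by
  rcases hx.eq_or_lt with rfl | hx
  · norm_num [InformationTheory.klFun]
  -- This gives `2x - x log x ≤ e`, and `e ≤ 3` is all that the constant 2 requires.
  · have h1 := Real.add_one_le_exp (1 - Real.log x)
    have h2 : x * Real.exp (1 - Real.log x) = Real.exp 1 := by
      rw [Real.exp_sub, Real.exp_log hx]; field_simp
    have h3 := mul_le_mul_of_nonneg_left h1 hx.le
    have h4 := Real.exp_one_lt_d9
    rw [h2] at h3
    simp only [InformationTheory.klFun]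
    nlinarith

/-- The right side is `2(x log x + 1)`, and `x log x ≥ -1/e ≥ -1/2`. -/
theorem one_le_two_mul_klFun_add {x : ℝ} (hx : 0 ≤ x) :
    1 ≤ 2 * (InformationTheory.klFun x + x) := by
  rcases hx.eq_or_lt with rfl | hx
  · simp [InformationTheory.klFun]
  · have h1 := Real.add_one_le_exp (-1 - Real.log x)
    have h2 : x * Real.exp (-1 - Real.log x) = Real.exp (-1) := by
      rw [Real.exp_sub, Real.exp_log hx]; field_simp
    have h3 := mul_le_mul_of_nonneg_left h1 hx.le
    have h4 : Real.exp (-1) ≤ 1 / 2 := by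
      rw [Real.exp_neg, inv_le_comm₀ (Real.exp_pos _) (by norm_num)]
      have := Real.exp_one_gt_d9
      linarith
    rw [h2] at h3
    simp only [InformationTheory.klFun]
    nlinarith

section KL

variable {α : Type*} [MeasurableSpace α] (μ ν : Measure α) [IsFiniteMeasure μ] [IsFiniteMeasure ν]

/-- The pointwise bound on `klFun`, applied to the density and integrated over `E` only. This is
cruder than Pinsker's inequality, but only fixed small constants are needed later. -/
theorem measure_le_klDiv_add (E : Set α) :
    μ E ≤ InformationTheory.klDiv μ ν + 2 * ν E := by
  by_cases hac : μ ≪ ν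
  · rw [InformationTheory.klDiv_eq_lintegral_klFun_of_ac hac, ← Measure.setLIntegral_rnDeriv hac E]
    calc ∫⁻ x in E, μ.rnDeriv ν x ∂ν
        ≤ ∫⁻ x in E, (ENNReal.ofReal (InformationTheory.klFun (μ.rnDeriv ν x).toReal) + 2) ∂ν := by
          refine lintegral_mono_ae (ae_restrict_of_ae ?_)
          filter_upwards [μ.rnDeriv_ne_top ν] with x hx
          rw [← ENNReal.ofReal_toReal hx]
          simp only [ENNReal.toReal_ofReal ENNReal.toReal_nonneg]
          calc ENNReal.ofReal (μ.rnDeriv ν x).toReal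
              ≤ ENNReal.ofReal (InformationTheory.klFun (μ.rnDeriv ν x).toReal + 2) :=
                ENNReal.ofReal_le_ofReal (le_klFun_add_two ENNReal.toReal_nonneg)
            _ ≤ _ := ENNReal.ofReal_add_le.trans (by simp)
      _ = ∫⁻ x in E, ENNReal.ofReal (InformationTheory.klFun (μ.rnDeriv ν x).toReal) ∂ν
            + 2 * ν E := by
          rw [lintegral_add_right _ measurable_const]; simp
      _ ≤ _ := by gcongr; exact Measure.restrict_le_self
  · simp [InformationTheory.klDiv_of_not_ac hac]

/-- The reverse comparison: an event that is rare under `μ` is also rare under `ν`. -/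
theorem measure_le_two_mul_klDiv_add (E : Set α) :
    ν E ≤ 2 * (InformationTheory.klDiv μ ν + μ E) := by
  by_cases hac : μ ≪ ν
  · rw [InformationTheory.klDiv_eq_lintegral_klFun_of_ac hac, ← Measure.setLIntegral_rnDeriv hac E]
    calc ν E = ∫⁻ _ in E, 1 ∂ν := by simp
      _ ≤ ∫⁻ x in E, 2 * (ENNReal.ofReal (InformationTheory.klFun (μ.rnDeriv ν x).toReal)
            + μ.rnDeriv ν x) ∂ν := by
          refine lintegral_mono_ae (ae_restrict_of_ae ?_)
          filter_upwards [μ.rnDeriv_ne_top ν] with x hx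
          rw [← ENNReal.ofReal_toReal hx]
          simp only [ENNReal.toReal_ofReal ENNReal.toReal_nonneg]
          rw [← ENNReal.ofReal_add (InformationTheory.klFun_nonneg ENNReal.toReal_nonneg)
            ENNReal.toReal_nonneg, ← ENNReal.ofReal_ofNat 2, ← ENNReal.ofReal_mul (by norm_num)]
          exact ENNReal.one_le_ofReal.2 (one_le_two_mul_klFun_add ENNReal.toReal_nonneg)
      _ = 2 * (∫⁻ x in E, ENNReal.ofReal (InformationTheory.klFun (μ.rnDeriv ν x).toReal) ∂ν
            + ∫⁻ x in E, μ.rnDeriv ν x ∂ν) := by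
          rw [lintegral_const_mul' _ _ (by simp), lintegral_add_right _ (μ.measurable_rnDeriv ν)]
      _ ≤ _ := by gcongr; exact Measure.restrict_le_self
  · simp [InformationTheory.klDiv_of_not_ac hac]

end KL

/-! ### Conditional mutual information and the decoupled law -/

section Cond

variable {Ω α β γ : Type*} [MeasurableSpace Ω] [MeasurableSpace α] [MeasurableSpace β]
  [Fintype γ] (P : Measure Ω) [IsProbabilityMeasure P] {U : Ω → α} {V : Ω → β} {W : Ω → γ}

/-- Passing from nats to bits divides by `log 2 ≤ 1`. -/
theorem klDiv_le_mutualInfo (U : Ω → α) (V : Ω → β) :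
    InformationTheory.klDiv (P.map fun ω => (U ω, V ω)) ((P.map U).prod (P.map V))
      ≤ mutualInfo P U V := by
  rw [mutualInfo, ENNReal.div_eq_inv_mul]
  refine le_mul_of_one_le_left (by simp) ?_
  rw [ENNReal.one_le_inv]
  have : Real.log 2 ≤ 1 := by have := Real.log_two_lt_d9; linarith
  simpa using ENNReal.ofReal_le_ofReal this

/-- The probability of `E` when, given `W`, the variables `U` and `V` are made independent. -/
noncomputable def decoupled [Fintype α] (P : Measure Ω) (U : Ω → α) (V : Ω → β) (W : Ω → γ)
    (E : γ → α → Set β) : ℝ≥0∞ :=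
  ∑ w, ∑ u, P[|W ⁻¹' {w}] (U ⁻¹' {u}) * P (W ⁻¹' {w} ∩ V ⁻¹' E w u)

theorem measure_eq_sum_fiber (hW : ∀ w, MeasurableSet (W ⁻¹' {w})) (S : Set Ω) :
    P S = ∑ w, P (W ⁻¹' {w} ∩ S) := by
  have := measure_biUnion_finset (μ := P.restrict S) (s := Finset.univ) (f := fun w => W ⁻¹' {w})
    (by intro a _ b _ hab; exact Set.disjoint_left.2 fun x hx hy => hab (hx.symm.trans hy))
    (fun w _ => hW w)
  have h2 : (⋃ w ∈ (Finset.univ : Finset γ), W ⁻¹' {w}) = Set.univ := by ext; simp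
  rw [h2, Measure.restrict_apply_univ] at this
  rw [this]
  exact Finset.sum_congr rfl fun w _ => Measure.restrict_apply (hW w)

theorem fiber_mul_cond (hW : ∀ w, MeasurableSet (W ⁻¹' {w})) (w : γ) (S : Set Ω) :
    P (W ⁻¹' {w}) * P[|W ⁻¹' {w}] S = P (W ⁻¹' {w} ∩ S) := by
  rw [mul_comm, cond_mul_eq_inter (hW w)]

variable [Fintype α] [MeasurableSingletonClass α]

theorem prod_map_apply (Q : Measure Ω) [IsFiniteMeasure Q] (hU : Measurable U) (hV : Measurable V)
    (E : α → Set β) (hE : ∀ u, MeasurableSet (E u)) :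
    ((Q.map U).prod (Q.map V)) {x | x.2 ∈ E x.1} = ∑ u, Q (U ⁻¹' {u}) * Q (V ⁻¹' E u) := by
  have hm : MeasurableSet {x : α × β | x.2 ∈ E x.1} := by
    have : {x : α × β | x.2 ∈ E x.1} = ⋃ u, {u} ×ˢ E u := by
      ext ⟨a, b⟩; simp
    rw [this]
    exact MeasurableSet.iUnion fun u => (measurableSet_singleton u).prod (hE u)
  rw [Measure.prod_apply hm, lintegral_fintype]
  refine Finset.sum_congr rfl fun u _ => ?_
  rw [Measure.map_apply hU (measurableSet_singleton u), mul_comm]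
  congr 1
  rw [show Prod.mk u ⁻¹' {x : α × β | x.2 ∈ E x.1} = E u from rfl, Measure.map_apply hV (hE u)]

theorem map_pair_apply (Q : Measure Ω) (hU : Measurable U) (hV : Measurable V)
    (E : α → Set β) (hE : ∀ u, MeasurableSet (E u)) :
    (Q.map fun ω => (U ω, V ω)) {x | x.2 ∈ E x.1} = Q {ω | V ω ∈ E (U ω)} := by
  have hm : MeasurableSet {x : α × β | x.2 ∈ E x.1} := by
    have : {x : α × β | x.2 ∈ E x.1} = ⋃ u, {u} ×ˢ E u := by
      ext ⟨a, b⟩; simp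
    rw [this]
    exact MeasurableSet.iUnion fun u => (measurableSet_singleton u).prod (hE u)
  rw [Measure.map_apply (hU.prodMk hV) hm]
  rfl

theorem decoupled_eq (hW : ∀ w, MeasurableSet (W ⁻¹' {w})) (E : γ → α → Set β) :
    decoupled P U V W E = ∑ w, P (W ⁻¹' {w}) *
      ∑ u, P[|W ⁻¹' {w}] (U ⁻¹' {u}) * P[|W ⁻¹' {w}] (V ⁻¹' E w u) := by
  refine Finset.sum_congr rfl fun w _ => ?_
  rw [Finset.mul_sum]
  refine Finset.sum_congr rfl fun u _ => ?_
  rw [← fiber_mul_cond P hW]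
  ring

/-- The comparison of measures is applied on each fibre of `W` to the joint law and the product of
the marginals, and averaged over `W`. The event may depend on `W` and `U`. -/
theorem measure_le_condMutualInfo_add (hU : Measurable U) (hV : Measurable V)
    (hW : ∀ w, MeasurableSet (W ⁻¹' {w})) (E : γ → α → Set β) (hE : ∀ w u, MeasurableSet (E w u)) :
    P {ω | V ω ∈ E (W ω) (U ω)} ≤ condMutualInfo P U V W + 2 * decoupled P U V W E := by
  rw [measure_eq_sum_fiber P hW, decoupled_eq P hW, condMutualInfo, Finset.mul_sum,
    ← Finset.sum_add_distrib]
  refine Finset.sum_le_sum fun w _ => ?_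
  have h := measure_le_klDiv_add ((P[|W ⁻¹' {w}]).map fun ω => (U ω, V ω))
    (((P[|W ⁻¹' {w}]).map U).prod ((P[|W ⁻¹' {w}]).map V)) {x | x.2 ∈ E w x.1}
  rw [map_pair_apply _ hU hV _ (hE w), prod_map_apply _ hU hV _ (hE w)] at h
  have h1 : W ⁻¹' {w} ∩ {ω | V ω ∈ E (W ω) (U ω)} = W ⁻¹' {w} ∩ {ω | V ω ∈ E w (U ω)} := by
    ext ω; simp +contextual
  rw [h1, ← fiber_mul_cond P hW, mul_left_comm 2, ← mul_add]
  by_cases h0 : P (W ⁻¹' {w}) = 0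
  · simp [h0]
  have := cond_isProbabilityMeasure h0
  gcongr
  exact h.trans (add_le_add (klDiv_le_mutualInfo _ U V) le_rfl)

theorem decoupled_le (hU : Measurable U) (hV : Measurable V)
    (hW : ∀ w, MeasurableSet (W ⁻¹' {w})) (E : γ → α → Set β) (hE : ∀ w u, MeasurableSet (E w u)) :
    decoupled P U V W E ≤ 2 * (condMutualInfo P U V W + P {ω | V ω ∈ E (W ω) (U ω)}) := by
  rw [measure_eq_sum_fiber P hW, decoupled_eq P hW, condMutualInfo,
    ← Finset.sum_add_distrib, Finset.mul_sum]
  refine Finset.sum_le_sum fun w _ => ?_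
  have h := measure_le_two_mul_klDiv_add ((P[|W ⁻¹' {w}]).map fun ω => (U ω, V ω))
    (((P[|W ⁻¹' {w}]).map U).prod ((P[|W ⁻¹' {w}]).map V)) {x | x.2 ∈ E w x.1}
  rw [map_pair_apply _ hU hV _ (hE w), prod_map_apply _ hU hV _ (hE w)] at h
  have h1 : W ⁻¹' {w} ∩ {ω | V ω ∈ E (W ω) (U ω)} = W ⁻¹' {w} ∩ {ω | V ω ∈ E w (U ω)} := by
    ext ω; simp +contextual
  rw [h1, ← fiber_mul_cond P hW, ← mul_add, mul_left_comm 2]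
  by_cases h0 : P (W ⁻¹' {w}) = 0
  · simp [h0]
  have := cond_isProbabilityMeasure h0
  gcongr
  refine h.trans ?_
  gcongr
  exact klDiv_le_mutualInfo _ U V

/-- If, given `W`, the variable `U` is uniform on a set and `V` does not depend on it, then
`I(U;V|W) = 0`. -/
theorem condMutualInfo_eq_zero (hU : Measurable U) (hV : Measurable V)
    (hW : ∀ w, MeasurableSet (W ⁻¹' {w})) (T : γ → Set α)
    (hT : ∀ w, ∀ u ∈ T w, ∀ u' ∈ T w, ∀ S, MeasurableSet S →
      P (W ⁻¹' {w} ∩ (U ⁻¹' {u} ∩ V ⁻¹' S)) = P (W ⁻¹' {w} ∩ (U ⁻¹' {u'} ∩ V ⁻¹' S)))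
    (h0 : ∀ w, ∀ u ∉ T w, P (W ⁻¹' {w} ∩ U ⁻¹' {u}) = 0) :
    condMutualInfo P U V W = 0 := by
  classical
  refine Finset.sum_eq_zero fun w _ => ?_
  by_cases hw : P (W ⁻¹' {w}) = 0
  · simp [hw]
  have := cond_isProbabilityMeasure hw
  set Q := P[|W ⁻¹' {w}] with hQ
  have hQT : ∀ u ∈ T w, ∀ u' ∈ T w, ∀ S, MeasurableSet S →
      Q (U ⁻¹' {u} ∩ V ⁻¹' S) = Q (U ⁻¹' {u'} ∩ V ⁻¹' S) := by
    intro u hu u' hu' S hS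
    rw [hQ, cond_apply (hW w), cond_apply (hW w), hT w u hu u' hu' S hS]
  have hQ0 : ∀ u ∉ T w, ∀ S, Q (U ⁻¹' {u} ∩ S) = 0 := by
    intro u hu S
    refine measure_mono_null Set.inter_subset_left ?_
    rw [hQ, cond_apply (hW w), h0 w u hu, mul_zero]
  have hfib : ∀ S, Q S = ∑ u, Q (U ⁻¹' {u} ∩ S) := fun S =>
    measure_eq_sum_fiber Q (fun u => hU (measurableSet_singleton u)) S
  -- Summing over the fibres of `U` gives `Q(V ∈ S) = c * Q(U = u, V ∈ S)` for `u ∈ T w`. The case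
  -- of the full set `S` says `c * Q(U = u) = 1`, and together these give independence.
  set c := (Finset.univ.filter fun u => u ∈ T w).card with hc
  have key : ∀ u ∈ T w, ∀ S, MeasurableSet S → Q (V ⁻¹' S) = c * Q (U ⁻¹' {u} ∩ V ⁻¹' S) := by
    intro u hu S hS
    rw [hfib, ← Finset.sum_filter_add_sum_filter_not _ (fun u => u ∈ T w),
      Finset.sum_congr rfl (g := fun _ => Q (U ⁻¹' {u} ∩ V ⁻¹' S))
        (fun u' hu' => hQT u' (Finset.mem_filter.1 hu').2 u hu S hS),
      Finset.sum_eq_zero (s := Finset.filter (fun u => u ∉ T w) _)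
        (fun u' hu' => hQ0 u' (Finset.mem_filter.1 hu').2 _)]
    simp [hc]
  have hind : ∀ u S, MeasurableSet S → Q (U ⁻¹' {u} ∩ V ⁻¹' S) = Q (U ⁻¹' {u}) * Q (V ⁻¹' S) := by
    intro u S hS
    by_cases hu : u ∈ T w
    · have h1 := key u hu Set.univ MeasurableSet.univ
      simp only [Set.preimage_univ, Set.inter_univ, measure_univ] at h1
      rw [key u hu S hS, ← mul_assoc, mul_comm _ (c : ℝ≥0∞), ← h1, one_mul]
    · rw [hQ0 u hu, ← Set.inter_univ (U ⁻¹' {u}), hQ0 u hu, zero_mul]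
  have heq : Q.map (fun ω => (U ω, V ω)) = (Q.map U).prod (Q.map V) := by
    have := Measure.isProbabilityMeasure_map (μ := Q) hU.aemeasurable
    have := Measure.isProbabilityMeasure_map (μ := Q) hV.aemeasurable
    refine (Measure.prod_eq fun s t hs ht => ?_).symm
    rw [Measure.map_apply (hU.prodMk hV) (hs.prod ht), Measure.map_apply hU hs,
      Measure.map_apply hV ht, hfib, hfib (U ⁻¹' s), Finset.sum_mul]
    refine Finset.sum_congr rfl fun u _ => ?_
    by_cases hus : u ∈ s
    · have e1 : U ⁻¹' {u} ∩ (fun ω => (U ω, V ω)) ⁻¹' s ×ˢ t = U ⁻¹' {u} ∩ V ⁻¹' t := by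
        ext ω; simp only [Set.mem_inter_iff, Set.mem_preimage, Set.mem_singleton_iff, Set.mem_prod]
        constructor
        · rintro ⟨h, -, h2⟩; exact ⟨h, h2⟩
        · rintro ⟨h, h2⟩; exact ⟨h, h ▸ hus, h2⟩
      have e2 : U ⁻¹' {u} ∩ U ⁻¹' s = U ⁻¹' {u} := by
        ext ω; simp only [Set.mem_inter_iff, Set.mem_preimage, Set.mem_singleton_iff]
        constructor
        · rintro ⟨h, -⟩; exact h
        · rintro h; exact ⟨h, h ▸ hus⟩
      rw [e1, e2, hind u t ht]
    · have e1 : U ⁻¹' {u} ∩ (fun ω => (U ω, V ω)) ⁻¹' s ×ˢ t = ∅ := by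
        ext ω; simp only [Set.mem_inter_iff, Set.mem_preimage, Set.mem_singleton_iff, Set.mem_prod,
          Set.mem_empty_iff_false, iff_false]
        rintro ⟨h, h1, -⟩; exact hus (h ▸ h1)
      have e2 : U ⁻¹' {u} ∩ U ⁻¹' s = ∅ := by
        ext ω; simp only [Set.mem_inter_iff, Set.mem_preimage, Set.mem_singleton_iff,
          Set.mem_empty_iff_false, iff_false]
        rintro ⟨h, h1⟩; exact hus (h ▸ h1)
      rw [e1, e2]; simp
  rw [mutualInfo, heq, InformationTheory.klDiv_self]
  simp

end Cond

/-! ### Concentration of the number of hits -/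

/-- Chebyshev's inequality: the count is a sum of `n` independent indicators, each of variance at
most 1. -/
theorem pi_count_concentration {Z : Type*} [MeasurableSpace Z] (ν : Measure Z)
    [IsProbabilityMeasure ν] {D : Set Z} [DecidablePred (· ∈ D)] (hD : MeasurableSet D) {p : ℝ}
    (hp : ν.real D = p) {n : ℕ} (hn : 0 < n) {δ : ℝ} (hδ : 0 < δ) :
    (Measure.pi fun _ : Fin n => ν)
      {w | δ * n ≤ |((Finset.univ.filter fun i => w i ∈ D).card : ℝ) - n * p|} ≤
      ENNReal.ofReal (1 / (δ ^ 2 * n)) := by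
  set μ := Measure.pi fun _ : Fin n => ν
  set f : Z → ℝ := D.indicator 1 with hf
  have hfm : Measurable f := measurable_one.indicator hD
  have hfmem : MemLp f 2 ν := memLp_indicator_const 2 hD 1 (Or.inr (measure_ne_top _ _))
  have hmem : ∀ i, MemLp (fun w : Fin n → Z => f (w i)) 2 μ := fun i =>
    hfmem.comp_measurePreserving (measurePreserving_eval _ i)
  have hsum : ∀ w : Fin n → Z,
      ((Finset.univ.filter fun i => w i ∈ D).card : ℝ) = ∑ i, f (w i) := by
    intro w
    rw [Finset.card_filter]
    push_cast
    exact Finset.sum_congr rfl fun i _ => by simp [hf, Set.indicator_apply]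
  have hexp : ∫ z, f z ∂ν = p := by
    rw [hf, integral_indicator_one hD, hp]
  have hmean : ∫ w, ∑ i, f (w i) ∂μ = n * p := by
    rw [integral_finsetSum _ fun i _ => (hmem i).integrable (by norm_num)]
    have : ∀ i : Fin n, ∫ w, f (w i) ∂μ = p := by
      intro i
      rw [← hexp]
      exact integral_comp_eval (μ := fun _ : Fin n => ν) hfm.aestronglyMeasurable
    simp [this]
  have hvar1 : variance f ν ≤ 1 := by
    refine (variance_le_expectation_sq hfm.aestronglyMeasurable).trans ?_
    calc ∫ z, (f ^ 2) z ∂ν ≤ ∫ _, (1 : ℝ) ∂ν := by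
          refine integral_mono hfmem.integrable_sq (integrable_const _) fun z => ?_
          simp only [Pi.pow_apply, hf, Set.indicator_apply]
          split_ifs <;> simp
      _ = 1 := by simp
  have hvar : variance (fun w : Fin n → Z => ∑ i, f (w i)) μ ≤ n := by
    have h1 : (fun w : Fin n → Z => ∑ i, f (w i)) = ∑ i, fun w => f (w i) := by
      ext w; simp
    rw [h1, IndepFun.variance_sum (fun i _ => hmem i)
      (fun i _ j _ hij => (iIndepFun_pi (μ := fun _ : Fin n => ν) (X := fun _ => f)
        (fun _ => hfm.aemeasurable)).indepFun hij)]
    have : ∀ i : Fin n, variance (fun w : Fin n → Z => f (w i)) μ ≤ 1 := by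
      intro i
      have h3 := (measurePreserving_eval (fun _ : Fin n => ν) i).variance_fun_comp
        (f := f) hfm.aemeasurable
      rw [h3]; exact hvar1
    calc _ ≤ ∑ i : Fin n, (1 : ℝ) := Finset.sum_le_sum fun i _ => this i
      _ = n := by simp
  have hn' : (0 : ℝ) < n := by exact_mod_cast hn
  have := meas_ge_le_variance_div_sq (μ := μ) (X := fun w => ∑ i, f (w i))
    (by simpa using memLp_finsetSum Finset.univ fun i _ => hmem i) (c := δ * n) (by positivity)
  rw [hmean] at this
  simp only [hsum]
  refine this.trans (ENNReal.ofReal_le_ofReal ?_)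
  rw [div_le_div_iff₀ (by positivity) (by positivity)]
  have : (δ * n) ^ 2 = (δ ^ 2 * n) * n := by ring
  rw [this, one_mul, mul_comm]
  exact mul_le_mul_of_nonneg_left hvar (by positivity)

/-! ### Consequences of privacy for events -/

section Privacy

variable {Ω V : Type*} [MeasurableSpace Ω] [MeasurableSpace V] {m k : ℕ} (P : Measure Ω)
  [IsProbabilityMeasure P] {A : Ω → Fin k → Fin m → Bool} {B : Ω → Fin k → Fin m} {view : Ω → V}

/-- Double counting: the sum of the indicators is at most `N` on `H` and zero off `H`. -/
theorem sum_measure_le_of_card_le {ι : Type*} [Fintype ι] (F : ι → Set Ω) {H : Set Ω}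
    (hF : ∀ i, MeasurableSet (F i)) (hH : MeasurableSet H) (hFH : ∀ i, F i ⊆ H) (N : ℕ)
    (hN : ∀ ω, Set.ncard {i | ω ∈ F i} ≤ N) : ∑ i, P (F i) ≤ N * P H := by
  classical
  calc ∑ i, P (F i) = ∑ i, ∫⁻ ω, (F i).indicator 1 ω ∂P := by
        simp [lintegral_indicator_one (hF _)]
    _ = ∫⁻ ω, ∑ i, (F i).indicator 1 ω ∂P :=
        (lintegral_finsetSum _ fun i _ => measurable_one.indicator (hF i)).symm
    _ ≤ ∫⁻ ω, N * H.indicator 1 ω ∂P := by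
        refine lintegral_mono fun ω => ?_
        by_cases hω : ω ∈ H
        · have h1 : ∑ i, (F i).indicator (1 : Ω → ℝ≥0∞) ω = (Set.ncard {i | ω ∈ F i} : ℕ) := by
            rw [Set.ncard_eq_toFinset_card', Set.toFinset_ofPred, Finset.card_filter]
            push_cast
            exact Finset.sum_congr rfl fun i _ => by simp [Set.indicator_apply]
          rw [h1]
          simpa [hω] using hN ω
        · rw [Finset.sum_eq_zero fun i _ => by
            simpa using fun h => hω (hFH i h)]
          simp
    _ = N * P H := by
        rw [lintegral_const_mul _ (measurable_one.indicator hH), lintegral_indicator_one hH]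

theorem card_rows_eq (b : Fin k → Fin m) (g : Fin k → Bool) :
    (Finset.univ.filter fun a : Fin k → Fin m → Bool => samples otG a b = g).card
      = 2 ^ (k * (m - 1)) := by
  classical
  have h : (Finset.univ.filter fun a : Fin k → Fin m → Bool => samples otG a b = g) =
      Fintype.piFinset fun i => Fintype.piFinset fun j =>
        if j = b i then {g i} else Finset.univ := by
    ext a
    simp only [Finset.mem_filter, Finset.mem_univ, true_and, Fintype.mem_piFinset, samples, otG,
      funext_iff]
    refine ⟨fun h i j => ?_, fun h i => ?_⟩
    · split_ifs with hj
      · simp [hj, h i]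
      · simp
    · simpa using h i (b i)
  rw [h, Fintype.card_piFinset]
  simp only [Fintype.card_piFinset, apply_ite Finset.card]
  simp [Finset.prod_ite, Finset.filter_ne', Finset.card_erase_of_mem, ← pow_mul, mul_comm]

/-- The two choices differ in every coordinate, so exactly two entries of each row are prescribed
and `m - 2` are free. -/
theorem card_rows_eq_pair (b b' : Fin k → Fin m) (hb : ∀ i, b' i ≠ b i) (g g' : Fin k → Bool) :
    (Finset.univ.filter fun a : Fin k → Fin m → Bool =>
      samples otG a b = g ∧ samples otG a b' = g').card = 2 ^ (k * (m - 2)) := by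
  classical
  have h : (Finset.univ.filter fun a : Fin k → Fin m → Bool =>
      samples otG a b = g ∧ samples otG a b' = g') =
      Fintype.piFinset fun i => Fintype.piFinset fun j =>
        if j = b i then {g i} else if j = b' i then {g' i} else Finset.univ := by
    ext a
    simp only [Finset.mem_filter, Finset.mem_univ, true_and, Fintype.mem_piFinset, samples, otG,
      funext_iff]
    refine ⟨fun h i j => ?_, fun h => ⟨fun i => ?_, fun i => ?_⟩⟩
    · split_ifs with hj hj'
      · simp [hj, h.1 i]
      · simp [hj', h.2 i]
      · simp
    · simpa using h i (b i)
    · simpa [hb i] using h i (b' i)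
  rw [h, Fintype.card_piFinset]
  simp only [Fintype.card_piFinset, apply_ite Finset.card]
  have : ∀ i, (∏ j : Fin m, if j = b i then Finset.card {g i} else if j = b' i then
      Finset.card {g' i} else (Finset.univ : Finset Bool).card) = 2 ^ (m - 2) := by
    intro i
    simp only [Finset.card_singleton, Finset.card_univ, Fintype.card_bool, Finset.prod_ite,
      Finset.prod_const_one, one_mul, Finset.prod_const, Finset.filter_ne']
    rw [Finset.card_erase_of_mem (by simp [hb i]), Finset.card_erase_of_mem (by simp)]
    simp [Nat.sub_sub]
  simp only [this]
  simp [← pow_mul, mul_comm]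

/-- The pair `(A,B)` is uniformly distributed. -/
def IsUniformPair (P : Measure Ω) (A : Ω → Fin k → Fin m → Bool) (B : Ω → Fin k → Fin m) : Prop :=
  ∃ c : ℝ≥0∞, ∀ a b, P (A ⁻¹' {a} ∩ B ⁻¹' {b}) = c

variable {P}

theorem IsUniformPair.exists_const (hu : IsUniformPair P A B) (hA : Measurable A)
    (hB : Measurable B) : ∃ c : ℝ≥0∞, c ≠ 0 ∧ c ≠ ⊤ ∧ ∀ a b, P (A ⁻¹' {a} ∩ B ⁻¹' {b}) = c := by
  obtain ⟨c, hc⟩ := hu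
  refine ⟨c, ?_, ?_, hc⟩
  · rintro rfl
    have h1 : P Set.univ = 0 := by
      rw [measure_eq_sum_fiber P (W := A) (fun a => hA (measurableSet_singleton a))]
      refine Finset.sum_eq_zero fun a _ => ?_
      rw [measure_eq_sum_fiber P (W := B) (fun a => hB (measurableSet_singleton a))]
      refine Finset.sum_eq_zero fun b _ => ?_
      rw [Set.inter_univ, Set.inter_comm, hc]
    simp at h1
  · obtain ⟨ω⟩ : Nonempty Ω := by
      by_contra h
      rw [not_nonempty_iff] at h
      have := measure_univ (μ := P)
      rw [Set.univ_eq_empty_iff.2 h] at this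
      simp at this
    rw [← hc (A ω) (B ω)]
    exact measure_ne_top _ _

/-- Bob cannot list few candidates for `A^k` without violating Alice's privacy. -/
theorem alice_privacy_list (hA : Measurable A) (hB : Measurable B) (hV : Measurable view)
    (hu : IsUniformPair P A B) (L : (Fin k → Fin m) → V → Set (Fin k → Fin m → Bool))
    (hL : ∀ b a, MeasurableSet {v | a ∈ L b v}) (N : ℕ)
    (hN : ∀ b v g, Set.ncard {a | samples otG a b = g ∧ a ∈ L b v} ≤ N) :
    P {ω | A ω ∈ L (B ω) (view ω)} ≤
      condMutualInfo P A view (fun ω => (B ω, samples otG (A ω) (B ω))) +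
        2 * (N * ((2 : ℝ≥0∞) ^ (k * (m - 1)))⁻¹) := by
  classical
  obtain ⟨c, hc0, hct, hc⟩ := hu.exists_const hA hB
  set W : Ω → (Fin k → Fin m) × (Fin k → Bool) := fun ω => (B ω, samples otG (A ω) (B ω)) with hWdef
  have hAB : ∀ a b, MeasurableSet (A ⁻¹' {a} ∩ B ⁻¹' {b}) := fun a b =>
    (hA (measurableSet_singleton a)).inter (hB (measurableSet_singleton b))
  have hW : ∀ w, MeasurableSet (W ⁻¹' {w}) := by
    rintro ⟨b, g⟩
    have : W ⁻¹' {(b, g)} = ⋃ a ∈ {a | samples otG a b = g}, A ⁻¹' {a} ∩ B ⁻¹' {b} := by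
      ext ω
      simp only [hWdef, Set.mem_preimage, Set.mem_singleton_iff, Prod.mk.injEq, Set.mem_ofPred_eq,
        Set.mem_iUnion, Set.mem_inter_iff, exists_prop]
      constructor
      · rintro ⟨rfl, rfl⟩; exact ⟨_, rfl, rfl, rfl⟩
      · rintro ⟨a, rfl, rfl, rfl⟩; exact ⟨rfl, rfl⟩
    rw [this]
    exact MeasurableSet.biUnion (Set.to_countable _) fun a _ => hAB a b
  have hWA : ∀ b g a, P (W ⁻¹' {(b, g)} ∩ A ⁻¹' {a}) = if samples otG a b = g then c else 0 := by
    intro b g a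
    split_ifs with h
    · rw [← hc a b]
      congr 1
      ext ω
      simp only [hWdef, Set.mem_preimage, Set.mem_singleton_iff, Prod.mk.injEq, Set.mem_inter_iff]
      constructor
      · rintro ⟨⟨rfl, -⟩, rfl⟩; exact ⟨rfl, rfl⟩
      · rintro ⟨rfl, rfl⟩; exact ⟨⟨rfl, h⟩, rfl⟩
    · convert measure_empty (μ := P)
      ext ω
      simp only [hWdef, Set.mem_preimage, Set.mem_singleton_iff, Prod.mk.injEq, Set.mem_inter_iff,
        Set.mem_empty_iff_false, iff_false]
      rintro ⟨⟨rfl, h1⟩, rfl⟩; exact h h1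
  have hPW : ∀ b g, P (W ⁻¹' {(b, g)}) = (2 : ℝ≥0∞) ^ (k * (m - 1)) * c := by
    intro b g
    rw [measure_eq_sum_fiber P (W := A) (fun a => hA (measurableSet_singleton a))]
    simp_rw [Set.inter_comm _ (W ⁻¹' {(b, g)}), hWA]
    rw [← Finset.sum_filter, Finset.sum_const, card_rows_eq, nsmul_eq_mul]
    simp
  have hcond : ∀ b g a, P[|W ⁻¹' {(b, g)}] (A ⁻¹' {a}) =
      if samples otG a b = g then ((2 : ℝ≥0∞) ^ (k * (m - 1)))⁻¹ else 0 := by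
    intro b g a
    rw [cond_apply (hW _), hWA, hPW]
    split_ifs with h
    · rw [ENNReal.mul_inv (Or.inl (by simp)) (Or.inl (by simp)), mul_assoc,
        ENNReal.inv_mul_cancel hc0 hct, mul_one]
    · simp
  -- Under the decoupled law `A` is uniform on the `2^(k(m-1))` values allowed by `(b,g)` and
  -- independent of the view, so a list with at most `N` allowed members succeeds with probability
  -- at most `N / 2^(k(m-1))`.
  have key := measure_le_condMutualInfo_add P hA hV hW (fun w a => {v | a ∈ L w.1 v})
    (fun w a => hL w.1 a)
  refine key.trans ?_
  gcongr
  calc decoupled P A view W (fun w a => {v | a ∈ L w.1 v})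
      ≤ ∑ w, (N * ((2 : ℝ≥0∞) ^ (k * (m - 1)))⁻¹) * P (W ⁻¹' {w}) := by
        refine Finset.sum_le_sum ?_
        rintro ⟨b, g⟩ -
        have hsum := sum_measure_le_of_card_le P
          (fun a => if samples otG a b = g then W ⁻¹' {(b, g)} ∩ view ⁻¹' {v | a ∈ L b v} else ∅)
          (H := W ⁻¹' {(b, g)}) (fun a => by
            split_ifs
            · exact (hW _).inter (hV (hL b a))
            · exact MeasurableSet.empty) (hW _) (fun a => by
            split_ifs
            · exact Set.inter_subset_left
            · exact Set.empty_subset _) N (fun ω => by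
            refine (Set.ncard_le_ncard ?_ (Set.toFinite _)).trans (hN b (view ω) g)
            intro a ha
            simp only [Set.mem_ofPred_eq] at ha
            split_ifs at ha with h
            · exact ⟨h, ha.2⟩
            · exact absurd ha (Set.notMem_empty _))
        simp_rw [hcond]
        calc _ = ((2 : ℝ≥0∞) ^ (k * (m - 1)))⁻¹ * ∑ a, P (if samples otG a b = g then
              W ⁻¹' {(b, g)} ∩ view ⁻¹' {v | a ∈ L b v} else ∅) := by
              rw [Finset.mul_sum]
              refine Finset.sum_congr rfl fun a _ => ?_
              split_ifs <;> simp
          _ ≤ ((2 : ℝ≥0∞) ^ (k * (m - 1)))⁻¹ * (N * P (W ⁻¹' {(b, g)})) := by gcongr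
          _ = _ := by ring
    _ = N * ((2 : ℝ≥0∞) ^ (k * (m - 1)))⁻¹ := by
        rw [← Finset.mul_sum]
        have := measure_eq_sum_fiber P hW Set.univ
        simp only [Set.inter_univ, measure_univ] at this
        rw [← this, mul_one]

/-- The probability of an event on `(B^k, A^k, view)` when `B^k` is replaced by an independent
uniform variable. -/
noncomputable def averaged (P : Measure Ω) (A : Ω → Fin k → Fin m → Bool) (view : Ω → V)
    (E : (Fin k → Fin m) → (Fin k → Fin m → Bool) → Set V) : ℝ≥0∞ :=
  ∑ b, ((m : ℝ≥0∞) ^ k)⁻¹ * P {ω | view ω ∈ E b (A ω)}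

/-- A permutation of its values preserves the uniform law. With Bob's privacy, this carries
statements about the true choice over to other choices. -/
theorem averaged_comp (σ : Equiv.Perm (Fin k → Fin m))
    (E : (Fin k → Fin m) → (Fin k → Fin m → Bool) → Set V) :
    averaged P A view (fun b => E (σ b)) = averaged P A view E :=
  Equiv.sum_comp σ fun b => ((m : ℝ≥0∞) ^ k)⁻¹ * P {ω | view ω ∈ E b (A ω)}

/-- Alice's function is constant, so conditioning on `(A,F)` is conditioning on `A`, and `B` is
uniform given `A`. -/
theorem decoupled_eq_averaged (hm : 0 < m) (hA : Measurable A) (hB : Measurable B)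
    (hu : IsUniformPair P A B)
    (E : (Fin k → Fin m) → (Fin k → Fin m → Bool) → Set V) :
    decoupled P B view (fun ω => (A ω, samples otF (A ω) (B ω))) (fun w b => E b w.1) =
      averaged P A view E := by
  obtain ⟨c, hc0, hct, hc⟩ := hu.exists_const hA hB
  have hm0 : (m : ℝ≥0∞) ≠ 0 := by exact_mod_cast hm.ne'
  have hWeq : ∀ a f, (fun ω => (A ω, samples otF (A ω) (B ω))) ⁻¹' {(a, f)} = A ⁻¹' {a} := by
    intro a f
    ext ω
    simp [Subsingleton.elim (samples otF (A ω) (B ω)) f]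
  have hPA : ∀ a, P (A ⁻¹' {a}) = (m : ℝ≥0∞) ^ k * c := by
    intro a
    rw [measure_eq_sum_fiber P (W := B) (fun a => hB (measurableSet_singleton a))]
    simp_rw [Set.inter_comm _ (A ⁻¹' {a}), hc]
    simp
  have hcond : ∀ a b, P[|A ⁻¹' {a}] (B ⁻¹' {b}) = ((m : ℝ≥0∞) ^ k)⁻¹ := by
    intro a b
    rw [cond_apply (hA (measurableSet_singleton a)), hc, hPA,
      ENNReal.mul_inv (Or.inl (by simp [hm0])) (Or.inl (by simp)), mul_assoc,
        ENNReal.inv_mul_cancel hc0 hct, mul_one]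
  rw [decoupled, Fintype.sum_prod_type]
  simp_rw [hWeq, hcond]
  simp only [Finset.univ_unique, Finset.sum_singleton]
  rw [Finset.sum_comm, averaged]
  refine Finset.sum_congr rfl fun b _ => ?_
  rw [← Finset.mul_sum, measure_eq_sum_fiber P (W := A) (fun a => hA (measurableSet_singleton a))]
  congr 1
  refine Finset.sum_congr rfl fun a _ => ?_
  congr 1
  ext ω
  simp +contextual

theorem measurableSet_fiber_otF (hA : Measurable A) (w) :
    MeasurableSet ((fun ω => (A ω, samples otF (A ω) (B ω))) ⁻¹' {w}) := by
  obtain ⟨a, f⟩ := w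
  have : (fun ω => (A ω, samples otF (A ω) (B ω))) ⁻¹' {(a, f)} = A ⁻¹' {a} := by
    ext ω
    simp [Subsingleton.elim (samples otF (A ω) (B ω)) f]
  rw [this]
  exact hA (measurableSet_singleton a)

/-- Together with `averaged_le` this allows the exchange of Bob's true choice for an independent
one, and back. -/
theorem bob_privacy_le (hm : 0 < m) (hA : Measurable A) (hB : Measurable B) (hV : Measurable view)
    (hu : IsUniformPair P A B) (E : (Fin k → Fin m) → (Fin k → Fin m → Bool) → Set V)
    (hE : ∀ b a, MeasurableSet (E b a)) :
    P {ω | view ω ∈ E (B ω) (A ω)} ≤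
      condMutualInfo P B view (fun ω => (A ω, samples otF (A ω) (B ω))) +
        2 * averaged P A view E := by
  rw [← decoupled_eq_averaged hm hA hB hu]
  exact measure_le_condMutualInfo_add P hB hV (measurableSet_fiber_otF hA) (fun w b => E b w.1)
    (fun w b => hE b w.1)

theorem averaged_le (hm : 0 < m) (hA : Measurable A) (hB : Measurable B) (hV : Measurable view)
    (hu : IsUniformPair P A B) (E : (Fin k → Fin m) → (Fin k → Fin m → Bool) → Set V)
    (hE : ∀ b a, MeasurableSet (E b a)) :
    averaged P A view E ≤
      2 * (condMutualInfo P B view (fun ω => (A ω, samples otF (A ω) (B ω))) +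
        P {ω | view ω ∈ E (B ω) (A ω)}) := by
  rw [← decoupled_eq_averaged hm hA hB hu]
  exact decoupled_le P hB hV (measurableSet_fiber_otF hA) (fun w b => E b w.1)
    (fun w b => hE b w.1)

end Privacy

/-! ### Executions over an erasure channel -/

theorem measure_preimage_eq_tsum {Ω τ : Type*} [MeasurableSpace Ω] [Countable τ] (P : Measure Ω)
    {T : Ω → τ} (hT : ∀ t, MeasurableSet (T ⁻¹' {t})) (S : Set τ) :
    P (T ⁻¹' S) = ∑' t, S.indicator (fun t => P (T ⁻¹' {t})) t := by
  have h : T ⁻¹' S = ⋃ t ∈ S, T ⁻¹' {t} := by ext; simp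
  rw [h, measure_biUnion S.to_countable _ fun t _ => hT t, tsum_subtype S fun t => P (T ⁻¹' {t})]
  intro s _ t _ hst
  exact Set.disjoint_left.2 fun x hx hy => hst (hx.symm.trans hy)

theorem measurableSet_preimage_of_fibers {Ω τ : Type*} [MeasurableSpace Ω] [Countable τ]
    {T : Ω → τ} (hT : ∀ t, MeasurableSet (T ⁻¹' {t})) (S : Set τ) : MeasurableSet (T ⁻¹' S) := by
  have h : T ⁻¹' S = ⋃ t ∈ S, T ⁻¹' {t} := by ext; simp
  rw [h]
  exact MeasurableSet.biUnion S.to_countable fun t _ => hT t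

/-- The output law of the erasure channel for the uniform input. -/
noncomputable def outLaw (p : ℝ) (hp : p ∈ Set.Icc (0 : ℝ) 1) (y : Option Bool) : ℝ≥0∞ :=
  2⁻¹ * bec p hp false y + 2⁻¹ * bec p hp true y

/-- An erasure has the same probability for either input, while a non-erased symbol is at most twice
as likely as under a uniform input. The total cost of forgetting the inputs is thus one bit per
non-erasure. -/
theorem bec_le_outLaw {p : ℝ} (hp : p ∈ Set.Icc (0 : ℝ) 1) (x : Bool) (y : Option Bool) :
    bec p hp x y ≤ (if y ≠ none then 2 else 1) * outLaw p hp y := by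
  rw [outLaw, ← mul_add]
  have h2 : (2 : ℝ≥0∞) * 2⁻¹ = 1 := ENNReal.mul_inv_cancel (by simp) (by simp)
  cases y with
  | none =>
    have : ∀ x, bec p hp x none = ENNReal.ofReal p := by intro x; simp [bec]
    simp only [this, ← two_mul, ← mul_assoc, ne_eq, not_true_eq_false, if_false, one_mul]
    rw [mul_comm 2⁻¹, h2, one_mul]
  | some y =>
    simp only [ne_eq, reduceCtorEq, not_false_eq_true, if_true]
    rw [← mul_assoc, h2, one_mul]
    cases x <;> simp

theorem prod_bec_le {n : ℕ} {p : ℝ} (hp : p ∈ Set.Icc (0 : ℝ) 1) (x : Fin n → Bool)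
    (y : Fin n → Option Bool) :
    ∏ i, bec p hp (x i) (y i) ≤ 2 ^ (nonErasures y).card * ∏ i, outLaw p hp (y i) := by
  refine (Finset.prod_le_prod' fun i _ => bec_le_outLaw hp (x i) (y i)).trans (le_of_eq ?_)
  rw [Finset.prod_mul_distrib]
  congr 1
  rw [Finset.prod_ite]
  simp [nonErasures]

theorem bec_eq_zero {p : ℝ} (hp : p ∈ Set.Icc (0 : ℝ) 1) {x : Bool} {y : Option Bool}
    (h1 : y ≠ none) (h2 : y ≠ some x) : bec p hp x y = 0 := by
  simp [bec, h1, h2]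

theorem card_nonErasures_add_card_erasures {n : ℕ} (y : Fin n → Option Bool) :
    (nonErasures y).card + (erasures y).card = n := by
  rw [add_comm]
  simpa [nonErasures, erasures] using
    Finset.card_filter_add_card_filter_not (s := (Finset.univ : Finset (Fin n))) (fun i => y i = none)

/-- What the upper bounds need to know about an execution over the erasure channel: the joint law of
all relevant variables factors into a part `α` of Alice, a part `β` of Bob, and the channel. The sum
in `norm` is the total mass of the execution whose channel outputs do not depend on the inputs. -/
structure ErasureExecution {m n k : ℕ} {p : ℝ} (hp : p ∈ Set.Icc (0 : ℝ) 1) {Ω L : Type*}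
    [MeasurableSpace Ω] (P : Measure Ω) (M : Ω → L) (B : Ω → Fin k → Fin m) (X : Ω → Fin n → Bool)
    (A : Ω → Fin k → Fin m → Bool) (Y : Ω → Fin n → Option Bool) (Gh : Ω → Fin k → Bool) where
  meas : ∀ t, MeasurableSet ((fun ω => (M ω, B ω, X ω, A ω, Y ω, Gh ω)) ⁻¹' {t})
  unif : IsUniformPair P A B
  α : L → (Fin n → Bool) → (Fin k → Fin m → Bool) → ℝ≥0∞
  β : L → (Fin k → Fin m) → (Fin n → Option Bool) → (Fin k → Bool) → ℝ≥0∞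
  β_le : ∀ l b y g, β l b y g ≤ 1
  fact : ∀ l b x a y g, P ((fun ω => (M ω, B ω, X ω, A ω, Y ω, Gh ω)) ⁻¹' {(l, b, x, a, y, g)}) =
    α l x a * β l b y g * ∏ i, bec p hp (x i) (y i)
  norm : ∑' l, ∑ b, ∑ x, ∑ a, ∑ y, ∑ g, α l x a * β l b y g * ∏ i, outLaw p hp (y i) ≤ 1
  conc : 0 < n → ∀ δ : ℝ, 0 < δ →
    P {ω | δ * n ≤ |((erasures (Y ω)).card : ℝ) - n * p|} ≤ ENNReal.ofReal (1 / (δ ^ 2 * n))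

namespace ErasureExecution

variable {m n k : ℕ} {p : ℝ} {hp : p ∈ Set.Icc (0 : ℝ) 1} {Ω L : Type*}
    [MeasurableSpace Ω] {P : Measure Ω} {M : Ω → L} {B : Ω → Fin k → Fin m} {X : Ω → Fin n → Bool}
    {A : Ω → Fin k → Fin m → Bool} {Y : Ω → Fin n → Option Bool} {Gh : Ω → Fin k → Bool}
    [IsProbabilityMeasure P] [Countable L]

theorem measure_eq (ex : ErasureExecution hp P M B X A Y Gh)
    (S : L → (Fin k → Fin m) → (Fin n → Bool) → (Fin k → Fin m → Bool) → (Fin n → Option Bool) →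
      (Fin k → Bool) → Prop) [∀ l b x a y g, Decidable (S l b x a y g)] :
    P {ω | S (M ω) (B ω) (X ω) (A ω) (Y ω) (Gh ω)} =
      ∑' l, ∑ b, ∑ x, ∑ a, ∑ y, ∑ g, if S l b x a y g then
        ex.α l x a * ex.β l b y g * ∏ i, bec p hp (x i) (y i) else 0 := by
  have h := measure_preimage_eq_tsum P ex.meas
    {t | S t.1 t.2.1 t.2.2.1 t.2.2.2.1 t.2.2.2.2.1 t.2.2.2.2.2}
  refine Eq.trans ?_ (h.trans ?_)
  · rfl
  · rw [ENNReal.tsum_prod']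
    refine tsum_congr fun l => ?_
    simp only [tsum_fintype, Fintype.sum_prod_type, Set.indicator_apply, Set.mem_ofPred_eq, ex.fact]

theorem measurableSet_event (ex : ErasureExecution hp P M B X A Y Gh)
    (S : L × (Fin k → Fin m) × (Fin n → Bool) × (Fin k → Fin m → Bool) × (Fin n → Option Bool) ×
      (Fin k → Bool) → Prop) :
    MeasurableSet {ω | S (M ω, B ω, X ω, A ω, Y ω, Gh ω)} :=
  measurableSet_preimage_of_fibers ex.meas {t | S t}

theorem measurable_A (ex : ErasureExecution hp P M B X A Y Gh) : Measurable A :=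
  measurable_to_countable' fun a => ex.measurableSet_event fun t => t.2.2.2.1 = a

theorem measurable_B (ex : ErasureExecution hp P M B X A Y Gh) : Measurable B :=
  measurable_to_countable' fun b => ex.measurableSet_event fun t => t.2.1 = b

/-- Alice's data and the messages determine the bits selected by Bob as reliably as Bob's
estimate does. -/
theorem exists_decoder (ex : ErasureExecution hp P M B X A Y Gh) :
    ∃ D : (Fin k → Fin m) → (Fin n → Bool) → L → (Fin k → Bool),
      P {ω | samples otG (A ω) (B ω) ≠ D (B ω) (X ω) (M ω)} ≤
        P {ω | Gh ω ≠ samples otG (A ω) (B ω)} := by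
  classical
  let w : L → (Fin k → Fin m) → (Fin n → Bool) → (Fin k → Bool) → ℝ≥0∞ := fun l b x g =>
    ∑ a, if samples otG a b = g then ex.α l x a else 0
  have hmax : ∀ l b x, ∃ g, ∀ g', w l b x g' ≤ w l b x g := fun l b x =>
    Finite.exists_max (w l b x)
  choose d hd using hmax
  refine ⟨fun b x l => d l b x, ?_⟩
  -- For fixed `l, b, x` only `α` contains `a`, so `A` is independent of Bob's estimate. No such
  -- estimate beats the maximizer `d l b x` of the unnormalized posterior weight `w l b x`.
  have key : P {ω | samples otG (A ω) (B ω) = Gh ω} ≤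
      P {ω | samples otG (A ω) (B ω) = d (M ω) (B ω) (X ω)} := by
    rw [ex.measure_eq fun l b x a y g => samples otG a b = g,
      ex.measure_eq fun l b x a y g => samples otG a b = d l b x]
    refine ENNReal.tsum_le_tsum fun l => Finset.sum_le_sum fun b _ => Finset.sum_le_sum fun x _ => ?_
    have hswap : ∀ f : (Fin k → Bool) → (Fin k → Bool),
        (∑ a, ∑ y, ∑ g, if samples otG a b = f g then
          ex.α l x a * ex.β l b y g * ∏ i, bec p hp (x i) (y i) else 0) =
        ∑ y, ∑ g, w l b x (f g) * (ex.β l b y g * ∏ i, bec p hp (x i) (y i)) := by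
      intro f
      rw [Finset.sum_comm]
      refine Finset.sum_congr rfl fun y _ => ?_
      rw [Finset.sum_comm]
      refine Finset.sum_congr rfl fun g _ => ?_
      rw [Finset.sum_mul]
      refine Finset.sum_congr rfl fun a _ => ?_
      split_ifs
      · rw [mul_assoc]
      · simp
    rw [hswap fun g => g, hswap fun _ => d l b x]
    gcongr with y _ g _
    exact hd l b x g
  have m1 : MeasurableSet {ω | samples otG (A ω) (B ω) = Gh ω} :=
    ex.measurableSet_event fun t => samples otG t.2.2.2.1 t.2.1 = t.2.2.2.2.2
  have m2 : MeasurableSet {ω | samples otG (A ω) (B ω) = d (M ω) (B ω) (X ω)} :=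
    ex.measurableSet_event fun t => samples otG t.2.2.2.1 t.2.1 = d t.1 t.2.1 t.2.2.1
  have e1 : {ω | Gh ω ≠ samples otG (A ω) (B ω)} = {ω | samples otG (A ω) (B ω) = Gh ω}ᶜ := by
    ext ω; simp [eq_comm]
  have e2 : {ω | samples otG (A ω) (B ω) ≠ d (M ω) (B ω) (X ω)} =
      {ω | samples otG (A ω) (B ω) = d (M ω) (B ω) (X ω)}ᶜ := by
    ext ω; simp
  rw [e1, e2, prob_compl_eq_one_sub m1, prob_compl_eq_one_sub m2]
  exact tsub_le_tsub_left key 1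

/-- From the messages alone one can list about `2^s` candidates for the bits selected by Bob, if
the channel erases all but `s` symbols. -/
theorem exists_list (ex : ErasureExecution hp P M B X A Y Gh) (s K : ℕ) (hK : 0 < K) :
    ∃ C : (Fin k → Fin m) → L → Finset (Fin k → Bool), (∀ b l, (C b l).card ≤ K) ∧
      P {ω | samples otG (A ω) (B ω) ∉ C (B ω) (M ω)} ≤
        P {ω | Gh ω ≠ samples otG (A ω) (B ω)} + P {ω | s < (nonErasures (Y ω)).card} +
          2 ^ s * (K : ℝ≥0∞)⁻¹ := by
  classical
  -- The weight of the estimate `g` when channel outputs are drawn without regard to the inputs; it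
  -- therefore depends only on the messages and Bob's choice.
  let w : L → (Fin k → Fin m) → (Fin k → Bool) → ℝ≥0∞ := fun l b g =>
    ∑ y, ex.β l b y g * ∏ i, outLaw p hp (y i)
  have hout : ∀ y, outLaw p hp y ≠ ⊤ := fun y => by
    simp [outLaw, ENNReal.mul_eq_top, (bec p hp _).apply_ne_top]
  have hwtop : ∀ l b g, w l b g ≠ ⊤ := by
    intro l b g
    refine ENNReal.sum_ne_top.2 fun y _ => ENNReal.mul_ne_top
      (ne_top_of_le_ne_top ENNReal.one_ne_top (ex.β_le l b y g)) ?_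
    exact ENNReal.prod_ne_top fun i _ => hout _
  have hK0 : (K : ℝ≥0∞) ≠ 0 := by exact_mod_cast hK.ne'
  -- The values that carry at least a fraction `1/K` of the total weight; there are at most `K`. The
  -- condition `w l b g ≠ 0` keeps the list empty when the total weight vanishes.
  let C : (Fin k → Fin m) → L → Finset (Fin k → Bool) := fun b l =>
    Finset.univ.filter fun g => w l b g ≠ 0 ∧ ∑ g', w l b g' ≤ K * w l b g
  refine ⟨C, fun b l => ?_, ?_⟩
  · by_cases hS : ∑ g', w l b g' = 0
    · have : C b l = ∅ := by
        refine Finset.filter_eq_empty_iff.2 fun g _ h => h.1 ?_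
        exact (Finset.sum_eq_zero_iff.1 hS) g (Finset.mem_univ g)
      simp [this]
    · have hS' : ∑ g', w l b g' ≠ ⊤ := ENNReal.sum_ne_top.2 fun g _ => hwtop l b g
      have h1 : ((C b l).card : ℝ≥0∞) * ∑ g', w l b g' ≤ K * ∑ g', w l b g' := by
        calc ((C b l).card : ℝ≥0∞) * ∑ g', w l b g' = ∑ g ∈ C b l, ∑ g', w l b g' := by simp
          _ ≤ ∑ g ∈ C b l, K * w l b g :=
            Finset.sum_le_sum fun g hg => (Finset.mem_filter.1 hg).2.2
          _ ≤ ∑ g, K * w l b g := Finset.sum_le_sum_of_subset (Finset.subset_univ _)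
          _ = _ := by rw [Finset.mul_sum]
      exact_mod_cast (ENNReal.mul_le_mul_iff_left hS hS').1 h1
  · have hsub : {ω | samples otG (A ω) (B ω) ∉ C (B ω) (M ω)} ⊆
        ({ω | Gh ω ≠ samples otG (A ω) (B ω)} ∪ {ω | s < (nonErasures (Y ω)).card}) ∪
          {ω | Gh ω = samples otG (A ω) (B ω) ∧ (nonErasures (Y ω)).card ≤ s ∧
            samples otG (A ω) (B ω) ∉ C (B ω) (M ω)} := by
      intro ω hω
      by_cases h1 : Gh ω = samples otG (A ω) (B ω)
      · by_cases h2 : (nonErasures (Y ω)).card ≤ s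
        · exact Or.inr ⟨h1, h2, hω⟩
        · exact Or.inl (Or.inr (not_le.1 h2))
      · exact Or.inl (Or.inl h1)
    refine (measure_mono hsub).trans ((measure_union_le _ _).trans
      (add_le_add (measure_union_le _ _) ?_))
    rw [ex.measure_eq fun l b x a y g => g = samples otG a b ∧ (nonErasures y).card ≤ s ∧
            samples otG a b ∉ C b l]
    -- On this event the estimate equals the selected bits, so one `g` contributes. Forgetting the
    -- inputs costs `2^s`, being off the list gains `1/K`, and `norm` bounds the remaining sum by 1.
    calc _ ≤ ∑' l, ∑ b, ∑ x, ∑ a, (2 ^ s * (K : ℝ≥0∞)⁻¹) * (ex.α l x a * ∑ g, w l b g) := by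
          refine ENNReal.tsum_le_tsum fun l => Finset.sum_le_sum fun b _ =>
            Finset.sum_le_sum fun x _ => Finset.sum_le_sum fun a _ => ?_
          by_cases hC : samples otG a b ∈ C b l
          · simp [hC]
          have hw : w l b (samples otG a b) ≤ (K : ℝ≥0∞)⁻¹ * ∑ g, w l b g := by
            simp only [C, Finset.mem_filter, Finset.mem_univ, true_and, not_and, not_le] at hC
            by_cases h0 : w l b (samples otG a b) = 0
            · simp [h0]
            · rw [← ENNReal.div_eq_inv_mul, ENNReal.le_div_iff_mul_le (Or.inl hK0) (Or.inl (by simp)),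
                mul_comm]
              exact (hC h0).le
          calc _ ≤ ∑ y, ex.α l x a * ex.β l b y (samples otG a b) *
                (2 ^ s * ∏ i, outLaw p hp (y i)) := by
                refine Finset.sum_le_sum fun y _ => ?_
                by_cases hy : (nonErasures y).card ≤ s
                · simp only [hy, hC, not_false_eq_true, and_true, Finset.sum_ite_eq',
                    Finset.mem_univ, if_true]
                  gcongr
                  refine (prod_bec_le hp x y).trans ?_
                  gcongr
                  simp
                · simp [hy]
            _ = 2 ^ s * (ex.α l x a * w l b (samples otG a b)) := by
                simp only [w, Finset.mul_sum]
                exact Finset.sum_congr rfl fun y _ => by ring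
            _ ≤ 2 ^ s * (ex.α l x a * ((K : ℝ≥0∞)⁻¹ * ∑ g, w l b g)) := by gcongr
            _ = _ := by ring
      _ = (2 ^ s * (K : ℝ≥0∞)⁻¹) * ∑' l, ∑ b, ∑ x, ∑ a, ∑ y, ∑ g,
            ex.α l x a * ex.β l b y g * ∏ i, outLaw p hp (y i) := by
          rw [← ENNReal.tsum_mul_left]
          refine tsum_congr fun l => ?_
          simp only [Finset.mul_sum, w]
          refine Finset.sum_congr rfl fun b _ => Finset.sum_congr rfl fun x _ =>
            Finset.sum_congr rfl fun a _ => ?_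
          rw [Finset.sum_comm]
          exact Finset.sum_congr rfl fun y _ => Finset.sum_congr rfl fun g _ => by ring
      _ ≤ (2 ^ s * (K : ℝ≥0∞)⁻¹) * 1 := by gcongr; exact ex.norm
      _ = _ := mul_one _

end ErasureExecution

/-! ### Upper bounds on the number of samples -/

namespace ErasureExecution

variable {m n k : ℕ} {p : ℝ} {hp : p ∈ Set.Icc (0 : ℝ) 1} {Ω L : Type*}
    [MeasurableSpace Ω] {P : Measure Ω} {M : Ω → L} {B : Ω → Fin k → Fin m} {X : Ω → Fin n → Bool}
    {A : Ω → Fin k → Fin m → Bool} {Y : Ω → Fin n → Option Bool} {Gh : Ω → Fin k → Bool}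
    [IsProbabilityMeasure P] [Countable L]
    {VA VB : Type*} [MeasurableSpace VA] [MeasurableSpace VB] {viewA : Ω → VA} {viewB : Ω → VB}
    {Fh : Ω → Fin k → Fin 1} {ε : ℝ}

/-- The messages confine the selected bits to a short list. Bob's privacy extends this to the
entries next to the selected ones, and Alice's privacy forbids Bob to know those so well. -/
theorem card_le_of_nonErasures (hm : 2 ≤ m) (ex : ErasureExecution hp P M B X A Y Gh)
    (sec : IsSecureExecution otF otG ε P A B viewA viewB Fh Gh)
    (hVA : Measurable viewA) (hVB : Measurable viewB)
    (ξ : VA → (Fin n → Bool) × L) (hξ : ∀ S, MeasurableSet (ξ ⁻¹' S))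
    (hξ' : ∀ ω, ξ (viewA ω) = (X ω, M ω))
    (ψ : VB → (Fin n → Option Bool) × L) (hψ : ∀ S, MeasurableSet (ψ ⁻¹' S))
    (hψ' : ∀ ω, ψ (viewB ω) = (Y ω, M ω))
    (hε : ε ≤ 1 / 100) (s : ℕ)
    (hs : P {ω | s < (nonErasures (Y ω)).card} ≤ ENNReal.ofReal (1 / 100)) : k ≤ s + 6 := by
  classical
  -- From here on `m` stands for the original `m - 2`.
  obtain ⟨m, rfl⟩ := Nat.exists_eq_add_of_le' hm
  have hε' : ENNReal.ofReal ε ≤ ENNReal.ofReal (1 / 100) := ENNReal.ofReal_le_ofReal hε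
  set e : ℝ≥0∞ := ENNReal.ofReal (1 / 100) with he
  have hA := ex.measurable_A
  have hB := ex.measurable_B
  have hI1 := sec.privacy_alice.le.trans hε'
  have hI2 := sec.privacy_bob.le.trans hε'
  -- This list size makes the term `2^s / K` equal to `1/16`.
  obtain ⟨C, hCcard, hC⟩ := ex.exists_list s (16 * 2 ^ s) (by positivity)
  -- A cyclic shift of each coordinate; with at least two columns it changes every one of them.
  set σ : Equiv.Perm (Fin k → Fin (m + 2)) := Equiv.addRight fun _ => 1 with hσ
  have hσne : ∀ b i, σ b i ≠ b i := by
    intro b i h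
    simp [hσ] at h
  let E : (Fin k → Fin (m + 2)) → (Fin k → Fin (m + 2) → Bool) → Set VA := fun b a =>
    {v | samples otG a b ∉ C b (ξ v).2}
  have hE : ∀ b a, MeasurableSet (E b a) := fun b a => hξ {v | samples otG a b ∉ C b v.2}
  have h1 : P {ω | viewA ω ∈ E (B ω) (A ω)} ≤ e + e + ENNReal.ofReal (1 / 16) := by
    have : {ω | viewA ω ∈ E (B ω) (A ω)} = {ω | samples otG (A ω) (B ω) ∉ C (B ω) (M ω)} := by
      ext ω; simp [E, hξ']
    rw [this]
    refine hC.trans (add_le_add (add_le_add (sec.correct_bob.le.trans hε') hs) (le_of_eq ?_))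
    push_cast
    rw [ENNReal.mul_inv (by simp) (by simp), mul_left_comm, ENNReal.mul_inv_cancel (by simp) (by simp),
      mul_one, one_div, ENNReal.ofReal_inv_of_pos (by norm_num)]
    simp
  -- From the true `B` to an independent uniform one (`h2`), where shifting by `σ` changes nothing,
  -- and back to the true `B` with the shifted event (`h3`).
  have h2 := averaged_le (by omega) hA hB hVA ex.unif E hE
  have h3 := bob_privacy_le (by omega) hA hB hVA ex.unif (fun b => E (σ b)) (fun b => hE (σ b))
  rw [averaged_comp σ E] at h3
  have h4 := alice_privacy_list hA hB hVB ex.unif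
    (fun b v => {a | samples otG a (σ b) ∈ C (σ b) (ψ v).2})
    (fun b a => hψ {v | samples otG a (σ b) ∈ C (σ b) v.2})
    (16 * 2 ^ s * 2 ^ (k * m)) (by
      intro b v g
      have : {a | samples otG a b = g ∧ a ∈ {a | samples otG a (σ b) ∈ C (σ b) (ψ v).2}} =
          (((C (σ b) (ψ v).2).biUnion fun g' => Finset.univ.filter fun a =>
            samples otG a b = g ∧ samples otG a (σ b) = g') :
              Finset (Fin k → Fin (m + 2) → Bool)) := by
        ext a; simp
      rw [this, Set.ncard_coe_finset]
      refine (Finset.card_biUnion_le_card_mul _ _ _ fun g' _ =>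
        (card_rows_eq_pair b (σ b) (hσne b) g g').le).trans ?_
      exact Nat.mul_le_mul_right _ (hCcard _ _))
  have hcover : (1 : ℝ≥0∞) ≤ P {ω | viewA ω ∈ E (σ (B ω)) (A ω)} +
      P {ω | A ω ∈ {a | samples otG a (σ (B ω)) ∈ C (σ (B ω)) (ψ (viewB ω)).2}} := by
    rw [← measure_univ (μ := P)]
    refine (measure_mono ?_).trans (measure_union_le _ _)
    intro ω _
    by_cases h : samples otG (A ω) (σ (B ω)) ∈ C (σ (B ω)) (M ω)
    · right; simpa [hψ'] using h
    · left; simpa [E, hξ'] using h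
  by_contra hk
  push Not at hk
  have hpow : ((16 * 2 ^ s * 2 ^ (k * m) : ℕ) : ℝ≥0∞) * ((2 : ℝ≥0∞) ^ (k * (m + 2 - 1)))⁻¹ ≤
      ENNReal.ofReal (1 / 8) := by
    rw [one_div, ENNReal.ofReal_inv_of_pos (by norm_num), ← ENNReal.div_eq_inv_mul.trans (mul_comm _ _)]
    refine ENNReal.div_le_of_le_mul ?_
    rw [← ENNReal.div_eq_inv_mul, ENNReal.le_div_iff_mul_le (by simp) (by simp)]
    -- Since `16 * 8 = 2^7`, the assumption `k ≥ s + 7` suffices.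
    have : 16 * 2 ^ s * 2 ^ (k * m) * 8 ≤ 2 ^ (k * (m + 2 - 1)) := by
      calc 16 * 2 ^ s * 2 ^ (k * m) * 8 = 2 ^ (s + 7 + k * m) := by ring
        _ ≤ 2 ^ (k * (m + 2 - 1)) := by
          apply Nat.pow_le_pow_right (by norm_num)
          have : k * (m + 2 - 1) = k * m + k := by
            rw [show m + 2 - 1 = m + 1 by omega]; ring
          omega
    have h8 : ENNReal.ofReal 8 = 8 := by simp
    rw [h8]
    exact_mod_cast this
  -- The right side equals 0.64 for `e = 1/100`.
  have hfin : (1 : ℝ≥0∞) ≤ (e + 2 * (2 * (e + (e + e + ENNReal.ofReal (1 / 16))))) +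
      (e + 2 * ENNReal.ofReal (1 / 8)) := by
    refine hcover.trans (add_le_add (h3.trans ?_) (h4.trans ?_))
    · gcongr
      exact h2.trans (by gcongr)
    · gcongr
  rw [he, ← ENNReal.ofReal_ofNat 2,
    ← ENNReal.ofReal_add (by norm_num) (by norm_num),
    ← ENNReal.ofReal_add (by norm_num) (by norm_num),
    ← ENNReal.ofReal_add (by norm_num) (by norm_num), ← ENNReal.ofReal_mul (by norm_num),
    ← ENNReal.ofReal_mul (by norm_num), ← ENNReal.ofReal_mul (by norm_num),
    ← ENNReal.ofReal_add (by norm_num) (by norm_num),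
    ← ENNReal.ofReal_add (by norm_num) (by norm_num),
    ← ENNReal.ofReal_add (by norm_num) (by norm_num), ENNReal.one_le_ofReal] at hfin
  norm_num at hfin

/-- `X` and the messages reveal the selected bits, and by Bob's privacy the bits for every shifted
choice, hence all of `A`. Bob misses only the erased part of `X`, so his list of candidates for `A`
has at most `2^t` members. -/
theorem card_mul_le_of_erasures (hm : 2 ≤ m) (ex : ErasureExecution hp P M B X A Y Gh)
    (sec : IsSecureExecution otF otG ε P A B viewA viewB Fh Gh)
    (hVA : Measurable viewA) (hVB : Measurable viewB)
    (ξ : VA → (Fin n → Bool) × L) (hξ : ∀ S, MeasurableSet (ξ ⁻¹' S))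
    (hξ' : ∀ ω, ξ (viewA ω) = (X ω, M ω))
    (ψ : VB → (Fin n → Option Bool) × L) (hψ : ∀ S, MeasurableSet (ψ ⁻¹' S))
    (hψ' : ∀ ω, ψ (viewB ω) = (Y ω, M ω))
    (hε : ε ≤ 1 / (100 * m)) (t : ℕ)
    (ht : P {ω | t < (erasures (Y ω)).card} ≤ ENNReal.ofReal (1 / 100)) :
    k * (m - 1) ≤ t + 2 := by
  classical
  have : NeZero m := ⟨by omega⟩
  have hε' : ENNReal.ofReal ε ≤ ENNReal.ofReal (1 / (100 * m)) := ENNReal.ofReal_le_ofReal hε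
  set e : ℝ≥0∞ := ENNReal.ofReal (1 / (100 * m)) with he
  have hA := ex.measurable_A
  have hB := ex.measurable_B
  have hI1 := sec.privacy_alice.le.trans hε'
  have hI2 := sec.privacy_bob.le.trans hε'
  obtain ⟨D, hD⟩ := ex.exists_decoder
  let σ : Fin m → Equiv.Perm (Fin k → Fin m) := fun c => Equiv.addRight fun _ => c
  have hσ : ∀ c b i, σ c b i = b i + c := fun c b i => rfl
  let E : (Fin k → Fin m) → (Fin k → Fin m → Bool) → Set VA := fun b a =>
    {v | samples otG a b ≠ D b (ξ v).1 (ξ v).2}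
  have hE : ∀ b a, MeasurableSet (E b a) := fun b a => hξ {v | samples otG a b ≠ D b v.1 v.2}
  have h1 : P {ω | viewA ω ∈ E (B ω) (A ω)} ≤ e := by
    refine le_trans (le_of_eq ?_) (hD.trans (sec.correct_bob.le.trans hε'))
    congr 1
    ext ω; simp [E, hξ']
  have h2 : averaged P A viewA E ≤ 2 * (e + e) :=
    (averaged_le (by omega) hA hB hVA ex.unif E hE).trans (by gcongr)
  -- The decoder fails for some shift. The `m` shifts of `b` together reach every entry of every
  -- row.
  let F : (Fin k → Fin m) → (Fin k → Fin m → Bool) → Set VA := fun b a => ⋃ c, E (σ c b) a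
  have hF : ∀ b a, MeasurableSet (F b a) := fun b a => MeasurableSet.iUnion fun c => hE _ a
  have h3 := bob_privacy_le (by omega) hA hB hVA ex.unif F hF
  have h3' : averaged P A viewA F ≤ m * (2 * (e + e)) := by
    calc averaged P A viewA F ≤ ∑ c, averaged P A viewA (fun b => E (σ c b)) := by
          simp only [averaged]
          rw [Finset.sum_comm]
          refine Finset.sum_le_sum fun b _ => ?_
          rw [← Finset.mul_sum]
          gcongr
          have : {ω | viewA ω ∈ F b (A ω)} = ⋃ c, {ω | viewA ω ∈ E (σ c b) (A ω)} := by
            ext ω; simp [F]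
          rw [this]
          exact measure_iUnion_fintype_le _ _
      _ = ∑ c : Fin m, averaged P A viewA E :=
          Finset.sum_congr rfl fun c _ => averaged_comp (σ c) E
      _ ≤ _ := by simp only [Finset.sum_const, Finset.card_univ, Fintype.card_fin, nsmul_eq_mul]; gcongr
  let comp : (Fin n → Bool) → (Fin n → Option Bool) → Prop := fun x y =>
    ∀ i, y i ≠ none → y i = some (x i)
  -- The channel erases symbols but never alters them.
  have hcomp : P {ω | ¬ comp (X ω) (Y ω)} = 0 := by
    rw [ex.measure_eq fun l b x a y g => ¬ comp x y]
    rw [ENNReal.tsum_eq_zero]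
    intro l
    refine Finset.sum_eq_zero fun b _ => Finset.sum_eq_zero fun x _ => Finset.sum_eq_zero fun a _ =>
      Finset.sum_eq_zero fun y _ => Finset.sum_eq_zero fun g _ => ?_
    by_cases h : comp x y
    · simp [h]
    · rw [if_pos h]
      simp only [comp, not_forall] at h
      obtain ⟨i, hi, hi'⟩ := h
      rw [Finset.prod_eq_zero (Finset.mem_univ i) (bec_eq_zero hp hi hi'), mul_zero]
  have hcard : ∀ y : Fin n → Option Bool,
      (Finset.univ.filter fun x => comp x y).card ≤ 2 ^ (erasures y).card := by
    intro y
    have : (Finset.univ.filter fun x => comp x y) ⊆ Fintype.piFinset fun i =>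
        if y i = none then Finset.univ else {(y i).getD false} := by
      intro x hx
      rw [Finset.mem_filter] at hx
      rw [Fintype.mem_piFinset]
      intro i
      split_ifs with h
      · simp
      · simp [hx.2 i h]
    refine (Finset.card_le_card this).trans (le_of_eq ?_)
    rw [Fintype.card_piFinset]
    simp [apply_ite Finset.card, Finset.prod_ite, erasures]
  have h4 := alice_privacy_list hA hB hVB ex.unif
    (fun b v => {a | (erasures (ψ v).1).card ≤ t ∧ ∃ x, comp x (ψ v).1 ∧
      ∀ c, samples otG a (σ c b) = D (σ c b) x (ψ v).2})
    (fun b a => hψ {v | (erasures v.1).card ≤ t ∧ ∃ x, comp x v.1 ∧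
      ∀ c, samples otG a (σ c b) = D (σ c b) x v.2})
    (2 ^ t) (by
      intro b v g
      by_cases hv : (erasures (ψ v).1).card ≤ t
      -- Each compatible `x` yields a single candidate: entry `(i,j)` is read off at the shift `j -
      -- b i`, which moves the choice in row `i` to `j`.
      · refine (Set.ncard_le_ncard (t := (((Finset.univ.filter fun x => comp x (ψ v).1).image
          fun x => fun i j => D (σ (j - b i) b) x (ψ v).2 i : Finset _) :
            Set (Fin k → Fin m → Bool))) ?_ (Finset.finite_toSet _)).trans ?_
        · rintro a ⟨-, -, x, hx, hax⟩
          simp only [Finset.coe_image, Finset.coe_filter, Set.mem_image]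
          refine ⟨x, ⟨Finset.mem_univ _, hx⟩, ?_⟩
          ext i j
          rw [← hax]
          simp [samples, otG, hσ]
        · rw [Set.ncard_coe_finset]
          exact Finset.card_image_le.trans ((hcard _).trans (Nat.pow_le_pow_right (by norm_num) hv))
      · simp [hv])
  have hcover : (1 : ℝ≥0∞) ≤ P {ω | viewA ω ∈ F (B ω) (A ω)} +
      P {ω | A ω ∈ {a | (erasures (ψ (viewB ω)).1).card ≤ t ∧ ∃ x, comp x (ψ (viewB ω)).1 ∧
        ∀ c, samples otG a (σ c (B ω)) = D (σ c (B ω)) x (ψ (viewB ω)).2}} +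
      P {ω | t < (erasures (Y ω)).card} + P {ω | ¬ comp (X ω) (Y ω)} := by
    rw [← measure_univ (μ := P)]
    refine (measure_mono (t := ((_ ∪ _) ∪ _) ∪ _) ?_).trans ((measure_union_le _ _).trans
      (add_le_add ((measure_union_le _ _).trans (add_le_add (measure_union_le _ _) le_rfl)) le_rfl))
    intro ω _
    by_cases h : comp (X ω) (Y ω)
    · left
      by_cases h' : (erasures (Y ω)).card ≤ t
      · left
        by_cases h'' : ∀ c, samples otG (A ω) (σ c (B ω)) = D (σ c (B ω)) (X ω) (M ω)
        · right
          simp only [hψ']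
          exact ⟨h', X ω, h, h''⟩
        · left
          push Not at h''
          obtain ⟨c, hc⟩ := h''
          simp only [F, Set.mem_ofPred_eq, Set.mem_iUnion, E, hξ']
          exact ⟨c, hc⟩
      · right; exact not_le.1 h'
    · right; exact h
  by_contra hk
  push Not at hk
  have hpow : ((2 ^ t : ℕ) : ℝ≥0∞) * ((2 : ℝ≥0∞) ^ (k * (m - 1)))⁻¹ ≤ ENNReal.ofReal (1 / 8) := by
    rw [one_div, ENNReal.ofReal_inv_of_pos (by norm_num), ← ENNReal.div_eq_inv_mul.trans (mul_comm _ _)]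
    refine ENNReal.div_le_of_le_mul ?_
    rw [← ENNReal.div_eq_inv_mul, ENNReal.le_div_iff_mul_le (by simp) (by simp)]
    have : 2 ^ t * 8 ≤ 2 ^ (k * (m - 1)) := by
      calc 2 ^ t * 8 = 2 ^ (t + 3) := by ring
        _ ≤ 2 ^ (k * (m - 1)) := Nat.pow_le_pow_right (by norm_num) hk
    have h8 : ENNReal.ofReal 8 = 8 := by simp
    rw [h8]
    exact_mod_cast this
  have hfin : (1 : ℝ≥0∞) ≤ (e + 2 * (m * (2 * (e + e)))) + (e + 2 * ENNReal.ofReal (1 / 8)) +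
      ENNReal.ofReal (1 / 100) + 0 := by
    refine hcover.trans (add_le_add (add_le_add (add_le_add (h3.trans ?_) (h4.trans ?_)) ht)
      hcomp.le)
    · gcongr
    · gcongr
  have hm' : (2 : ℝ) ≤ m := by exact_mod_cast hm
  have hmm : ENNReal.ofReal (m : ℝ) = m := by simp
  have he0 : 0 ≤ 1 / (100 * (m : ℝ)) := by positivity
  rw [he, ← ENNReal.ofReal_ofNat 2, ← hmm, add_zero, ← ENNReal.ofReal_add he0 he0,
    ← ENNReal.ofReal_mul (by norm_num), ← ENNReal.ofReal_mul (by positivity),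
    ← ENNReal.ofReal_mul (by norm_num), ← ENNReal.ofReal_mul (by norm_num),
    ← ENNReal.ofReal_add (by positivity) (by positivity),
    ← ENNReal.ofReal_add (by positivity) (by positivity),
    ← ENNReal.ofReal_add (by positivity) (by positivity),
    ← ENNReal.ofReal_add (by positivity) (by positivity), ENNReal.one_le_ofReal] at hfin
  -- The tolerance `1/(100m)` is chosen to cancel the factor `m` from the union over the shifts.
  have h5 : 2 * (m * (2 * (1 / (100 * (m : ℝ)) + 1 / (100 * (m : ℝ))))) = 8 / 100 := by
    field_simp; norm_num
  have h6 : 1 / (100 * (m : ℝ)) ≤ 1 / 100 := by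
    apply one_div_le_one_div_of_le <;> linarith
  rw [h5] at hfin
  linarith

end ErasureExecution

/-! ### From bounds on the number of samples to bounds on rates -/

section Rate

variable {m : ℕ} {p : ℝ}

/-- The hypothesis `100 ≤ δ²n` brings the Chebyshev bound down to the `1/100` required by both
counting bounds, with `s` and `t` the integer parts of mean plus `δn`. -/
theorem ErasureExecution.card_bounds {n k : ℕ} {hp : p ∈ Set.Icc (0 : ℝ) 1} {Ω L : Type*}
    [MeasurableSpace Ω] {P : Measure Ω} {M : Ω → L} {B : Ω → Fin k → Fin m} {X : Ω → Fin n → Bool}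
    {A : Ω → Fin k → Fin m → Bool} {Y : Ω → Fin n → Option Bool} {Gh : Ω → Fin k → Bool}
    [IsProbabilityMeasure P] [Countable L]
    {VA VB : Type*} [MeasurableSpace VA] [MeasurableSpace VB] {viewA : Ω → VA} {viewB : Ω → VB}
    {Fh : Ω → Fin k → Fin 1} {ε : ℝ}
    (hm : 2 ≤ m) (ex : ErasureExecution hp P M B X A Y Gh)
    (sec : IsSecureExecution otF otG ε P A B viewA viewB Fh Gh)
    (hVA : Measurable viewA) (hVB : Measurable viewB)
    (ξ : VA → (Fin n → Bool) × L) (hξ : ∀ S, MeasurableSet (ξ ⁻¹' S))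
    (hξ' : ∀ ω, ξ (viewA ω) = (X ω, M ω))
    (ψ : VB → (Fin n → Option Bool) × L) (hψ : ∀ S, MeasurableSet (ψ ⁻¹' S))
    (hψ' : ∀ ω, ψ (viewB ω) = (Y ω, M ω))
    (hε : ε ≤ 1 / (100 * m)) {δ : ℝ} (hδ : 0 < δ) (hn : 0 < n) (hδn : 100 ≤ δ ^ 2 * n) :
    (k : ℝ) ≤ n * (1 - p) + δ * n + 6 ∧ (k : ℝ) * (m - 1) ≤ n * p + δ * n + 2 := by
  have hm' : (2 : ℝ) ≤ m := by exact_mod_cast hm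
  have hconc := (ex.conc hn δ hδ).trans (ENNReal.ofReal_le_ofReal
    (one_div_le_one_div_of_le (by norm_num) hδn))
  have hn0 : (0 : ℝ) ≤ n := by positivity
  have hpos1 : 0 ≤ n * (1 - p) + δ * n :=
    add_nonneg (mul_nonneg hn0 (by linarith [hp.2])) (by positivity)
  have hpos2 : 0 ≤ n * p + δ * n := add_nonneg (mul_nonneg hn0 hp.1) (by positivity)
  have hsplit : ∀ y : Fin n → Option Bool,
      ((nonErasures y).card : ℝ) + (erasures y).card = n := fun y => by
    exact_mod_cast card_nonErasures_add_card_erasures y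
  constructor
  · have h := ex.card_le_of_nonErasures hm sec hVA hVB ξ hξ hξ' ψ hψ hψ'
      (hε.trans (one_div_le_one_div_of_le (by norm_num) (by linarith)))
      ⌊n * (1 - p) + δ * n⌋₊ (le_trans (measure_mono fun ω hω => ?_) hconc)
    · have h1 : (k : ℝ) ≤ ⌊n * (1 - p) + δ * n⌋₊ + 6 := by exact_mod_cast h
      have h2 := Nat.floor_le hpos1
      linarith
    · have h3 := (Nat.floor_lt hpos1).1 hω
      have h4 := hsplit (Y ω)
      rw [Set.mem_ofPred_eq]
      refine le_trans ?_ (neg_le_abs _)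
      linarith
  · have h := ex.card_mul_le_of_erasures hm sec hVA hVB ξ hξ hξ' ψ hψ hψ' hε
      ⌊n * p + δ * n⌋₊ (le_trans (measure_mono fun ω hω => ?_) hconc)
    · have h1 : (k : ℝ) * ((m - 1 : ℕ) : ℝ) ≤ ⌊n * p + δ * n⌋₊ + 2 := by exact_mod_cast h
      rw [Nat.cast_sub (by omega), Nat.cast_one] at h1
      have h2 := Nat.floor_le hpos2
      linarith
    · have h3 := (Nat.floor_lt hpos2).1 hω
      rw [Set.mem_ofPred_eq]
      refine le_trans ?_ (le_abs_self _)
      linarith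

theorem rate_le_of_card_bounds (hm : 2 ≤ m) {good : ℕ → ℕ → ℝ → Prop}
    (h : ∀ n k ε, good n k ε → ε ≤ 1 / (100 * m) → ∀ δ : ℝ, 0 < δ → 0 < n → 100 ≤ δ ^ 2 * n →
      (k : ℝ) ≤ n * (1 - p) + δ * n + 6 ∧ (k : ℝ) * (m - 1) ≤ n * p + δ * n + 2)
    {R : ℝ} (hR : AttainsRate good R) : R ≤ min (1 - p) (p / ((m : ℝ) - 1)) := by
  have hm' : (2 : ℝ) ≤ m := by exact_mod_cast hm
  refine le_of_forall_pos_le_add fun η hη => ?_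
  -- Three losses of at most `εn` each must fit into `ηn`: the rate tolerance, the deviation with `δ
  -- = ε`, and the additive constant, which is at most `6 ≤ εn`.
  set ε := min (η / 3) (1 / (100 * m)) with hε
  have hε0 : 0 < ε := lt_min (by positivity) (by positivity)
  have hε3 : 3 * ε ≤ η := by have := min_le_left (η / 3) (1 / (100 * (m : ℝ))); linarith
  obtain ⟨n, ⟨k, hk, hgood⟩, hn1, hn2, hn3⟩ := ((hR ε hε0).and
    (((tendsto_natCast_atTop_atTop (R := ℝ)).eventually_ge_atTop (100 / ε ^ 2)).and
      (((tendsto_natCast_atTop_atTop (R := ℝ)).eventually_ge_atTop (6 / ε)).and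
        (eventually_gt_atTop 0)))).exists
  have hn0 : (0 : ℝ) < n := by exact_mod_cast hn3
  rw [div_le_iff₀ (by positivity)] at hn1 hn2
  obtain ⟨h1, h2⟩ := h n k ε hgood (min_le_right _ _) ε hε0 hn3 (by linarith)
  rw [lt_div_iff₀ hn0] at hk
  rw [← min_add_add_right, le_min_iff]
  constructor
  · refine le_of_mul_le_mul_right ?_ hn0
    nlinarith
  · have h3 : p / ((m : ℝ) - 1) + η = (p + η * (m - 1)) / (m - 1) := by
      field_simp [show (m : ℝ) - 1 ≠ 0 by linarith]
    rw [h3, le_div_iff₀ (by linarith)]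
    refine le_of_mul_le_mul_right ?_ hn0
    have h4 : (R - ε) * n * (m - 1) ≤ k * (m - 1) := mul_le_mul_of_nonneg_right hk.le (by linarith)
    have h5 : ε * n * 2 ≤ ε * n * (2 * (m - 1)) := by
      apply mul_le_mul_of_nonneg_left _ (by positivity); linarith
    have h6 : 3 * ε * (n * (m - 1)) ≤ η * (n * (m - 1)) :=
      mul_le_mul_of_nonneg_right hε3 (mul_nonneg hn0.le (by linarith))
    nlinarith

end Rate

/-! ### Laws of the source samples and of the erasure source -/

theorem isProbabilityMeasure_uniformSource {m : ℕ} (hm : 2 ≤ m) (k : ℕ) :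
    IsProbabilityMeasure (uniformSource m k) := by
  have : NeZero m := ⟨by omega⟩
  exact isProbabilityMeasure_uniformOn Set.finite_univ Set.univ_nonempty

theorem uniformSource_singleton (m k : ℕ) (z : (Fin k → Fin m → Bool) × (Fin k → Fin m)) :
    uniformSource m k {z} = (Fintype.card ((Fin k → Fin m → Bool) × (Fin k → Fin m)) : ℝ≥0∞)⁻¹ := by
  rw [uniformSource, uniformOn_univ, Measure.count_singleton, one_div]

theorem jointLaw_apply {𝓧 𝓨 : Type} (PX : PMF 𝓧) (W : 𝓧 → PMF 𝓨) (x : 𝓧) (y : 𝓨) :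
    jointLaw PX W (x, y) = PX x * W x y := by
  classical
  rw [jointLaw, PMF.bind_apply, tsum_eq_single x]
  · congr 1
    rw [PMF.map_apply, tsum_eq_single y]
    · simp
    · intro y' hy'; simp [hy'.symm]
  · intro x' hx'
    rw [PMF.map_apply]
    simp [hx'.symm]

theorem bes_apply {p : ℝ} (hp : p ∈ Set.Icc (0 : ℝ) 1) (x : Bool) (y : Option Bool) :
    bes p hp (x, y) = 2⁻¹ * bec p hp x y := by
  rw [bes, jointLaw_apply]
  simp

/-- The output law of the erasure channel for the uniform input, as a `PMF`. -/
noncomputable def outPMF (p : ℝ) (hp : p ∈ Set.Icc (0 : ℝ) 1) : PMF (Option Bool) :=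
  (PMF.uniformOfFintype Bool).bind (bec p hp)

theorem outPMF_apply {p : ℝ} (hp : p ∈ Set.Icc (0 : ℝ) 1) (y : Option Bool) :
    outPMF p hp y = outLaw p hp y := by
  rw [outPMF, PMF.bind_apply, tsum_fintype]
  simp [outLaw, add_comm]

theorem bec_none {p : ℝ} (hp : p ∈ Set.Icc (0 : ℝ) 1) (x : Bool) :
    bec p hp x none = ENNReal.ofReal p := by
  simp [bec]

theorem bes_real_erased {p : ℝ} (hp : p ∈ Set.Icc (0 : ℝ) 1) :
    (bes p hp).toMeasure.real {z : Bool × Option Bool | z.2 = none} = p := by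
  have h2 : (2 : ℝ≥0∞)⁻¹ + 2⁻¹ = 1 := ENNReal.inv_two_add_inv_two
  rw [Measure.real, PMF.toMeasure_apply_fintype, Fintype.sum_prod_type]
  simp only [Fintype.sum_bool, Fintype.sum_option, Set.indicator_apply, Set.mem_ofPred_eq,
    bes_apply, bec_none]
  simp [← add_mul, h2, hp.1]

instance instDiscreteMeasurableSpaceList {α : Type*} : DiscreteMeasurableSpace (List α) :=
  ⟨fun _ => trivial⟩

/-! ### Source-model executions -/

namespace SourceProtocol

variable {m n k : ℕ} (π : OTSourceProtocol Bool (Option Bool) m n k)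

theorem length_transcript (a : Fin k → Fin m → Bool) (b : Fin k → Fin m) (x : Fin n → Bool)
    (y : Fin n → Option Bool) (zA : π.ZA) (zB : π.ZB) (i : ℕ) :
    (π.transcript a b x y zA zB i).length = i := by
  induction i with
  | zero => rfl
  | succ i ih => simp [transcript, ih]

/-- Each message has a single author, so for fixed data the event of a given transcript is a
condition on `zA` and a separate condition on `zB`. This rectangle structure is what makes the joint
law factor. The condition on the length is put on Alice's side. -/
theorem transcript_eq_iff (a : Fin k → Fin m → Bool) (b : Fin k → Fin m) (x : Fin n → Bool)
    (y : Fin n → Option Bool) (zA : π.ZA) (zB : π.ZB) (i : ℕ) (l : List π.Msg) :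
    π.transcript a b x y zA zB i = l ↔
      (l.length = i ∧ ∀ j < i, Even j → l[j]? = some (π.aliceMsg a x zA (l.take j))) ∧
      (∀ j < i, ¬ Even j → l[j]? = some (π.bobMsg b y zB (l.take j))) := by
  induction i generalizing l with
  | zero => simp [transcript, eq_comm]
  | succ i ih =>
    set h := π.transcript a b x y zA zB i with hh
    have hlen : h.length = i := π.length_transcript a b x y zA zB i
    have htr : π.transcript a b x y zA zB (i + 1) =
      h ++ [if Even i then π.aliceMsg a x zA h else π.bobMsg b y zB h] := rfl
    rw [htr]
    constructor
    · rintro rfl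
      have hI := (ih h).1 rfl
      refine ⟨⟨by simp [hlen], fun j hj hje => ?_⟩, fun j hj hje => ?_⟩
      · rcases (Nat.lt_succ_iff_lt_or_eq.1 hj) with hj' | rfl
        · rw [List.getElem?_append_left (by omega), List.take_append_of_le_length (by omega)]
          exact hI.1.2 j hj' hje
        · rw [List.getElem?_append_right (by omega), List.take_append_of_le_length (by omega)]
          simp [hlen, hje, List.take_of_length_le hlen.le]
      · rcases (Nat.lt_succ_iff_lt_or_eq.1 hj) with hj' | rfl
        · rw [List.getElem?_append_left (by omega), List.take_append_of_le_length (by omega)]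
          exact hI.2 j hj' hje
        · rw [List.getElem?_append_right (by omega), List.take_append_of_le_length (by omega)]
          simp [hlen, hje, List.take_of_length_le hlen.le]
    · rintro ⟨⟨hl, hA⟩, hB⟩
      have h1 : h = l.take i := by
        refine (ih (l.take i)).2 ⟨⟨by simp [hl], fun j hj hje => ?_⟩, fun j hj hje => ?_⟩
        · rw [List.getElem?_take_of_lt hj, List.take_take, min_eq_left hj.le]
          exact hA j (by omega) hje
        · rw [List.getElem?_take_of_lt hj, List.take_take, min_eq_left hj.le]
          exact hB j (by omega) hje
      have h2 : l[i]? = some (if Even i then π.aliceMsg a x zA h else π.bobMsg b y zB h) := by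
        split_ifs with he
        · rw [hA i (by omega) he, h1]
        · rw [hB i (by omega) he, h1]
      conv_rhs => rw [← List.take_append_drop i l]
      rw [← h1]
      congr 1
      obtain ⟨hi, hi'⟩ := List.getElem?_eq_some_iff.1 h2
      rw [List.drop_eq_getElem_cons hi, hi', List.drop_of_length_le (by omega)]

/-- The values of Alice's local randomness that are consistent with the messages. -/
def aliceSet (a : Fin k → Fin m → Bool) (x : Fin n → Bool) (l : List π.Msg) : Set π.ZA :=
  {zA | l.length = π.r ∧ ∀ j < π.r, Even j → l[j]? = some (π.aliceMsg a x zA (l.take j))}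

/-- The values of Bob's local randomness that are consistent with the messages and his estimate. -/
def bobSet (b : Fin k → Fin m) (y : Fin n → Option Bool) (l : List π.Msg) (g : Fin k → Bool) :
    Set π.ZB :=
  {zB | (∀ j < π.r, ¬ Even j → l[j]? = some (π.bobMsg b y zB (l.take j))) ∧
    π.bobEst b y zB l = g}

theorem measurableSet_aliceSet (a : Fin k → Fin m → Bool) (x : Fin n → Bool) (l : List π.Msg) :
    MeasurableSet (π.aliceSet a x l) := by
  have : π.aliceSet a x l = {_zA | l.length = π.r} ∩ ⋂ j, ⋂ (_ : j < π.r), ⋂ (_ : Even j),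
      {zA | l[j]? = some (π.aliceMsg a x zA (l.take j))} := by
    ext zA; simp [aliceSet]
  rw [this]
  refine (MeasurableSet.const _).inter ?_
  refine MeasurableSet.iInter fun j => MeasurableSet.iInter fun _ => MeasurableSet.iInter fun _ => ?_
  cases h : l[j]? with
  | none => simp
  | some c =>
    simp only [Option.some.injEq, eq_comm (a := c)]
    exact π.meas_aliceMsg a x (l.take j) c

theorem measurableSet_bobSet (b : Fin k → Fin m) (y : Fin n → Option Bool) (l : List π.Msg)
    (g : Fin k → Bool) : MeasurableSet (π.bobSet b y l g) := by
  have : π.bobSet b y l g = (⋂ j, ⋂ (_ : j < π.r), ⋂ (_ : ¬ Even j),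
      {zB | l[j]? = some (π.bobMsg b y zB (l.take j))}) ∩ {zB | π.bobEst b y zB l = g} := by
    ext zB; simp [bobSet]
  rw [this]
  refine MeasurableSet.inter ?_ (π.meas_bobEst b y l g)
  refine MeasurableSet.iInter fun j => MeasurableSet.iInter fun _ => MeasurableSet.iInter fun _ => ?_
  cases h : l[j]? with
  | none => simp
  | some c =>
    simp only [Option.some.injEq, eq_comm (a := c)]
    exact π.meas_bobMsg b y (l.take j) c

/-- All variables of an execution that matter for the upper bounds. -/
def record (ω : π.Space) : List π.Msg × (Fin k → Fin m) × (Fin n → Bool) × (Fin k → Fin m → Bool) ×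
    (Fin n → Option Bool) × (Fin k → Bool) :=
  (π.messages ω, ω.1.1.2, fun i => (ω.1.2 i).1, ω.1.1.1, fun i => (ω.1.2 i).2,
    π.bobEst ω.1.1.2 (fun i => (ω.1.2 i).2) ω.2.2 (π.messages ω))

theorem record_preimage (l : List π.Msg) (b : Fin k → Fin m) (x : Fin n → Bool)
    (a : Fin k → Fin m → Bool) (y : Fin n → Option Bool) (g : Fin k → Bool) :
    π.record ⁻¹' {(l, b, x, a, y, g)} =
      ({(a, b)} ×ˢ {fun i => (x i, y i)}) ×ˢ (π.aliceSet a x l ×ˢ π.bobSet b y l g) := by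
  ext ω
  obtain ⟨⟨⟨a', b'⟩, xy⟩, zA, zB⟩ := ω
  simp only [record, messages, Set.mem_preimage, Set.mem_singleton_iff, Prod.mk.injEq, Set.mem_prod,
    aliceSet, bobSet, Set.mem_ofPred_eq]
  constructor
  · rintro ⟨h, rfl, rfl, rfl, rfl, rfl⟩
    have h' := (π.transcript_eq_iff _ _ _ _ _ _ _ _).1 h
    exact ⟨⟨⟨rfl, rfl⟩, rfl⟩, h'.1, h'.2, by rw [h]⟩
  · rintro ⟨⟨⟨rfl, rfl⟩, rfl⟩, h1, h2, rfl⟩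
    have h' := (π.transcript_eq_iff a' b' x y zA zB π.r l).2 ⟨h1, h2⟩
    refine ⟨h', rfl, rfl, rfl, rfl, ?_⟩
    simp only [h']

theorem law_record (hm : 2 ≤ m) (PXY : PMF (Bool × Option Bool)) (l : List π.Msg)
    (b : Fin k → Fin m) (x : Fin n → Bool)
    (a : Fin k → Fin m → Bool) (y : Fin n → Option Bool) (g : Fin k → Bool) :
    π.law (uniformSource m k) PXY (π.record ⁻¹' {(l, b, x, a, y, g)}) =
      (Fintype.card ((Fin k → Fin m → Bool) × (Fin k → Fin m)) : ℝ≥0∞)⁻¹ *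
        π.lawA (π.aliceSet a x l) * π.lawB (π.bobSet b y l g) * ∏ i, PXY (x i, y i) := by
  have := isProbabilityMeasure_uniformSource hm k
  rw [record_preimage, law, Measure.prod_prod, Measure.prod_prod, Measure.prod_prod,
    uniformSource_singleton, Measure.pi_singleton]
  simp only [PMF.toMeasure_apply_singleton _ _ (measurableSet_singleton _)]
  ring

theorem measurableSet_record (t) : MeasurableSet (π.record ⁻¹' {t}) := by
  obtain ⟨l, b, x, a, y, g⟩ := t
  rw [record_preimage]
  exact ((measurableSet_singleton _).prod (measurableSet_singleton _)).prod
    ((π.measurableSet_aliceSet a x l).prod (π.measurableSet_bobSet b y l g))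

theorem isProbabilityMeasure_law (hm : 2 ≤ m) (PXY : PMF (Bool × Option Bool)) :
    IsProbabilityMeasure (π.law (uniformSource m k) PXY) := by
  have := isProbabilityMeasure_uniformSource hm k
  unfold law
  infer_instance

/-- A source-model execution with the erasure source. -/
noncomputable def erasureExecution (hm : 2 ≤ m) {p : ℝ} (hp : p ∈ Set.Icc (0 : ℝ) 1) :
    ErasureExecution hp (π.law (uniformSource m k) (bes p hp)) π.messages (fun ω => ω.1.1.2)
      (fun ω i => (ω.1.2 i).1) (fun ω => ω.1.1.1) (fun ω i => (ω.1.2 i).2)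
      (fun ω => π.bobEst ω.1.1.2 (fun i => (ω.1.2 i).2) ω.2.2 (π.messages ω)) where
  meas := π.measurableSet_record
  unif := by
    have := isProbabilityMeasure_uniformSource hm k
    refine ⟨(Fintype.card ((Fin k → Fin m → Bool) × (Fin k → Fin m)) : ℝ≥0∞)⁻¹, fun a b => ?_⟩
    have : (fun ω : π.Space => ω.1.1.1) ⁻¹' {a} ∩ (fun ω : π.Space => ω.1.1.2) ⁻¹' {b} =
        ({(a, b)} ×ˢ Set.univ) ×ˢ Set.univ := by
      ext ω; simp [Prod.ext_iff]
    rw [this, law, Measure.prod_prod, Measure.prod_prod, uniformSource_singleton]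
    simp
  -- Alice's factor absorbs the probability `2^(-n)` of the uniform source bits, which leaves
  -- exactly the channel law.
  α l x a := (Fintype.card ((Fin k → Fin m → Bool) × (Fin k → Fin m)) : ℝ≥0∞)⁻¹ *
        π.lawA (π.aliceSet a x l) * 2⁻¹ ^ n
  β l b y g := π.lawB (π.bobSet b y l g)
  β_le _ _ _ _ := prob_le_one
  fact l b x a y g := by
    refine (π.law_record hm (bes p hp) l b x a y g).trans ?_
    simp only [bes_apply, Finset.prod_mul_distrib, Finset.prod_const, Finset.card_univ,
      Fintype.card_fin]
    ring
  -- The sum is the total mass of the same protocol run on a source whose `X` and `Y` are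
  -- independent, with `Y` distributed as the output for uniform input.
  norm := by
    have hP := π.isProbabilityMeasure_law hm
      (jointLaw (PMF.uniformOfFintype Bool) fun _ => outPMF p hp)
    have h := measure_preimage_eq_tsum (π.law (uniformSource m k)
      (jointLaw (PMF.uniformOfFintype Bool) fun _ => outPMF p hp)) π.measurableSet_record Set.univ
    rw [Set.preimage_univ, measure_univ, ENNReal.tsum_prod'] at h
    refine le_of_eq (Eq.trans (tsum_congr fun l => ?_) h.symm)
    simp only [tsum_fintype, Fintype.sum_prod_type, Set.indicator_univ, π.law_record hm,
      jointLaw_apply, outPMF_apply, PMF.uniformOfFintype_apply, Fintype.card_bool,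
      Finset.prod_mul_distrib, Finset.prod_const, Finset.card_univ, Fintype.card_fin, Nat.cast_ofNat]
    refine Finset.sum_congr rfl fun b _ => Finset.sum_congr rfl fun x _ =>
      Finset.sum_congr rfl fun a _ => Finset.sum_congr rfl fun y _ =>
      Finset.sum_congr rfl fun g _ => by ring
  conc hn δ hδ := by
    classical
    have := isProbabilityMeasure_uniformSource hm k
    have h := pi_count_concentration (bes p hp).toMeasure
      (D := {z : Bool × Option Bool | z.2 = none}) MeasurableSet.of_discrete
      (bes_real_erased hp) hn hδ
    refine le_trans (le_of_eq ?_) h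
    set S : Set (Fin n → Bool × Option Bool) := {w | δ * n ≤ |((Finset.univ.filter fun i =>
      w i ∈ {z : Bool × Option Bool | z.2 = none}).card : ℝ) - n * p|}
    have : {ω : π.Space | δ * n ≤ |((erasures fun i => (ω.1.2 i).2).card : ℝ) - n * p|} =
        (Set.univ ×ˢ S) ×ˢ Set.univ := by
      ext ω; simp [S, erasures]
    rw [this, law, Measure.prod_prod, Measure.prod_prod]
    simp

theorem card_bounds (hm : 2 ≤ m) {p : ℝ} (hp : p ∈ Set.Icc (0 : ℝ) 1) {ε : ℝ}
    (sec : π.IsSecure (uniformSource m k) (bes p hp) otF otG ε) (hε : ε ≤ 1 / (100 * m)) {δ : ℝ}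
    (hδ : 0 < δ) (hn : 0 < n) (hδn : 100 ≤ δ ^ 2 * n) :
    (k : ℝ) ≤ n * (1 - p) + δ * n + 6 ∧ (k : ℝ) * (m - 1) ≤ n * p + δ * n + 2 := by
  have := π.isProbabilityMeasure_law hm (bes p hp)
  have hM : Measurable π.messages := measurable_to_countable' fun l =>
    (π.erasureExecution hm hp).measurableSet_event fun t => t.1 = l
  refine (π.erasureExecution hm hp).card_bounds hm sec ?_ ?_ Prod.snd
    (fun S => measurable_snd MeasurableSet.of_discrete) (fun _ => rfl) Prod.snd
    (fun S => measurable_snd MeasurableSet.of_discrete) (fun _ => rfl) hε hδ hn hδn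
  · exact (by fun_prop : Measurable fun ω : π.Space => ω.2.1).prodMk
      ((by fun_prop : Measurable fun ω : π.Space => fun i => (ω.1.2 i).1).prodMk hM)
  · exact (by fun_prop : Measurable fun ω : π.Space => ω.2.2).prodMk
      ((by fun_prop : Measurable fun ω : π.Space => fun i => (ω.1.2 i).2).prodMk hM)

end SourceProtocol

/-! ### Channel-model executions -/

/-- The channel uses `ws` map the inputs `xs` to the outputs `ys`. -/
def NoiseMaps {𝓧 𝓨 : Type} : List (𝓧 → 𝓨) → List 𝓧 → List 𝓨 → Prop
  | [], [], [] => True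
  | w :: ws, x :: xs, y :: ys => w x = y ∧ NoiseMaps ws xs ys
  | _, _, _ => False

theorem noiseMaps_ofFn {𝓧 𝓨 : Type} {n : ℕ} (w : Fin n → 𝓧 → 𝓨) (x : Fin n → 𝓧) (y : Fin n → 𝓨) :
    NoiseMaps (List.ofFn w) (List.ofFn x) (List.ofFn y) ↔ ∀ i, w i (x i) = y i := by
  induction n with
  | zero => simp [NoiseMaps]
  | succ n ih => simp only [List.ofFn_succ, NoiseMaps, Fin.forall_fin_succ, ih]

theorem ofFn_getD {α : Type*} {n : ℕ} (l : List α) (d : α) (hl : l.length = n) :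
    List.ofFn (fun i : Fin n => l.getD i d) = l := by
  subst hl
  refine List.ext_getElem (by simp) fun i h1 h2 => ?_
  simp

theorem getD_ofFn {α : Type*} {n : ℕ} (x : Fin n → α) (d : α) :
    (fun i : Fin n => (List.ofFn x).getD i d) = x := by
  ext i
  simp

namespace ChannelProtocol

variable {m n k : ℕ} (π : OTChannelProtocol Bool (Option Bool) m n k)

/-- Alice's local randomness makes her produce the inputs and messages of the given future. -/
def AliceConsistent (a : Fin k → Fin m → Bool) (zA : π.ZA) :
    List Step → List Bool → List π.Msg → List Bool → List π.Msg → Prop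
  | [], _, _, [], [] => True
  | Step.talk :: s, xs, ms, xf, c :: mf =>
      (Even ms.length → π.aliceMsg a zA xs ms = c) ∧
        AliceConsistent a zA s xs (ms ++ [c]) xf mf
  | Step.send :: s, xs, ms, x :: xf, mf =>
      π.input a zA xs ms = x ∧ AliceConsistent a zA s (xs ++ [x]) ms xf mf
  | _, _, _, _, _ => False

/-- Bob's local randomness makes him produce the messages of the given future. -/
def BobConsistent (b : Fin k → Fin m) (zB : π.ZB) :
    List Step → List (Option Bool) → List π.Msg → List (Option Bool) → List π.Msg → Prop
  | [], _, _, [], [] => True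
  | Step.talk :: s, ys, ms, yf, c :: mf =>
      (¬ Even ms.length → π.bobMsg b zB ys ms = c) ∧
        BobConsistent b zB s ys (ms ++ [c]) yf mf
  | Step.send :: s, ys, ms, y :: yf, mf => BobConsistent b zB s (ys ++ [y]) ms yf mf
  | _, _, _, _, _ => False

/-- Running only appends to the three lists, and the input and output lists grow by one at each
channel use. This names the increments for the induction in `run_eq_iff`. -/
theorem exists_run_eq_append (a : Fin k → Fin m → Bool) (b : Fin k → Fin m) (zA : π.ZA) (zB : π.ZB)
    (s : List Step) (ws : List (Bool → Option Bool)) (xs : List Bool) (ys : List (Option Bool))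
    (ms : List π.Msg) (hws : ws.length = s.count Step.send) :
    ∃ xf yf mf, π.run a b zA zB s ws xs ys ms = (xs ++ xf, ys ++ yf, ms ++ mf) ∧
      xf.length = s.count Step.send ∧ yf.length = s.count Step.send := by
  induction s generalizing ws xs ys ms with
  | nil => exact ⟨[], [], [], by simp [run]⟩
  | cons st s ih =>
    cases st with
    | talk =>
      obtain ⟨xf, yf, mf, h, h1, h2⟩ := ih ws xs ys
        (ms ++ [if Even ms.length then π.aliceMsg a zA xs ms else π.bobMsg b zB ys ms])
        (by simpa using hws)
      refine ⟨xf, yf, (if Even ms.length then π.aliceMsg a zA xs ms else π.bobMsg b zB ys ms) :: mf,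
        ?_, by simpa using h1, by simpa using h2⟩
      rw [run, h]
      simp
    | send =>
      cases ws with
      | nil => simp at hws
      | cons w ws =>
        obtain ⟨xf, yf, mf, h, h1, h2⟩ := ih ws (xs ++ [π.input a zA xs ms])
          (ys ++ [w (π.input a zA xs ms)]) ms (by simpa using hws)
        refine ⟨π.input a zA xs ms :: xf, w (π.input a zA xs ms) :: yf, mf, ?_, by simpa using h1,
          by simpa using h2⟩
        rw [run, h]
        simp

/-- Once the whole future is prescribed, each step tests one party only: Alice's input or message,
Bob's message, or the noise. The channel model thus has the same rectangle structure as the source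
model, in spite of the adaptive inputs. -/
theorem run_eq_iff (a : Fin k → Fin m → Bool) (b : Fin k → Fin m) (zA : π.ZA) (zB : π.ZB)
    (s : List Step) (ws : List (Bool → Option Bool)) (xs : List Bool) (ys : List (Option Bool))
    (ms : List π.Msg) (hws : ws.length = s.count Step.send) (xf : List Bool)
    (yf : List (Option Bool)) (mf : List π.Msg) :
    π.run a b zA zB s ws xs ys ms = (xs ++ xf, ys ++ yf, ms ++ mf) ↔
      π.AliceConsistent a zA s xs ms xf mf ∧ π.BobConsistent b zB s ys ms yf mf ∧
        NoiseMaps ws xf yf := by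
  induction s generalizing ws xs ys ms xf yf mf with
  | nil =>
    have : ws = [] := by simpa using hws
    subst this
    cases xf <;> cases yf <;> cases mf <;> simp [run, AliceConsistent, BobConsistent, NoiseMaps]
  | cons st s ih =>
    cases st with
    | talk =>
      have hws' : ws.length = s.count Step.send := by simpa using hws
      rw [run]
      set c := if Even ms.length then π.aliceMsg a zA xs ms else π.bobMsg b zB ys ms with hc
      cases mf with
      | nil =>
        obtain ⟨xf', yf', mf', h, -⟩ := π.exists_run_eq_append a b zA zB s ws xs ys (ms ++ [c]) hws'
        rw [h]
        simp [AliceConsistent]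
      | cons d mf =>
        have key : π.run a b zA zB s ws xs ys (ms ++ [c]) = (xs ++ xf, ys ++ yf, ms ++ d :: mf) ↔
            c = d ∧ π.run a b zA zB s ws xs ys (ms ++ [d]) =
              (xs ++ xf, ys ++ yf, (ms ++ [d]) ++ mf) := by
          obtain ⟨xf', yf', mf', h, -⟩ :=
            π.exists_run_eq_append a b zA zB s ws xs ys (ms ++ [c]) hws'
          constructor
          · intro h1
            have hcd : c = d := by
              rw [h] at h1
              simp only [Prod.mk.injEq, List.append_assoc, List.append_cancel_left_eq,
                List.cons_append, List.nil_append, List.cons.injEq] at h1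
              exact h1.2.2.1
            subst hcd
            exact ⟨rfl, by simpa using h1⟩
          · rintro ⟨rfl, h1⟩
            simpa using h1
        rw [key, ih ws xs ys (ms ++ [d]) hws' xf yf mf]
        simp only [AliceConsistent, BobConsistent, hc]
        split_ifs with he <;> simp only [he, not_true_eq_false, not_false_eq_true, true_implies,
          false_implies, true_and] <;> tauto
    | send =>
      cases ws with
      | nil => simp at hws
      | cons w ws =>
        have hws' : ws.length = s.count Step.send := by simpa using hws
        rw [run]
        set x := π.input a zA xs ms with hx
        obtain ⟨xf', yf', mf', h, -⟩ := π.exists_run_eq_append a b zA zB s ws (xs ++ [x])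
          (ys ++ [w x]) ms hws'
        cases xf with
        | nil => rw [h]; simp [AliceConsistent]
        | cons x' xf =>
          cases yf with
          | nil => rw [h]; simp [BobConsistent]
          | cons y' yf =>
            have key : π.run a b zA zB s ws (xs ++ [x]) (ys ++ [w x]) ms =
                (xs ++ x' :: xf, ys ++ y' :: yf, ms ++ mf) ↔
                (x = x' ∧ w x' = y') ∧ π.run a b zA zB s ws (xs ++ [x']) (ys ++ [y']) ms =
                  ((xs ++ [x']) ++ xf, (ys ++ [y']) ++ yf, ms ++ mf) := by
              constructor
              · intro h1
                have hcd : x = x' ∧ w x = y' := by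
                  rw [h] at h1
                  simp only [Prod.mk.injEq, List.append_assoc, List.append_cancel_left_eq,
                    List.cons_append, List.nil_append, List.cons.injEq] at h1
                  exact ⟨h1.1.1, h1.2.1.1⟩
                obtain ⟨h2, h3⟩ := hcd
                rw [← h2, ← h3]
                exact ⟨⟨rfl, rfl⟩, by simpa [← h2, ← h3] using h1⟩
              · rintro ⟨⟨h2, h3⟩, h1⟩
                rw [h2, h3]
                simpa using h1
            rw [key, ih ws (xs ++ [x']) (ys ++ [y']) ms hws' xf yf mf]
            simp only [AliceConsistent, BobConsistent, NoiseMaps, ← hx]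
            tauto

theorem measurableSet_aliceConsistent (a : Fin k → Fin m → Bool) (s : List Step) (xs : List Bool)
    (ms : List π.Msg) (xf : List Bool) (mf : List π.Msg) :
    MeasurableSet {zA | π.AliceConsistent a zA s xs ms xf mf} := by
  induction s generalizing xs ms xf mf with
  | nil => cases xf <;> cases mf <;> simp [AliceConsistent]
  | cons st s ih =>
    cases st with
    | talk =>
      cases mf with
      | nil => simp [AliceConsistent]
      | cons c mf =>
        simp only [AliceConsistent]
        have h : MeasurableSet {zA | Even ms.length → π.aliceMsg a zA xs ms = c} := by
          by_cases he : Even ms.length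
          · simp only [he, true_implies]
            exact π.meas_aliceMsg a xs ms c
          · simp [he]
        exact h.inter (ih xs (ms ++ [c]) xf mf)
    | send =>
      cases xf with
      | nil => simp [AliceConsistent]
      | cons x xf =>
        simp only [AliceConsistent]
        exact (π.meas_input a xs ms x).inter (ih (xs ++ [x]) ms xf mf)

theorem measurableSet_bobConsistent (b : Fin k → Fin m) (s : List Step) (ys : List (Option Bool))
    (ms : List π.Msg) (yf : List (Option Bool)) (mf : List π.Msg) :
    MeasurableSet {zB | π.BobConsistent b zB s ys ms yf mf} := by
  induction s generalizing ys ms yf mf with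
  | nil => cases yf <;> cases mf <;> simp [BobConsistent]
  | cons st s ih =>
    cases st with
    | talk =>
      cases mf with
      | nil => simp [BobConsistent]
      | cons c mf =>
        simp only [BobConsistent]
        have h : MeasurableSet {zB | ¬ Even ms.length → π.bobMsg b zB ys ms = c} := by
          by_cases he : Even ms.length
          · simp [he]
          · simp only [he, not_false_eq_true, true_implies]
            exact π.meas_bobMsg b ys ms c
        exact h.inter (ih ys (ms ++ [c]) yf mf)
    | send =>
      cases yf with
      | nil => simp [BobConsistent]
      | cons y yf =>
        simp only [BobConsistent]
        exact ih (ys ++ [y]) ms yf mf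

/-- The channel inputs as a vector. -/
def inputs (ω : π.Space) (i : Fin n) : Bool := (π.execution ω).1.getD i false

/-- The channel outputs as a vector. -/
def outputs (ω : π.Space) (i : Fin n) : Option Bool := (π.execution ω).2.1.getD i none

theorem ofFn_inputs (ω : π.Space) : List.ofFn (π.inputs ω) = (π.execution ω).1 := by
  obtain ⟨xf, yf, mf, h, h1, -⟩ := π.exists_run_eq_append ω.1.1.1 ω.1.1.2 ω.2.1 ω.2.2 π.schedule
    (List.ofFn ω.1.2) [] [] [] (by simp [π.count_send])
  refine ofFn_getD _ _ ?_
  rw [execution, h]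
  simpa [π.count_send] using h1

theorem ofFn_outputs (ω : π.Space) : List.ofFn (π.outputs ω) = (π.execution ω).2.1 := by
  obtain ⟨xf, yf, mf, h, -, h1⟩ := π.exists_run_eq_append ω.1.1.1 ω.1.1.2 ω.2.1 ω.2.2 π.schedule
    (List.ofFn ω.1.2) [] [] [] (by simp [π.count_send])
  refine ofFn_getD _ _ ?_
  rw [execution, h]
  simpa [π.count_send] using h1

/-- All variables of an execution that matter for the upper bounds. -/
def record (ω : π.Space) : List π.Msg × (Fin k → Fin m) × (Fin n → Bool) × (Fin k → Fin m → Bool) ×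
    (Fin n → Option Bool) × (Fin k → Bool) :=
  ((π.execution ω).2.2, ω.1.1.2, π.inputs ω, ω.1.1.1, π.outputs ω,
    π.bobEst ω.1.1.2 ω.2.2 (π.execution ω).2.1 (π.execution ω).2.2)

/-- The values of Alice's local randomness that are consistent with her inputs and messages. -/
def aliceSet (a : Fin k → Fin m → Bool) (x : Fin n → Bool) (l : List π.Msg) : Set π.ZA :=
  {zA | π.AliceConsistent a zA π.schedule [] [] (List.ofFn x) l}

/-- The values of Bob's local randomness that are consistent with his messages and estimate. -/
def bobSet (b : Fin k → Fin m) (y : Fin n → Option Bool) (l : List π.Msg) (g : Fin k → Bool) :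
    Set π.ZB :=
  {zB | π.BobConsistent b zB π.schedule [] [] (List.ofFn y) l ∧ π.bobEst b zB (List.ofFn y) l = g}

theorem record_preimage (l : List π.Msg) (b : Fin k → Fin m) (x : Fin n → Bool)
    (a : Fin k → Fin m → Bool) (y : Fin n → Option Bool) (g : Fin k → Bool) :
    π.record ⁻¹' {(l, b, x, a, y, g)} =
      ({(a, b)} ×ˢ {w | ∀ i, w i (x i) = y i}) ×ˢ (π.aliceSet a x l ×ˢ π.bobSet b y l g) := by
  ext ω
  have hex : π.execution ω = (List.ofFn x, List.ofFn y, l) ↔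
      π.inputs ω = x ∧ π.outputs ω = y ∧ (π.execution ω).2.2 = l := by
    rw [← List.ofFn_inj, ← List.ofFn_inj, π.ofFn_inputs, π.ofFn_outputs, Prod.ext_iff, Prod.ext_iff]
  have hrun := π.run_eq_iff ω.1.1.1 ω.1.1.2 ω.2.1 ω.2.2 π.schedule
    (List.ofFn ω.1.2) [] [] [] (by simp [π.count_send]) (List.ofFn x) (List.ofFn y) l
  simp only [List.nil_append, noiseMaps_ofFn] at hrun
  change π.execution ω = _ ↔ _ at hrun
  obtain ⟨⟨⟨a', b'⟩, w⟩, zA, zB⟩ := ω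
  simp only [record, Set.mem_preimage, Set.mem_singleton_iff, Prod.mk.injEq, Set.mem_prod,
    aliceSet, bobSet, Set.mem_ofPred_eq]
  constructor
  · rintro ⟨h1, rfl, h2, rfl, h3, h4⟩
    have h := hex.2 ⟨h2, h3, h1⟩
    have h' := hrun.1 h
    rw [h] at h4
    exact ⟨⟨⟨rfl, rfl⟩, h'.2.2⟩, h'.1, h'.2.1, h4⟩
  · rintro ⟨⟨⟨rfl, rfl⟩, h1⟩, h2, h3, h4⟩
    have h := hrun.2 ⟨h2, h3, h1⟩
    have h' := hex.1 h
    rw [h]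
    exact ⟨rfl, rfl, h'.1, rfl, h'.2.1, h4⟩

theorem outputs_eq (ω : π.Space) (i : Fin n) : π.outputs ω i = ω.1.2 i (π.inputs ω i) := by
  have h : ω ∈ π.record ⁻¹' {((π.execution ω).2.2, ω.1.1.2, π.inputs ω, ω.1.1.1, π.outputs ω,
    π.bobEst ω.1.1.2 ω.2.2 (π.execution ω).2.1 (π.execution ω).2.2)} := rfl
  rw [record_preimage] at h
  exact (h.1.2 i).symm

theorem measurableSet_record (t) : MeasurableSet (π.record ⁻¹' {t}) := by
  obtain ⟨l, b, x, a, y, g⟩ := t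
  rw [record_preimage]
  exact ((measurableSet_singleton _).prod MeasurableSet.of_discrete).prod
    ((π.measurableSet_aliceConsistent _ _ _ _ _ _).prod
      ((π.measurableSet_bobConsistent _ _ _ _ _ _).inter (π.meas_bobEst b _ l g)))

/-- The law on the sample space for iid channel noise with law `ν`. -/
noncomputable def lawOfNoise (ν : Measure (Bool → Option Bool)) : Measure π.Space :=
  ((uniformSource m k).prod (Measure.pi fun _ : Fin n => ν)).prod (π.lawA.prod π.lawB)

theorem isProbabilityMeasure_lawOfNoise (hm : 2 ≤ m) (ν : Measure (Bool → Option Bool))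
    [IsProbabilityMeasure ν] : IsProbabilityMeasure (π.lawOfNoise ν) := by
  have := isProbabilityMeasure_uniformSource hm k
  unfold lawOfNoise
  infer_instance

/-- Each channel use evaluates its noise at one input only, so the law of the record depends on `ν`
only through its one-input marginals. The noise law may therefore be exchanged for a more convenient
one. -/
theorem lawOfNoise_record (hm : 2 ≤ m) (ν : Measure (Bool → Option Bool)) [IsProbabilityMeasure ν]
    (l : List π.Msg) (b : Fin k → Fin m) (x : Fin n → Bool)
    (a : Fin k → Fin m → Bool) (y : Fin n → Option Bool) (g : Fin k → Bool) :
    π.lawOfNoise ν (π.record ⁻¹' {(l, b, x, a, y, g)}) =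
      (Fintype.card ((Fin k → Fin m → Bool) × (Fin k → Fin m)) : ℝ≥0∞)⁻¹ *
        π.lawA (π.aliceSet a x l) * π.lawB (π.bobSet b y l g) * ∏ i, ν {w | w (x i) = y i} := by
  have := isProbabilityMeasure_uniformSource hm k
  have hpi : {w : Fin n → Bool → Option Bool | ∀ i, w i (x i) = y i} =
      Set.univ.pi fun i => {w | w (x i) = y i} := by
    ext w; simp
  rw [record_preimage, lawOfNoise, Measure.prod_prod, Measure.prod_prod, Measure.prod_prod,
    uniformSource_singleton, hpi, Measure.pi_pi]
  ring

end ChannelProtocol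

/-! ### Noise laws -/

section Noise

variable {p : ℝ} (hp : p ∈ Set.Icc (0 : ℝ) 1)

theorem pi_bec_apply (x : Bool) (y : Option Bool) :
    (Measure.pi fun x : Bool => (bec p hp x).toMeasure) {w | w x = y} = bec p hp x y := by
  have h := (measurePreserving_eval (fun x : Bool => (bec p hp x).toMeasure) x).measure_preimage
    (measurableSet_singleton y).nullMeasurableSet
  rw [PMF.toMeasure_apply_singleton _ _ (measurableSet_singleton _)] at h
  exact h

/-- Noise that erases both inputs or none. -/
noncomputable def commonNoise (p : ℝ) : Measure (Bool → Option Bool) :=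
  ENNReal.ofReal p • Measure.dirac (fun _ => none) + ENNReal.ofReal (1 - p) • Measure.dirac some

theorem isProbabilityMeasure_commonNoise {p : ℝ} (hp : p ∈ Set.Icc (0 : ℝ) 1) :
    IsProbabilityMeasure (commonNoise p) :=
  ⟨by simp [commonNoise, ← ENNReal.ofReal_add hp.1 (sub_nonneg.2 hp.2)]⟩

theorem commonNoise_apply (x : Bool) (y : Option Bool) :
    commonNoise p {w | w x = y} = bec p hp x y := by
  have h1 : 0 ≤ 1 - p := sub_nonneg.2 hp.2
  simp only [commonNoise, Measure.add_apply, Measure.smul_apply, smul_eq_mul, Measure.dirac_apply,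
    Set.indicator_apply, Set.mem_ofPred_eq, bec, PMF.ofFintype_apply, eq_comm (a := y)]
  rw [ENNReal.ofReal_add (mul_nonneg hp.1 (by split_ifs <;> norm_num))
    (mul_nonneg h1 (by split_ifs <;> norm_num)), ENNReal.ofReal_mul hp.1, ENNReal.ofReal_mul h1]
  congr 2 <;> split_ifs <;> simp

theorem commonNoise_ae : ∀ᵐ w ∂(commonNoise p), ∀ x, w x = none ↔ w true = none := by
  rw [commonNoise, ae_add_measure_iff]
  constructor
  · refine Measure.ae_smul_measure ?_ _
    rw [ae_dirac_iff MeasurableSet.of_discrete]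
    simp
  · refine Measure.ae_smul_measure ?_ _
    rw [ae_dirac_iff MeasurableSet.of_discrete]
    simp

/-- Noise whose output does not depend on the input. -/
noncomputable def constNoise : Measure (Bool → Option Bool) :=
  (outPMF p hp).toMeasure.map fun y _ => y

theorem isProbabilityMeasure_constNoise : IsProbabilityMeasure (constNoise hp) :=
  Measure.isProbabilityMeasure_map (Measurable.of_discrete).aemeasurable

theorem constNoise_apply (x : Bool) (y : Option Bool) :
    constNoise hp {w | w x = y} = outLaw p hp y := by
  rw [constNoise, Measure.map_apply Measurable.of_discrete MeasurableSet.of_discrete, ← outPMF_apply,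
    ← PMF.toMeasure_apply_singleton _ _ (measurableSet_singleton _)]
  rfl

end Noise

/-! ### Channel protocols as erasure executions -/

namespace ChannelProtocol

variable {m n k : ℕ} (π : OTChannelProtocol Bool (Option Bool) m n k)

/-- A channel-model execution with the erasure channel. -/
noncomputable def erasureExecution (hm : 2 ≤ m) {p : ℝ} (hp : p ∈ Set.Icc (0 : ℝ) 1) :
    ErasureExecution hp (π.law (uniformSource m k) (bec p hp)) (fun ω => (π.execution ω).2.2)
      (fun ω => ω.1.1.2) π.inputs (fun ω => ω.1.1.1) π.outputs
      (fun ω => π.bobEst ω.1.1.2 ω.2.2 (π.execution ω).2.1 (π.execution ω).2.2) where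
  meas := π.measurableSet_record
  unif := by
    have := isProbabilityMeasure_uniformSource hm k
    refine ⟨(Fintype.card ((Fin k → Fin m → Bool) × (Fin k → Fin m)) : ℝ≥0∞)⁻¹, fun a b => ?_⟩
    have : (fun ω : π.Space => ω.1.1.1) ⁻¹' {a} ∩ (fun ω : π.Space => ω.1.1.2) ⁻¹' {b} =
        ({(a, b)} ×ˢ Set.univ) ×ˢ Set.univ := by
      ext ω; simp [Prod.ext_iff]
    rw [this, law, Measure.prod_prod, Measure.prod_prod, uniformSource_singleton]
    simp
  α l x a := (Fintype.card ((Fin k → Fin m → Bool) × (Fin k → Fin m)) : ℝ≥0∞)⁻¹ *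
        π.lawA (π.aliceSet a x l)
  β l b y g := π.lawB (π.bobSet b y l g)
  β_le _ _ _ _ := prob_le_one
  fact l b x a y g := by
    refine (π.lawOfNoise_record hm (Measure.pi fun x : Bool => (bec p hp x).toMeasure)
      l b x a y g).trans ?_
    simp only [pi_bec_apply]
  -- The noise that ignores its input turns the sum into the total mass of a probability measure.
  norm := by
    have := isProbabilityMeasure_constNoise hp
    have := π.isProbabilityMeasure_lawOfNoise hm (constNoise hp)
    have h := measure_preimage_eq_tsum (π.lawOfNoise (constNoise hp)) π.measurableSet_record Set.univ
    rw [Set.preimage_univ, measure_univ, ENNReal.tsum_prod'] at h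
    refine le_of_eq (Eq.trans (tsum_congr fun l => ?_) h.symm)
    simp only [tsum_fintype, Fintype.sum_prod_type, Set.indicator_univ,
      π.lawOfNoise_record hm, constNoise_apply]
  conc hn δ hδ := by
    classical
    have := isProbabilityMeasure_uniformSource hm k
    have := isProbabilityMeasure_commonNoise hp
    have := π.isProbabilityMeasure_lawOfNoise hm (commonNoise p)
    -- Under the original noise an erasure may occur for one input and not for the other, so the
    -- erasure pattern depends on the adaptive inputs. `commonNoise` has the same marginals, hence
    -- the same law of the record, and erases regardless of the input; the erasures are then
    -- independent over the channel uses.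
    have hlaw : π.law (uniformSource m k) (bec p hp)
        {ω | δ * n ≤ |((erasures (π.outputs ω)).card : ℝ) - n * p|} =
        π.lawOfNoise (commonNoise p)
          {ω | δ * n ≤ |((erasures (π.outputs ω)).card : ℝ) - n * p|} := by
      have e : {ω | δ * n ≤ |((erasures (π.outputs ω)).card : ℝ) - n * p|} =
        π.record ⁻¹' {t | δ * n ≤ |((erasures t.2.2.2.2.1).card : ℝ) - n * p|} := rfl
      rw [e, measure_preimage_eq_tsum _ π.measurableSet_record,
        measure_preimage_eq_tsum _ π.measurableSet_record]
      refine tsum_congr ?_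
      rintro ⟨l, b, x, a, y, g⟩
      have h1 := π.lawOfNoise_record hm (Measure.pi fun x : Bool => (bec p hp x).toMeasure)
        l b x a y g
      have h2 := π.lawOfNoise_record hm (commonNoise p) l b x a y g
      simp only [pi_bec_apply, commonNoise_apply hp] at h1 h2
      change π.law (uniformSource m k) (bec p hp) _ = _ at h1
      simp only [Set.indicator_apply, h1, h2]
    rw [hlaw]
    have hreal : (commonNoise p).real {w | w true = none} = p := by
      rw [Measure.real, commonNoise_apply hp, bec_none, ENNReal.toReal_ofReal hp.1]
    have h := pi_count_concentration (commonNoise p)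
      (D := {w : Bool → Option Bool | w true = none}) MeasurableSet.of_discrete hreal hn hδ
    refine le_trans ?_ h
    set S : Set (Fin n → Bool → Option Bool) := {w | δ * n ≤ |((Finset.univ.filter fun i =>
      w i ∈ {w : Bool → Option Bool | w true = none}).card : ℝ) - n * p|}
    have hS : π.lawOfNoise (commonNoise p) ((Set.univ ×ˢ S) ×ˢ Set.univ) =
        (Measure.pi fun _ : Fin n => commonNoise p) S := by
      rw [lawOfNoise, Measure.prod_prod, Measure.prod_prod]
      simp
    rw [← hS]
    have hae : ∀ᵐ w ∂(Measure.pi fun _ : Fin n => commonNoise p),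
        ∀ i x, w i x = none ↔ w i true = none := by
      rw [ae_all_iff]
      intro i
      exact (measurePreserving_eval (fun _ : Fin n => commonNoise p) i).quasiMeasurePreserving.ae
        commonNoise_ae
    have hae' : ∀ᵐ ω ∂(π.lawOfNoise (commonNoise p)),
        ∀ i x, ω.1.2 i x = none ↔ ω.1.2 i true = none := by
      have q1 : Measure.QuasiMeasurePreserving (fun ω : π.Space => ω.1)
          (π.lawOfNoise (commonNoise p))
          ((uniformSource m k).prod (Measure.pi fun _ : Fin n => commonNoise p)) :=
        Measure.quasiMeasurePreserving_fst
      exact q1.ae (Measure.quasiMeasurePreserving_snd.ae hae)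
    refine measure_mono_ae ?_
    filter_upwards [hae'] with ω hω h
    have : erasures (π.outputs ω) = Finset.univ.filter fun i =>
        ω.1.2 i ∈ {w : Bool → Option Bool | w true = none} := by
      ext i
      simp [erasures, π.outputs_eq, hω i (π.inputs ω i)]
    refine ⟨⟨trivial, ?_⟩, trivial⟩
    change δ * n ≤ _
    rw [← this]
    exact h

theorem card_bounds (hm : 2 ≤ m) {p : ℝ} (hp : p ∈ Set.Icc (0 : ℝ) 1) {ε : ℝ}
    (sec : π.IsSecure (uniformSource m k) (bec p hp) otF otG ε) (hε : ε ≤ 1 / (100 * m)) {δ : ℝ}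
    (hδ : 0 < δ) (hn : 0 < n) (hδn : 100 ≤ δ ^ 2 * n) :
    (k : ℝ) ≤ n * (1 - p) + δ * n + 6 ∧ (k : ℝ) * (m - 1) ≤ n * p + δ * n + 2 := by
  have : IsProbabilityMeasure (π.law (uniformSource m k) (bec p hp)) :=
    π.isProbabilityMeasure_lawOfNoise hm (Measure.pi fun x : Bool => (bec p hp x).toMeasure)
  have hM : Measurable fun ω => (π.execution ω).2.2 := measurable_to_countable' fun l =>
    (π.erasureExecution hm hp).measurableSet_event fun t => t.1 = l
  have hX : Measurable fun ω => (π.execution ω).1 := measurable_to_countable' fun l => by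
    have := (π.erasureExecution hm hp).measurableSet_event fun t => List.ofFn t.2.2.1 = l
    simp only [ofFn_inputs] at this
    exact this
  have hY : Measurable fun ω => (π.execution ω).2.1 := measurable_to_countable' fun l => by
    have := (π.erasureExecution hm hp).measurableSet_event fun t => List.ofFn t.2.2.2.2.1 = l
    simp only [ofFn_outputs] at this
    exact this
  refine (π.erasureExecution hm hp).card_bounds hm sec ?_ ?_
    (fun v => (fun i => v.2.1.getD i false, v.2.2))
    (fun S => measurable_snd (MeasurableSet.of_discrete
      (s := (fun v : List Bool × List π.Msg => ((fun i : Fin n => v.1.getD i false), v.2)) ⁻¹' S)))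
    (fun _ => rfl)
    (fun v => (fun i => v.2.1.getD i none, v.2.2))
    (fun S => measurable_snd (MeasurableSet.of_discrete (s :=
      (fun v : List (Option Bool) × List π.Msg => ((fun i : Fin n => v.1.getD i none), v.2)) ⁻¹' S)))
    (fun _ => rfl) hε hδ hn hδn
  · exact (by fun_prop : Measurable fun ω : π.Space => ω.2.1).prodMk (hX.prodMk hM)
  · exact (by fun_prop : Measurable fun ω : π.Space => ω.2.2).prodMk (hY.prodMk hM)

end ChannelProtocol

/-! ### The SWOT protocol -/

section Swot

variable {m n k : ℕ}

/-- The sample space of the SWOT protocol in the source model. -/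
abbrev SwotSpace (m n k : ℕ) : Type :=
  (((Fin k → Fin m → Bool) × (Fin k → Fin m)) × (Fin n → Bool × Option Bool)) ×
    (Unit × IndexTable m n k)

instance instDiscreteMeasurableSpaceSwotSpace : DiscreteMeasurableSpace (SwotSpace m n k) :=
  ⟨fun s => s.to_countable.measurableSet⟩

/-- The law on the sample space of the SWOT protocol in the source model. -/
noncomputable def swotLaw (m n k : ℕ) {p : ℝ} (hp : p ∈ Set.Icc (0 : ℝ) 1) :
    Measure (SwotSpace m n k) :=
  ((uniformSource m k).prod (Measure.pi fun _ : Fin n => (bes p hp).toMeasure)).prod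
    ((Measure.dirac ()).prod (indexTableLaw m n k))

/-- The messages of the SWOT protocol, where `o` is Bob's matrix if he does not abort. -/
def swotTranscript (a : Fin k → Fin m → Bool) (x : Fin n → Bool)
    (o : Option (Fin k → Fin m → Fin n)) : List (SwotMsg m n k) :=
  [none, o.map Sum.inl, o.map fun U => Sum.inr fun i j => xor (a i j) (x (U i j))]

/-- There are enough erasures and non-erasures for `k` samples. -/
def Suffices (m k : ℕ) (y : Fin n → Option Bool) : Prop :=
  k ≤ (nonErasures y).card ∧ k * (m - 1) ≤ (erasures y).card

theorem isProbabilityMeasure_swotLaw (hm : 2 ≤ m) {p : ℝ} (hp : p ∈ Set.Icc (0 : ℝ) 1) :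
    IsProbabilityMeasure (swotLaw m n k hp) := by
  have := isProbabilityMeasure_uniformSource hm k
  unfold swotLaw
  infer_instance

theorem swotLaw_singleton (hm : 2 ≤ m) {p : ℝ} (hp : p ∈ Set.Icc (0 : ℝ) 1)
    (ω : SwotSpace m n k) :
    swotLaw m n k hp {ω} = (Fintype.card ((Fin k → Fin m → Bool) × (Fin k → Fin m)) : ℝ≥0∞)⁻¹ *
      (∏ i, bes p hp (ω.1.2 i)) * indexTableLaw m n k {ω.2.2} := by
  have := isProbabilityMeasure_uniformSource hm k
  obtain ⟨⟨ab, xy⟩, u, z⟩ := ω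
  have : {((ab, xy), u, z)} = (({ab} : Set _) ×ˢ ({xy} : Set (Fin n → Bool × Option Bool))) ×ˢ
      (({u} : Set Unit) ×ˢ ({z} : Set (IndexTable m n k))) := by
    simp only [Set.singleton_prod_singleton]
  rw [swotLaw, this, Measure.prod_prod, Measure.prod_prod, Measure.prod_prod,
    uniformSource_singleton, Measure.pi_singleton]
  simp [PMF.toMeasure_apply_singleton _ _ (measurableSet_singleton _)]

theorem indexTableLaw_singleton (z : IndexTable m n k) :
    indexTableLaw m n k {z} = ∏ q, indexLaw q.1 q.2 (z q) := by
  rw [indexTableLaw, Measure.pi_singleton]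
  simp [PMF.toMeasure_apply_singleton _ _ (measurableSet_singleton _)]

theorem indexTableLaw_eval (b : Fin k → Fin m) (y : Fin n → Option Bool)
    (S : Set (Option (Fin k → Fin m → Fin n))) :
    indexTableLaw m n k {z | z (b, y) ∈ S} = (indexLaw b y).toMeasure S :=
  (measurePreserving_eval (fun q : (Fin k → Fin m) × (Fin n → Option Bool) =>
    (indexLaw q.1 q.2).toMeasure) (b, y)).measure_preimage
      (MeasurableSet.of_discrete).nullMeasurableSet

open Classical in
theorem indexLaw_none (b : Fin k → Fin m) (y : Fin n → Option Bool) :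
    indexLaw b y none = if Suffices m k y then 0 else 1 := by
  unfold indexLaw Suffices
  split_ifs with h
  · simp [PMF.map_apply]
  · simp

open Classical in
theorem indexLaw_some (b : Fin k → Fin m) (y : Fin n → Option Bool) (U : Fin k → Fin m → Fin n) :
    indexLaw b y (some U) =
      if Suffices m k y ∧ U ∈ indexMatrices b y then ((indexMatrices b y).card : ℝ≥0∞)⁻¹ else 0 := by
  unfold indexLaw Suffices
  by_cases h : k ≤ (nonErasures y).card ∧ k * (m - 1) ≤ (erasures y).card
  · simp only [h, dite_true, true_and, PMF.map_apply, Option.some.injEq, and_self]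
    rw [tsum_eq_single U]
    · simp [PMF.uniformOfFinset_apply]
    · intro U' hU'; simp [hU'.symm]
  · rw [dif_neg h, if_neg fun h' => h h'.1]
    simp

theorem mem_indexMatrices {b : Fin k → Fin m} {y : Fin n → Option Bool}
    {U : Fin k → Fin m → Fin n} : U ∈ indexMatrices b y ↔
      (∀ i j i' j', U i j = U i' j' → i = i' ∧ j = j') ∧
        ∀ i j, (j = b i → y (U i j) ≠ none) ∧ (j ≠ b i → y (U i j) = none) := by
  simp [indexMatrices, nonErasures, erasures]

theorem bes_none {p : ℝ} (hp : p ∈ Set.Icc (0 : ℝ) 1) (x x' : Bool) :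
    bes p hp (x, none) = bes p hp (x', none) := by
  simp [bes_apply, bec_none]

theorem bes_map_xor {p : ℝ} (hp : p ∈ Set.Icc (0 : ℝ) 1) (x x' : Bool) (y : Option Bool) :
    bes p hp (x', y.map fun v => xor v (xor x x')) = bes p hp (x, y) := by
  rcases y with _ | y <;> cases x <;> cases x' <;> (try cases y) <;> simp [bes_apply, bec]

/-- The probability of an event for given source samples. -/
theorem swotLaw_event (hm : 2 ≤ m) {p : ℝ} (hp : p ∈ Set.Icc (0 : ℝ) 1)
    (a : Fin k → Fin m → Bool) (b : Fin k → Fin m)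
    (Q : (Fin n → Bool) → (Fin n → Option Bool) → IndexTable m n k → Prop) :
    swotLaw m n k hp {ω | ω.1.1 = (a, b) ∧ Q (fun i => (ω.1.2 i).1) (fun i => (ω.1.2 i).2) ω.2.2} =
      (Fintype.card ((Fin k → Fin m → Bool) × (Fin k → Fin m)) : ℝ≥0∞)⁻¹ *
        ∑ x, ∑ y, (∏ i, bes p hp (x i, y i)) * indexTableLaw m n k {z | Q x y z} := by
  have := isProbabilityMeasure_uniformSource hm k
  have := isProbabilityMeasure_swotLaw (n := n) (k := k) hm hp
  rw [measure_eq_sum_fiber (swotLaw m n k hp) (W := fun ω : SwotSpace m n k =>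
    ((fun i => (ω.1.2 i).1, fun i => (ω.1.2 i).2) : (Fin n → Bool) × (Fin n → Option Bool)))
    (fun _ => MeasurableSet.of_discrete), Fintype.sum_prod_type, Finset.mul_sum]
  refine Finset.sum_congr rfl fun x _ => ?_
  rw [Finset.mul_sum]
  refine Finset.sum_congr rfl fun y _ => ?_
  have : ((fun ω : SwotSpace m n k => ((fun i => (ω.1.2 i).1, fun i => (ω.1.2 i).2) :
      (Fin n → Bool) × (Fin n → Option Bool))) ⁻¹' {(x, y)} ∩ {ω | ω.1.1 = (a, b) ∧
        Q (fun i => (ω.1.2 i).1) (fun i => (ω.1.2 i).2) ω.2.2}) =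
      ({(a, b)} ×ˢ {fun i => (x i, y i)}) ×ˢ (Set.univ ×ˢ {z | Q x y z}) := by
    ext ⟨⟨ab, xy⟩, u, z⟩
    simp only [Set.mem_inter_iff, Set.mem_preimage, Set.mem_singleton_iff, Prod.mk.injEq,
      Set.mem_ofPred_eq, Set.mem_prod, Set.mem_univ, true_and]
    constructor
    · rintro ⟨⟨rfl, rfl⟩, rfl, h⟩; exact ⟨⟨rfl, rfl⟩, h⟩
    · rintro ⟨⟨rfl, rfl⟩, h⟩; exact ⟨⟨rfl, rfl⟩, rfl, h⟩
  rw [this, swotLaw, Measure.prod_prod, Measure.prod_prod, Measure.prod_prod,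
    uniformSource_singleton, Measure.pi_singleton]
  simp only [PMF.toMeasure_apply_singleton _ _ (measurableSet_singleton _)]
  simp [mul_assoc]

/-! #### Alice's privacy -/

/-- Flip the bits at the locations in a matrix where `a` and `a'` differ. -/
noncomputable def flipAt (U : Fin k → Fin m → Fin n) (a a' : Fin k → Fin m → Bool) :
    Equiv.Perm (Fin n → Bool) :=
  open Classical in
  Function.Involutive.toPerm
    (fun x t => xor (x t) (decide (∃ i j, U i j = t ∧ a i j ≠ a' i j)))
    (fun x => by ext t; simp)

/-- The locations in `U` are distinct, so the flip at `U i j` is governed by the entry `(i,j)` alone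
and cancels the change from `a` to `a'`. -/
theorem flipAt_apply_of_mem {b : Fin k → Fin m} {y : Fin n → Option Bool}
    {U : Fin k → Fin m → Fin n} (hU : U ∈ indexMatrices b y) (a a' : Fin k → Fin m → Bool)
    (x : Fin n → Bool) (i : Fin k) (j : Fin m) :
    xor (a' i j) (flipAt U a a' x (U i j)) = xor (a i j) (x (U i j)) := by
  have hinj := (mem_indexMatrices.1 hU).1
  have h : (∃ i' j', U i' j' = U i j ∧ a i' j' ≠ a' i' j') ↔ a i j ≠ a' i j := by
    constructor
    · rintro ⟨i', j', h, h'⟩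
      obtain ⟨rfl, rfl⟩ := hinj _ _ _ _ h
      exact h'
    · exact fun h => ⟨i, j, rfl, h⟩
  change xor (a' i j) (xor (x (U i j)) (decide (∃ i' j', U i' j' = U i j ∧ a i' j' ≠ a' i' j'))) = _
  simp only [h]
  cases a i j <;> cases a' i j <;> cases x (U i j) <;> rfl

/-- `a` and `a'` agree on the selected bits, so flips occur only at erased locations, where both
values of `x` are equally likely. -/
theorem bes_flipAt {p : ℝ} (hp : p ∈ Set.Icc (0 : ℝ) 1) {b : Fin k → Fin m}
    {y : Fin n → Option Bool} {U : Fin k → Fin m → Fin n} (hU : U ∈ indexMatrices b y)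
    {a a' : Fin k → Fin m → Bool} (haa : samples otG a b = samples otG a' b) (x : Fin n → Bool)
    (t : Fin n) : bes p hp (flipAt U a a' x t, y t) = bes p hp (x t, y t) := by
  by_cases h : ∃ i j, U i j = t ∧ a i j ≠ a' i j
  · obtain ⟨i, j, rfl, hij⟩ := h
    have hj : j ≠ b i := by
      rintro rfl
      exact hij (congrFun haa i)
    rw [((mem_indexMatrices.1 hU).2 i j).2 hj]
    exact bes_none hp _ _
  · have : flipAt U a a' x t = x t := by
      change xor (x t) (decide (∃ i j, U i j = t ∧ a i j ≠ a' i j)) = x t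
      simp only [h, decide_false, Bool.xor_false]
    rw [this]

theorem indexTableLaw_support {z : IndexTable m n k} (hz : indexTableLaw m n k {z} ≠ 0)
    {b : Fin k → Fin m} {y : Fin n → Option Bool} {U : Fin k → Fin m → Fin n}
    (hU : z (b, y) = some U) : U ∈ indexMatrices b y := by
  classical
  rw [indexTableLaw_singleton, Finset.prod_ne_zero_iff] at hz
  have h := hz (b, y) (Finset.mem_univ _)
  rw [hU, indexLaw_some] at h
  by_contra h'
  exact h (if_neg fun h'' => h' h''.2)

/-- For fixed `y` and table `z`, the bijection `flipAt` of the source bits preserves their weight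
and turns the transcript for `a` into the same transcript for `a'`; Bob's view is unchanged. -/
theorem swot_alice_private (hm : 2 ≤ m) {p : ℝ} (hp : p ∈ Set.Icc (0 : ℝ) 1)
    {a a' : Fin k → Fin m → Bool} {b : Fin k → Fin m} (haa : samples otG a b = samples otG a' b)
    (S : Set (IndexTable m n k × (Fin n → Option Bool) × List (SwotMsg m n k))) :
    swotLaw m n k hp {ω | ω.1.1 = (a, b) ∧ (ω.2.2, (fun i => (ω.1.2 i).2),
      swotTranscript a (fun i => (ω.1.2 i).1) (ω.2.2 (b, fun i => (ω.1.2 i).2))) ∈ S} =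
    swotLaw m n k hp {ω | ω.1.1 = (a', b) ∧ (ω.2.2, (fun i => (ω.1.2 i).2),
      swotTranscript a' (fun i => (ω.1.2 i).1) (ω.2.2 (b, fun i => (ω.1.2 i).2))) ∈ S} := by
  classical
  rw [swotLaw_event hm hp a b fun x y z => (z, y, swotTranscript a x (z (b, y))) ∈ S,
    swotLaw_event hm hp a' b fun x y z => (z, y, swotTranscript a' x (z (b, y))) ∈ S]
  congr 1
  rw [Finset.sum_comm, Finset.sum_comm (γ := Fin n → Bool)]
  refine Finset.sum_congr rfl fun y _ => ?_
  have hsum : ∀ a : Fin k → Fin m → Bool, ∀ x : Fin n → Bool,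
      indexTableLaw m n k {z | (z, y, swotTranscript a x (z (b, y))) ∈ S} =
        ∑ z, if (z, y, swotTranscript a x (z (b, y))) ∈ S then indexTableLaw m n k {z} else 0 := by
    intro a x
    rw [← Measure.tsum_indicator_apply_singleton _ _ MeasurableSet.of_discrete, tsum_fintype]
    rfl
  simp only [hsum, Finset.mul_sum]
  rw [Finset.sum_comm, Finset.sum_comm (γ := Fin n → Bool)]
  refine Finset.sum_congr rfl fun z _ => ?_
  by_cases hz : indexTableLaw m n k {z} = 0
  · simp [hz]
  cases hU : z (b, y) with
  | none => rfl
  | some U =>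
    have hmem := indexTableLaw_support hz hU
    rw [← Equiv.sum_comp (flipAt U a a') fun x => (∏ i, bes p hp (x i, y i)) *
      if (z, y, swotTranscript a' x (some U)) ∈ S then indexTableLaw m n k {z} else 0]
    refine Finset.sum_congr rfl fun x _ => ?_
    simp only [bes_flipAt hp hmem haa]
    have : swotTranscript a' (flipAt U a a' x) (some U) = swotTranscript a x (some U) := by
      simp only [swotTranscript, Option.map_some, flipAt_apply_of_mem hmem]
    rw [this]

/-! #### Bob's privacy -/

/-- Move the erasures by the permutation `σ`. -/
def moveErasures (σ : Equiv.Perm (Fin n)) (x : Fin n → Bool) :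
    Equiv.Perm (Fin n → Option Bool) where
  toFun y t := (y (σ.symm t)).map fun v => xor v (xor (x (σ.symm t)) (x t))
  invFun y t := (y (σ t)).map fun v => xor v (xor (x t) (x (σ t)))
  left_inv y := by
    ext1 t
    simp only [Equiv.symm_apply_apply, Option.map_map]
    cases y t <;> simp
  right_inv y := by
    ext1 t
    simp only [Equiv.apply_symm_apply, Option.map_map]
    cases y t <;> simp

theorem moveErasures_eq_none (σ : Equiv.Perm (Fin n)) (x : Fin n → Bool) (y : Fin n → Option Bool)
    (t : Fin n) : moveErasures σ x y (σ t) = none ↔ y t = none := by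
  simp [moveErasures]

theorem card_erasures_moveErasures (σ : Equiv.Perm (Fin n)) (x : Fin n → Bool)
    (y : Fin n → Option Bool) : (erasures (moveErasures σ x y)).card = (erasures y).card := by
  symm
  refine Finset.card_equiv σ fun t => ?_
  simp [erasures, moveErasures_eq_none]

theorem card_nonErasures_moveErasures (σ : Equiv.Perm (Fin n)) (x : Fin n → Bool)
    (y : Fin n → Option Bool) : (nonErasures (moveErasures σ x y)).card = (nonErasures y).card := by
  symm
  refine Finset.card_equiv σ fun t => ?_
  simp [nonErasures, moveErasures_eq_none]

/-- A non-erased symbol is corrected by the difference of `x` at the old and new location, so it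
agrees with `x` after the move exactly when it did before. -/
theorem prod_bes_moveErasures {p : ℝ} (hp : p ∈ Set.Icc (0 : ℝ) 1) (σ : Equiv.Perm (Fin n))
    (x : Fin n → Bool) (y : Fin n → Option Bool) :
    ∏ t, bes p hp (x t, moveErasures σ x y t) = ∏ t, bes p hp (x t, y t) := by
  rw [← Equiv.prod_comp σ.symm fun t => bes p hp (x t, y t)]
  exact Finset.prod_congr rfl fun t _ => bes_map_xor hp _ _ _

/-- Permute the locations by `σ` and exchange the columns `b i` and `b' i` in row `i`. -/
def exchange (σ : Equiv.Perm (Fin n)) (b b' : Fin k → Fin m) :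
    Equiv.Perm (Fin k → Fin m → Fin n) where
  toFun U i j := σ (U i (Equiv.swap (b i) (b' i) j))
  invFun U i j := σ.symm (U i (Equiv.swap (b i) (b' i) j))
  left_inv U := by ext1 i; ext1 j; simp
  right_inv U := by ext1 i; ext1 j; simp

theorem exchange_mem_iff (σ : Equiv.Perm (Fin n)) (b b' : Fin k → Fin m) (x : Fin n → Bool)
    (y : Fin n → Option Bool) (U : Fin k → Fin m → Fin n) :
    U ∈ indexMatrices b y ↔ exchange σ b b' U ∈ indexMatrices b' (moveErasures σ x y) := by
  have hsw : ∀ i j, Equiv.swap (b i) (b' i) j = b i ↔ j = b' i := by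
    intro i j
    rw [Equiv.swap_apply_eq_iff, Equiv.swap_apply_left]
  have hex : ∀ i j, exchange σ b b' U i j = σ (U i (Equiv.swap (b i) (b' i) j)) := fun _ _ => rfl
  rw [mem_indexMatrices, mem_indexMatrices]
  simp only [hex, moveErasures_eq_none, ne_eq, σ.injective.eq_iff]
  constructor
  · rintro ⟨h1, h2⟩
    refine ⟨fun i j i' j' h => ?_, fun i j => ⟨fun hj => (h2 i _).1 ((hsw i j).2 hj),
      fun hj => (h2 i _).2 fun h => hj ((hsw i j).1 h)⟩⟩
    obtain ⟨rfl, h'⟩ := h1 _ _ _ _ h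
    exact ⟨rfl, (Equiv.swap _ _).injective h'⟩
  · rintro ⟨h1, h2⟩
    refine ⟨fun i j i' j' h => ?_, fun i j => ?_⟩
    · have := h1 i (Equiv.swap (b i) (b' i) j) i' (Equiv.swap (b i') (b' i') j') (by simpa using h)
      obtain ⟨rfl, h'⟩ := this
      exact ⟨rfl, (Equiv.swap _ _).injective h'⟩
    · have := h2 i (Equiv.swap (b i) (b' i) j)
      rw [← hsw] at this
      simpa using this

/-- For given `X`, Bob's message has the same distribution whatever his choice. The erasure patterns
for `b` and `b'` are matched by a permutation of locations that fixes the given matrix and maps the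
admissible matrices onto each other. -/
theorem sum_indexLaw_eq {p : ℝ} (hp : p ∈ Set.Icc (0 : ℝ) 1) (b b' : Fin k → Fin m)
    (x : Fin n → Bool) (o : Option (Fin k → Fin m → Fin n)) :
    ∑ y, (∏ i, bes p hp (x i, y i)) * indexLaw b y o =
      ∑ y, (∏ i, bes p hp (x i, y i)) * indexLaw b' y o := by
  classical
  cases o with
  | none => simp only [indexLaw_none]
  | some U =>
    by_cases hinj : ∀ i j i' j', U i j = U i' j' → i = i' ∧ j = j'
    -- `τ` swaps the entries `(i, b i)` and `(i, b' i)` in each row. Transported along the injective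
    -- matrix `U` to a permutation `σ` of the locations, it undoes the column exchange, so `exchange
    -- σ b b'` fixes `U`.
    · let τ : Equiv.Perm (Fin k × Fin m) :=
        { toFun := fun q => (q.1, Equiv.swap (b q.1) (b' q.1) q.2)
          invFun := fun q => (q.1, Equiv.swap (b q.1) (b' q.1) q.2)
          left_inv := fun q => by simp
          right_inv := fun q => by simp }
      let f : Fin k × Fin m ↪ Fin n := ⟨fun q => U q.1 q.2, fun q q' h => by
        obtain ⟨h1, h2⟩ := hinj _ _ _ _ h
        exact Prod.ext h1 h2⟩
      let σ : Equiv.Perm (Fin n) := τ.viaFintypeEmbedding f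
      have hσ : ∀ i j, σ (U i j) = U i (Equiv.swap (b i) (b' i) j) := fun i j =>
        Equiv.Perm.viaFintypeEmbedding_apply_image τ f (i, j)
      have hUU : exchange σ b b' U = U := by
        ext1 i; ext1 j
        change σ (U i (Equiv.swap (b i) (b' i) j)) = U i j
        rw [hσ, Equiv.swap_apply_self]
      rw [← Equiv.sum_comp (moveErasures σ x) fun y => (∏ i, bes p hp (x i, y i)) *
        indexLaw b' y (some U)]
      refine Finset.sum_congr rfl fun y _ => ?_
      rw [prod_bes_moveErasures, indexLaw_some, indexLaw_some]
      have h1 : Suffices m k (moveErasures σ x y) ↔ Suffices m k y := by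
        rw [Suffices, Suffices, card_erasures_moveErasures, card_nonErasures_moveErasures]
      have h2 : U ∈ indexMatrices b' (moveErasures σ x y) ↔ U ∈ indexMatrices b y := by
        rw [exchange_mem_iff σ b b' x y U, hUU]
      have h3 : (indexMatrices b' (moveErasures σ x y)).card = (indexMatrices b y).card :=
        (Finset.card_equiv (exchange σ b b') fun V => exchange_mem_iff σ b b' x y V).symm
      simp only [h1, h2, h3]
    -- A matrix with a repeated location is never sent.
    · have : ∀ b : Fin k → Fin m, ∀ y, indexLaw b y (some U) = 0 := by
        intro b y
        rw [indexLaw_some]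
        exact if_neg fun h => hinj (mem_indexMatrices.1 h.2).1
      simp only [this]

theorem swot_bob_private (hm : 2 ≤ m) {p : ℝ} (hp : p ∈ Set.Icc (0 : ℝ) 1)
    (a : Fin k → Fin m → Bool) (b b' : Fin k → Fin m)
    (S : Set (Unit × (Fin n → Bool) × List (SwotMsg m n k))) :
    swotLaw m n k hp {ω | ω.1.1 = (a, b) ∧ ((), (fun i => (ω.1.2 i).1),
      swotTranscript a (fun i => (ω.1.2 i).1) (ω.2.2 (b, fun i => (ω.1.2 i).2))) ∈ S} =
    swotLaw m n k hp {ω | ω.1.1 = (a, b') ∧ ((), (fun i => (ω.1.2 i).1),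
      swotTranscript a (fun i => (ω.1.2 i).1) (ω.2.2 (b', fun i => (ω.1.2 i).2))) ∈ S} := by
  classical
  rw [swotLaw_event hm hp a b fun x y z => ((), x, swotTranscript a x (z (b, y))) ∈ S,
    swotLaw_event hm hp a b' fun x y z => ((), x, swotTranscript a x (z (b', y))) ∈ S]
  congr 1
  refine Finset.sum_congr rfl fun x _ => ?_
  -- Alice's view involves Bob's data only through the entry of the table that he uses, whose law is
  -- `indexLaw b y`.
  have hsum : ∀ b : Fin k → Fin m, ∀ y : Fin n → Option Bool,
      indexTableLaw m n k {z | ((), x, swotTranscript a x (z (b, y))) ∈ S} =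
        ∑ o, if ((), x, swotTranscript a x o) ∈ S then indexLaw b y o else 0 := by
    intro b y
    have := indexTableLaw_eval b y {o | ((), x, swotTranscript a x o) ∈ S}
    rw [PMF.toMeasure_apply_fintype] at this
    exact this
  simp only [hsum, Finset.mul_sum]
  rw [Finset.sum_comm, Finset.sum_comm (γ := Fin n → Option Bool)]
  refine Finset.sum_congr rfl fun o _ => ?_
  by_cases ho : ((), x, swotTranscript a x o) ∈ S
  · simp only [ho, if_true]
    exact sum_indexLaw_eq hp b b' x o
  · simp [ho]

/-! #### Correctness -/

/-- Wherever a sample has positive probability, Bob does not abort if there are enough locations,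
and the outputs at the selected locations equal the inputs, so the two exclusive-ors cancel. -/
theorem swot_correct (hm : 2 ≤ m) {p : ℝ} (hp : p ∈ Set.Icc (0 : ℝ) 1) :
    swotLaw m n k hp {ω | swotEst ω.1.1.2 (fun i => (ω.1.2 i).2) (swotTranscript ω.1.1.1
      (fun i => (ω.1.2 i).1) (ω.2.2 (ω.1.1.2, fun i => (ω.1.2 i).2))) ≠
        samples otG ω.1.1.1 ω.1.1.2} ≤
      swotLaw m n k hp {ω | ¬ Suffices m k fun i => (ω.1.2 i).2} := by
  classical
  -- The sample space is countable and discrete, so almost every point is an atom; the statement can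
  -- then be checked on the supports of the factors.
  have hae : ∀ᵐ ω ∂(swotLaw m n k hp), swotLaw m n k hp {ω} ≠ 0 := by
    rw [ae_iff, ← Measure.tsum_indicator_apply_singleton _ _ MeasurableSet.of_discrete,
      ENNReal.tsum_eq_zero]
    intro ω
    rw [Set.indicator_apply]
    split_ifs with h
    · simpa using h
    · rfl
  refine measure_mono_ae ?_
  filter_upwards [hae] with ω hω hne
  rw [swotLaw_singleton hm] at hω
  by_contra hs
  have hs : Suffices m k fun i => (ω.1.2 i).2 := not_not.1 hs
  apply hne
  have hz : indexTableLaw m n k {ω.2.2} ≠ 0 := right_ne_zero_of_mul hω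
  have hxy : ∀ i, bes p hp (ω.1.2 i) ≠ 0 := fun i =>
    (Finset.prod_ne_zero_iff.1 (right_ne_zero_of_mul (left_ne_zero_of_mul hω))) i (Finset.mem_univ i)
  obtain ⟨⟨⟨a, b⟩, xy⟩, u, z⟩ := ω
  cases hU : z (b, fun i => (xy i).2) with
  | none =>
    exfalso
    rw [indexTableLaw_singleton, Finset.prod_ne_zero_iff] at hz
    have h := hz (b, fun i => (xy i).2) (Finset.mem_univ _)
    simp only [hU, indexLaw_none] at h
    exact h (if_pos hs)
  | some U =>
    have hmem := mem_indexMatrices.1 (indexTableLaw_support hz hU)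
    simp only [hU]
    ext i
    have hy : (xy (U i (b i))).2 = some (xy (U i (b i))).1 := by
      by_contra h
      have h1 := bec_eq_zero hp ((hmem.2 i (b i)).1 rfl) h
      apply hxy (U i (b i))
      change bes p hp (xy (U i (b i))) = 0
      rw [show xy (U i (b i)) = ((xy (U i (b i))).1, (xy (U i (b i))).2) from rfl, bes_apply, h1,
        mul_zero]
    simp [swotTranscript, swotEst, samples, otG, hy]

theorem swot_abort_le (hm : 2 ≤ m) {p : ℝ} (hp : p ∈ Set.Icc (0 : ℝ) 1) (hn : 0 < n) {δ : ℝ}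
    (hδ : 0 < δ)
    (hs : ∀ y : Fin n → Option Bool, |((erasures y).card : ℝ) - n * p| < δ * n → Suffices m k y) :
    swotLaw m n k hp {ω | ¬ Suffices m k fun i => (ω.1.2 i).2} ≤
      ENNReal.ofReal (1 / (δ ^ 2 * n)) := by
  classical
  have := isProbabilityMeasure_uniformSource hm k
  have h := pi_count_concentration (bes p hp).toMeasure
    (D := {z : Bool × Option Bool | z.2 = none}) MeasurableSet.of_discrete
    (bes_real_erased hp) hn hδ
  refine le_trans ?_ h
  set S : Set (Fin n → Bool × Option Bool) := {w | δ * n ≤ |((Finset.univ.filter fun i =>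
    w i ∈ {z : Bool × Option Bool | z.2 = none}).card : ℝ) - n * p|}
  have hS : swotLaw m n k hp ((Set.univ ×ˢ S) ×ˢ Set.univ) =
      (Measure.pi fun _ : Fin n => (bes p hp).toMeasure) S := by
    rw [swotLaw, Measure.prod_prod, Measure.prod_prod]
    simp
  rw [← hS]
  refine measure_mono fun ω hω => ⟨⟨trivial, ?_⟩, trivial⟩
  by_contra hc
  exact hω (hs _ (not_le.1 hc))

/-! #### Security -/

/-- Security of the SWOT protocol over any probability space that maps to that of the source
model. -/
theorem swot_isSecureExecution (hm : 2 ≤ m) {p : ℝ} (hp : p ∈ Set.Icc (0 : ℝ) 1) {Ω VA VB : Type*}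
    [MeasurableSpace Ω] [MeasurableSpace VA] [MeasurableSpace VB] {P : Measure Ω}
    {Φ : Ω → SwotSpace m n k} (hΦ : MeasurePreserving Φ P (swotLaw m n k hp))
    {φA : Unit × (Fin n → Bool) × List (SwotMsg m n k) → VA} (hφA : Measurable φA)
    {φB : IndexTable m n k × (Fin n → Option Bool) × List (SwotMsg m n k) → VB} (hφB : Measurable φB)
    {ε : ℝ} (hε : 0 < ε)
    (habort : swotLaw m n k hp {ω | ¬ Suffices m k fun i => (ω.1.2 i).2} < ENNReal.ofReal ε) :
    IsSecureExecution otF otG ε P (fun ω => (Φ ω).1.1.1) (fun ω => (Φ ω).1.1.2)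
      (fun ω => φA ((), (fun i => ((Φ ω).1.2 i).1), swotTranscript (Φ ω).1.1.1
        (fun i => ((Φ ω).1.2 i).1) ((Φ ω).2.2 ((Φ ω).1.1.2, fun i => ((Φ ω).1.2 i).2))))
      (fun ω => φB ((Φ ω).2.2, (fun i => ((Φ ω).1.2 i).2), swotTranscript (Φ ω).1.1.1
        (fun i => ((Φ ω).1.2 i).1) ((Φ ω).2.2 ((Φ ω).1.1.2, fun i => ((Φ ω).1.2 i).2))))
      (fun _ _ => 0)
      (fun ω => swotEst (Φ ω).1.1.2 (fun i => ((Φ ω).1.2 i).2) (swotTranscript (Φ ω).1.1.1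
        (fun i => ((Φ ω).1.2 i).1) ((Φ ω).2.2 ((Φ ω).1.1.2, fun i => ((Φ ω).1.2 i).2)))) := by
  have := isProbabilityMeasure_swotLaw (n := n) (k := k) hm hp
  have hP : IsProbabilityMeasure P := ⟨by
    rw [← Set.preimage_univ (f := Φ), hΦ.measure_preimage nullMeasurableSet_univ, measure_univ]⟩
  have hpre : ∀ S : Set (SwotSpace m n k), P (Φ ⁻¹' S) = swotLaw m n k hp S := fun S =>
    hΦ.measure_preimage (MeasurableSet.of_discrete).nullMeasurableSet
  have hmeas : ∀ {γ : Type _} [MeasurableSpace γ] (f : SwotSpace m n k → γ),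
      Measurable fun ω => f (Φ ω) := fun f => (Measurable.of_discrete (f := f)).comp hΦ.measurable
  refine ⟨?_, ?_, ?_, ?_⟩
  · have : {ω | (fun _ => 0 : Fin k → Fin 1) ≠ samples otF (Φ ω).1.1.1 (Φ ω).1.1.2} = ∅ := by
      ext ω
      simp only [ne_eq, Set.mem_ofPred_eq, Set.mem_empty_iff_false, iff_false, not_not]
      exact Subsingleton.elim _ _
    rw [this, measure_empty]
    exact ENNReal.ofReal_pos.2 hε
  · refine lt_of_le_of_lt ?_ habort
    refine le_trans (le_of_eq (hpre {ω | swotEst ω.1.1.2 (fun i => (ω.1.2 i).2)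
      (swotTranscript ω.1.1.1 (fun i => (ω.1.2 i).1) (ω.2.2 (ω.1.1.2, fun i => (ω.1.2 i).2))) ≠
        samples otG ω.1.1.1 ω.1.1.2})) (swot_correct hm hp)
  -- Given `(b,g)`, the possible values of `A` are those that select `g` at `b`.
  · rw [condMutualInfo_eq_zero P (T := fun w => {a | samples otG a w.1 = w.2})]
    · exact ENNReal.ofReal_pos.2 hε
    · exact hmeas fun ω => ω.1.1.1
    · exact hφB.comp (hmeas fun ω => (ω.2.2, (fun i => (ω.1.2 i).2), swotTranscript ω.1.1.1
        (fun i => (ω.1.2 i).1) (ω.2.2 (ω.1.1.2, fun i => (ω.1.2 i).2))))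
    · intro w
      exact hΦ.measurable (MeasurableSet.of_discrete
        (s := (fun ω : SwotSpace m n k => (ω.1.1.2, samples otG ω.1.1.1 ω.1.1.2)) ⁻¹' {w}))
    · rintro ⟨b, g⟩ a ha a' ha' S -
      have ha : samples otG a b = g := ha
      have ha' : samples otG a' b = g := ha'
      have key : ∀ a, samples otG a b = g → P ((fun ω => ((Φ ω).1.1.2,
          samples otG (Φ ω).1.1.1 (Φ ω).1.1.2)) ⁻¹' {(b, g)} ∩
          ((fun ω => (Φ ω).1.1.1) ⁻¹' {a} ∩ (fun ω => φB ((Φ ω).2.2, (fun i => ((Φ ω).1.2 i).2),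
            swotTranscript (Φ ω).1.1.1 (fun i => ((Φ ω).1.2 i).1)
              ((Φ ω).2.2 ((Φ ω).1.1.2, fun i => ((Φ ω).1.2 i).2)))) ⁻¹' S)) =
          swotLaw m n k hp {ω | ω.1.1 = (a, b) ∧ (ω.2.2, (fun i => (ω.1.2 i).2),
            swotTranscript a (fun i => (ω.1.2 i).1) (ω.2.2 (b, fun i => (ω.1.2 i).2))) ∈
              φB ⁻¹' S} := by
        intro a ha
        rw [← hpre]
        congr 1
        ext ω
        simp only [Set.mem_inter_iff, Set.mem_preimage, Set.mem_singleton_iff,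
          Set.mem_ofPred_eq, Prod.ext_iff]
        constructor
        · rintro ⟨⟨rfl, rfl⟩, rfl, h⟩; exact ⟨⟨rfl, rfl⟩, h⟩
        · rintro ⟨⟨rfl, rfl⟩, h⟩; exact ⟨⟨rfl, ha⟩, rfl, h⟩
      rw [key a ha, key a' ha']
      exact swot_alice_private hm hp (ha.trans ha'.symm) _
    · rintro ⟨b, g⟩ a ha
      convert measure_empty (μ := P)
      ext ω
      simp only [Set.mem_inter_iff, Set.mem_preimage, Set.mem_singleton_iff, Prod.mk.injEq,
        Set.mem_empty_iff_false, iff_false]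
      rintro ⟨⟨rfl, h⟩, rfl⟩
      exact ha h
  -- Alice's function carries no information, so every value of `B` remains possible.
  · rw [condMutualInfo_eq_zero P (T := fun _ => Set.univ)]
    · exact ENNReal.ofReal_pos.2 hε
    · exact hmeas fun ω => ω.1.1.2
    · exact hφA.comp (hmeas fun ω => ((), (fun i => (ω.1.2 i).1), swotTranscript ω.1.1.1
        (fun i => (ω.1.2 i).1) (ω.2.2 (ω.1.1.2, fun i => (ω.1.2 i).2))))
    · intro w
      exact hΦ.measurable (MeasurableSet.of_discrete
        (s := (fun ω : SwotSpace m n k => (ω.1.1.1, samples otF ω.1.1.1 ω.1.1.2)) ⁻¹' {w}))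
    · rintro ⟨a, f⟩ b - b' - S -
      have key : ∀ b, P ((fun ω => ((Φ ω).1.1.1,
          samples otF (Φ ω).1.1.1 (Φ ω).1.1.2)) ⁻¹' {(a, f)} ∩
          ((fun ω => (Φ ω).1.1.2) ⁻¹' {b} ∩ (fun ω => φA ((), (fun i => ((Φ ω).1.2 i).1),
            swotTranscript (Φ ω).1.1.1 (fun i => ((Φ ω).1.2 i).1)
              ((Φ ω).2.2 ((Φ ω).1.1.2, fun i => ((Φ ω).1.2 i).2)))) ⁻¹' S)) =
          swotLaw m n k hp {ω | ω.1.1 = (a, b) ∧ ((), (fun i => (ω.1.2 i).1),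
            swotTranscript a (fun i => (ω.1.2 i).1) (ω.2.2 (b, fun i => (ω.1.2 i).2))) ∈
              φA ⁻¹' S} := by
        intro b
        rw [← hpre]
        congr 1
        ext ω
        simp only [Set.mem_inter_iff, Set.mem_preimage, Set.mem_singleton_iff,
          Set.mem_ofPred_eq, Prod.ext_iff]
        constructor
        · rintro ⟨⟨rfl, -⟩, rfl, h⟩; exact ⟨⟨rfl, rfl⟩, h⟩
        · rintro ⟨⟨rfl, rfl⟩, h⟩; exact ⟨⟨rfl, Subsingleton.elim _ _⟩, rfl, h⟩
      rw [key b, key b']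
      exact swot_bob_private hm hp a b b' _
    · intro w u hu
      exact absurd trivial hu

end Swot

/-! ### The rate of the SWOT protocol -/

section SwotRate

variable {m n k : ℕ}

theorem swotSource_messages (ω : (swotSource m n k).Space) :
    (swotSource m n k).messages ω = swotTranscript ω.1.1.1 (fun i => (ω.1.2 i).1)
      (ω.2.2 (ω.1.1.2, fun i => (ω.1.2 i).2)) := by
  have h0 : Even 0 := by decide
  have h1 : ¬ Even 1 := by decide
  have h2 : Even 2 := by decide
  change (swotSource m n k).transcript _ _ _ _ _ _ 3 = _
  simp only [SourceProtocol.transcript, h0, h1, h2, if_true, if_false, List.nil_append,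
    List.cons_append]
  obtain ⟨⟨⟨a, b⟩, xy⟩, u, z⟩ := ω
  change [none, (z (b, fun i => (xy i).2)).map Sum.inl, swotAlice a (fun i => (xy i).1)
    [none, (z (b, fun i => (xy i).2)).map Sum.inl]] = swotTranscript a (fun i => (xy i).1)
      (z (b, fun i => (xy i).2))
  cases z (b, fun i => (xy i).2) <;> rfl

theorem swotSource_isSecure (hm : 2 ≤ m) {p : ℝ} (hp : p ∈ Set.Icc (0 : ℝ) 1) {ε : ℝ} (hε : 0 < ε)
    (habort : swotLaw m n k hp {ω | ¬ Suffices m k fun i => (ω.1.2 i).2} < ENNReal.ofReal ε) :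
    (swotSource m n k).IsSecure (uniformSource m k) (bes p hp) otF otG ε := by
  have h := swot_isSecureExecution hm hp (MeasurePreserving.id (swotLaw m n k hp)) measurable_id
    measurable_id hε habort
  unfold SourceProtocol.IsSecure
  simp only [swotSource_messages]
  exact h

theorem run_send {𝓐 𝓑 𝓧 𝓨 𝓕 𝓖 : Type} (π : ChannelProtocol 𝓐 𝓑 𝓧 𝓨 𝓕 𝓖 n k) (a : Fin k → 𝓐)
    (b : Fin k → 𝓑) (zA : π.ZA) (zB : π.ZB) (s : List Step) (w : 𝓧 → 𝓨) (ws : List (𝓧 → 𝓨))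
    (xs : List 𝓧) (ys : List 𝓨) (ms : List π.Msg) :
    π.run a b zA zB (Step.send :: s) (w :: ws) xs ys ms =
      π.run a b zA zB s ws (xs ++ [π.input a zA xs ms]) (ys ++ [w (π.input a zA xs ms)]) ms := by
  rw [ChannelProtocol.run]

/-- Running the channel uses of the SWOT protocol. -/
theorem swotChannel_run_send (a : Fin k → Fin m → Bool) (b : Fin k → Fin m) (x : Fin n → Bool)
    (z : IndexTable m n k) (s : List Step) (ws : List (Bool → Option Bool)) (xs xf : List Bool)
    (ys : List (Option Bool)) (hx : List.ofFn x = xs ++ xf) (hlen : ws.length = xf.length) :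
    (swotChannel m n k).run a b x z (List.replicate xf.length Step.send ++ s) ws xs ys [] =
      (swotChannel m n k).run a b x z s [] (xs ++ xf) (ys ++ List.zipWith (fun w x => w x) ws xf)
        [] := by
  induction xf generalizing ws xs ys with
  | nil =>
    have : ws = [] := by simpa using hlen
    simp [this]
  | cons c xf ih =>
    cases ws with
    | nil => simp at hlen
    | cons w ws =>
      have hin : (swotChannel m n k).input a x xs [] = c := by
        change (List.ofFn x).getD xs.length false = c
        rw [hx]
        simp
      rw [List.length_cons, List.replicate_succ, List.cons_append]
      refine (run_send (swotChannel m n k) a b x z _ w ws xs ys []).trans ?_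
      rw [hin, ih ws (xs ++ [c]) (ys ++ [w c]) (by simpa using hx) (by simpa using hlen)]
      simp

theorem zipWith_ofFn {α β : Type*} (w : Fin n → α → β) (x : Fin n → α) :
    List.zipWith (fun w x => w x) (List.ofFn w) (List.ofFn x) = List.ofFn fun i => w i (x i) := by
  refine List.ext_getElem (by simp) fun i h1 h2 => ?_
  simp

/-- The sample of the source model that belongs to a sample of the channel model. -/
def swotMap (ω : (((Fin k → Fin m → Bool) × (Fin k → Fin m)) × (Fin n → Bool → Option Bool)) ×
    ((Fin n → Bool) × IndexTable m n k)) : SwotSpace m n k :=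
  ((ω.1.1, fun i => (ω.2.1 i, ω.1.2 i (ω.2.1 i))), ((), ω.2.2))

theorem swotChannel_execution_mk (a : Fin k → Fin m → Bool) (b : Fin k → Fin m)
    (w : Fin n → Bool → Option Bool) (x : Fin n → Bool) (z : IndexTable m n k) :
    (swotChannel m n k).execution (((a, b), w), (x, z)) =
      (List.ofFn x, List.ofFn fun i => w i (x i),
        swotTranscript a x (z (b, fun i => w i (x i)))) := by
  have h0 : Even 0 := by decide
  have h1 : ¬ Even 1 := by decide
  have h2 : Even 2 := by decide
  have h := swotChannel_run_send a b x z (List.replicate 3 Step.talk) (List.ofFn w) []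
    (List.ofFn x) [] (by simp) (by simp)
  rw [List.length_ofFn, zipWith_ofFn, List.nil_append, List.nil_append] at h
  change (swotChannel m n k).run a b x z (List.replicate n Step.send ++ List.replicate 3 Step.talk)
    (List.ofFn w) [] [] [] = _
  rw [h]
  simp only [List.replicate, ChannelProtocol.run, List.length_nil, h0, if_true, List.nil_append,
    h1, if_false, List.cons_append, List.length_cons, Nat.reduceAdd, h2]
  have hy : (fun i : Fin n => (List.ofFn fun i => w i (x i)).getD i none) = fun i => w i (x i) :=
    getD_ofFn _ _
  have hx : (fun i : Fin n => (List.ofFn x).getD i false) = x := getD_ofFn _ _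
  have hb : ∀ l, (swotChannel m n k).bobMsg b z (List.ofFn fun i => w i (x i)) l =
      (z (b, fun i => w i (x i))).map Sum.inl := by
    intro l
    change swotBob b (fun i : Fin n => (List.ofFn fun i => w i (x i)).getD i none) z = _
    rw [hy]
    rfl
  have ha : ∀ l, (swotChannel m n k).aliceMsg a x (List.ofFn x) l = swotAlice a x l := by
    intro l
    change swotAlice a (fun i : Fin n => (List.ofFn x).getD i false) l = _
    rw [hx]
  rw [hb, ha, ha]
  refine Prod.ext rfl (Prod.ext rfl ?_)
  change [none, (z (b, fun i => w i (x i))).map Sum.inl, swotAlice a x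
    [none, (z (b, fun i => w i (x i))).map Sum.inl]] = swotTranscript a x (z (b, fun i => w i (x i)))
  cases z (b, fun i => w i (x i)) <;> rfl

theorem swotChannel_execution (ω : (swotChannel m n k).Space) :
    (swotChannel m n k).execution ω =
      (List.ofFn fun i => ((swotMap ω).1.2 i).1, List.ofFn fun i => ((swotMap ω).1.2 i).2,
        swotTranscript (swotMap ω).1.1.1 (fun i => ((swotMap ω).1.2 i).1)
          ((swotMap ω).2.2 ((swotMap ω).1.1.2, fun i => ((swotMap ω).1.2 i).2))) :=
  swotChannel_execution_mk ω.1.1.1 ω.1.1.2 ω.1.2 ω.2.1 ω.2.2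

/-- Uniform inputs and the noise evaluated at them form iid pairs with the law of the erasure
source; the noise at the unused inputs is integrated out. -/
theorem measurePreserving_swotMap (hm : 2 ≤ m) {p : ℝ} (hp : p ∈ Set.Icc (0 : ℝ) 1) :
    MeasurePreserving (swotMap (m := m) (n := n) (k := k))
      (((uniformSource m k).prod (Measure.pi fun _ : Fin n =>
        Measure.pi fun x : Bool => (bec p hp x).toMeasure)).prod
        ((Measure.pi fun _ : Fin n => (PMF.uniformOfFintype Bool).toMeasure).prod
          (indexTableLaw m n k))) (swotLaw m n k hp) := by
  have := isProbabilityMeasure_uniformSource hm k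
  have hmeas : Measurable (swotMap (m := m) (n := n) (k := k)) := fun s _ =>
    (Set.to_countable _).measurableSet
  refine ⟨hmeas, Measure.ext_of_singleton fun ω => ?_⟩
  rw [Measure.map_apply hmeas (measurableSet_singleton _), swotLaw_singleton hm]
  obtain ⟨⟨ab, xy⟩, u, z⟩ := ω
  have : swotMap ⁻¹' {((ab, xy), u, z)} =
      ({ab} ×ˢ Set.univ.pi fun i => {w | w (xy i).1 = (xy i).2}) ×ˢ
        (({fun i => (xy i).1} : Set (Fin n → Bool)) ×ˢ ({z} : Set (IndexTable m n k))) := by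
    ext ⟨⟨ab', w⟩, x, z'⟩
    simp only [swotMap, Set.mem_preimage, Set.mem_singleton_iff, Set.mem_prod,
      Set.mem_pi, Set.mem_univ, true_implies, Set.mem_ofPred_eq, funext_iff, Prod.ext_iff, true_and]
    constructor
    · rintro ⟨⟨h1, h2⟩, h3⟩
      refine ⟨⟨h1, fun i => ?_⟩, fun i => (h2 i).1, h3⟩
      rw [← (h2 i).1]
      exact (h2 i).2
    · rintro ⟨⟨h1, h2⟩, h3, h4⟩
      refine ⟨⟨h1, fun i => ⟨h3 i, ?_⟩⟩, h4⟩
      rw [h3 i]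
      exact h2 i
  rw [this, Measure.prod_prod, Measure.prod_prod, Measure.prod_prod, uniformSource_singleton,
    Measure.pi_pi, Measure.pi_singleton]
  simp only [pi_bec_apply, PMF.toMeasure_apply_singleton _ _ (measurableSet_singleton _),
    PMF.uniformOfFintype_apply]
  have hb : ∀ i, bes p hp (xy i) = 2⁻¹ * bec p hp (xy i).1 (xy i).2 := fun i => bes_apply hp _ _
  simp only [hb, Finset.prod_mul_distrib, Fintype.card_bool, Nat.cast_ofNat]
  ring

theorem swotChannel_isSecure (hm : 2 ≤ m) {p : ℝ} (hp : p ∈ Set.Icc (0 : ℝ) 1) {ε : ℝ} (hε : 0 < ε)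
    (habort : swotLaw m n k hp {ω | ¬ Suffices m k fun i => (ω.1.2 i).2} < ENNReal.ofReal ε) :
    (swotChannel m n k).IsSecure (uniformSource m k) (bec p hp) otF otG ε := by
  have h := swot_isSecureExecution hm hp (measurePreserving_swotMap hm hp)
    (φA := fun v : Unit × (Fin n → Bool) × List (SwotMsg m n k) => (v.2.1, List.ofFn v.2.1, v.2.2))
    Measurable.of_discrete
    (φB := fun v : IndexTable m n k × (Fin n → Option Bool) × List (SwotMsg m n k) =>
      (v.1, List.ofFn v.2.1, v.2.2)) (fun s _ => (Set.to_countable _).measurableSet) hε habort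
  unfold ChannelProtocol.IsSecure
  simp only [swotChannel_execution]
  have hest : (fun ω : (swotChannel m n k).Space => (swotChannel m n k).bobEst ω.1.1.2 ω.2.2
      (List.ofFn fun i => ((swotMap ω).1.2 i).2) (swotTranscript (swotMap ω).1.1.1
        (fun i => ((swotMap ω).1.2 i).1)
        ((swotMap ω).2.2 ((swotMap ω).1.1.2, fun i => ((swotMap ω).1.2 i).2)))) =
      fun ω => swotEst (swotMap ω).1.1.2 (fun i => ((swotMap ω).1.2 i).2)
        (swotTranscript (swotMap ω).1.1.1 (fun i => ((swotMap ω).1.2 i).1)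
        ((swotMap ω).2.2 ((swotMap ω).1.1.2, fun i => ((swotMap ω).1.2 i).2))) := by
    funext ω
    change swotEst ω.1.1.2 (fun i : Fin n =>
      (List.ofFn fun i => ((swotMap ω).1.2 i).2).getD i none) _ = _
    rw [getD_ofFn]
    rfl
  rw [hest]
  exact h

theorem attainsRate_swot (hm : 2 ≤ m) {p : ℝ} (hp : p ∈ Set.Icc (0 : ℝ) 1)
    {good : ℕ → ℕ → ℝ → Prop} (hgood : ∀ n k ε, 0 < ε →
      swotLaw m n k hp {ω | ¬ Suffices m k fun i => (ω.1.2 i).2} < ENNReal.ofReal ε → good n k ε) :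
    AttainsRate good (min (1 - p) (p / ((m : ℝ) - 1))) := by
  intro ε hε
  have hm' : (2 : ℝ) ≤ m := by exact_mod_cast hm
  set R := min (1 - p) (p / ((m : ℝ) - 1)) with hR
  filter_upwards [(tendsto_natCast_atTop_atTop (R := ℝ)).eventually_gt_atTop (2 / ε),
    (tendsto_natCast_atTop_atTop (R := ℝ)).eventually_gt_atTop (1 / ((ε / 2) ^ 2 * ε)),
    eventually_gt_atTop 0] with n hn1 hn2 hn
  have hn0 : (0 : ℝ) < n := by exact_mod_cast hn
  rw [div_lt_iff₀ hε] at hn1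
  rw [div_lt_iff₀ (by positivity)] at hn2
  -- Backing off by `ε/2` leaves room for a deviation of `nε/2` in the number of erasures, and `nε/2
  -- > 1` covers the loss from rounding down.
  refine ⟨⌊n * (R - ε / 2)⌋₊, ?_, ?_⟩
  · rw [lt_div_iff₀ hn0]
    have := Nat.lt_floor_add_one (n * (R - ε / 2))
    nlinarith
  · refine hgood _ _ _ hε (lt_of_le_of_lt (swot_abort_le hm hp hn (half_pos hε) fun y hy => ?_)
      ((ENNReal.ofReal_lt_ofReal_iff hε).2 ?_))
    -- If the target is not positive then `k = 0`, for which every output suffices.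
    · rcases le_or_gt (n * (R - ε / 2)) 0 with h | h
      · rw [Nat.floor_of_nonpos h]
        exact ⟨Nat.zero_le _, by simp⟩
      · have hk := Nat.floor_le h.le
        set K := ⌊n * (R - ε / 2)⌋₊
        have hsplit : ((nonErasures y).card : ℝ) + (erasures y).card = n := by
          exact_mod_cast card_nonErasures_add_card_erasures y
        rw [abs_lt] at hy
        have h1 : R ≤ 1 - p := min_le_left _ _
        have h2 : R * (m - 1) ≤ p := (le_div_iff₀ (by linarith)).1 (min_le_right _ _)
        constructor
        · have : (K : ℝ) ≤ (nonErasures y).card := by nlinarith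
          exact_mod_cast this
        · have h3 : (K : ℝ) * (m - 1) ≤ (erasures y).card := by
            have h4 : (K : ℝ) * (m - 1) ≤ n * (R - ε / 2) * (m - 1) :=
              mul_le_mul_of_nonneg_right hk (by linarith)
            have h5 : n * (R * (m - 1)) ≤ n * p := mul_le_mul_of_nonneg_left h2 hn0.le
            have h6 : n * ε / 2 * 1 ≤ n * ε / 2 * (m - 1) :=
              mul_le_mul_of_nonneg_left (by linarith) (by positivity)
            nlinarith
          have h7 : ((m - 1 : ℕ) : ℝ) = m - 1 := by rw [Nat.cast_sub (by omega), Nat.cast_one]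
          rw [← h7] at h3
          exact_mod_cast h3
    · rw [div_lt_iff₀ (by positivity)]
      linarith

end SwotRate

/-! ### The single-letter bound -/

theorem absolutelyContinuous_of_singleton {α : Type*} [Countable α] [MeasurableSpace α]
    [MeasurableSingletonClass α] {μ ν : Measure α} (h : ∀ x, ν {x} = 0 → μ {x} = 0) : μ ≪ ν := by
  intro s hs
  rw [← Set.biUnion_of_singleton s, measure_biUnion_null_iff s.to_countable]
  exact fun x hx => h x (measure_mono_null (by simpa using hx) hs)

/-- The total masses agree, so the divergence is the integral of the log-likelihood ratio with no
correction term; points of `μ`-mass zero contribute nothing. -/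
theorem toReal_klDiv_fintype {α : Type*} [Fintype α] [MeasurableSpace α]
    [MeasurableSingletonClass α] (μ ν : Measure α) [IsProbabilityMeasure μ] [IsProbabilityMeasure ν]
    (h : μ ≪ ν) : (InformationTheory.klDiv μ ν).toReal =
      ∑ x, μ.real {x} * Real.log (μ.real {x} / ν.real {x}) := by
  rw [InformationTheory.toReal_klDiv_of_measure_eq h (by simp),
    integral_fintype (Integrable.of_finite)]
  refine Finset.sum_congr rfl fun x _ => ?_
  rw [smul_eq_mul]
  by_cases hx : μ {x} = 0
  · simp [Measure.real, hx]
  have hν : ν {x} ≠ 0 := fun h0 => hx (h h0)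
  have h1 : μ {x} = μ.rnDeriv ν x * ν {x} := by
    rw [← Measure.setLIntegral_rnDeriv h, lintegral_singleton]
  have h2 : (μ.rnDeriv ν x).toReal = μ.real {x} / ν.real {x} := by
    rw [Measure.real, Measure.real, h1, ENNReal.toReal_mul, mul_div_cancel_right₀]
    exact ENNReal.toReal_ne_zero.2 ⟨hν, measure_ne_top _ _⟩
  rw [llr, h2]

section OTBound

variable {p : ℝ} (hp : p ∈ Set.Icc (0 : ℝ) 1) (PX : PMF Bool)

theorem toMeasure_real_eq_sum {α : Type*} [Fintype α] [MeasurableSpace α]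
    [DiscreteMeasurableSpace α] (Q : PMF α) (S : Set α) [DecidablePred (· ∈ S)] :
    Q.toMeasure.real S = ∑ x, if x ∈ S then (Q x).toReal else 0 := by
  rw [Measure.real, PMF.toMeasure_apply_fintype, ENNReal.toReal_sum]
  · refine Finset.sum_congr rfl fun x _ => ?_
    rw [Set.indicator_apply]
    split_ifs <;> simp
  · intro x _
    rw [Set.indicator_apply]
    split_ifs
    · exact Q.apply_ne_top x
    · simp

theorem toReal_false_eq : (PX false).toReal = 1 - (PX true).toReal := by
  have h : PX true + PX false = 1 := by
    rw [← PX.tsum_coe, tsum_fintype, Fintype.sum_bool]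
  have h2 : (PX true).toReal + (PX false).toReal = 1 := by
    rw [← ENNReal.toReal_add (PX.apply_ne_top _) (PX.apply_ne_top _), h, ENNReal.toReal_one]
  linarith

theorem toReal_bec (x : Bool) (y : Option Bool) : (bec p hp x y).toReal =
    p * (if y = none then 1 else 0) + (1 - p) * (if y = some x then 1 else 0) := by
  have h1 : 0 ≤ 1 - p := sub_nonneg.2 hp.2
  rw [bec, PMF.ofFintype_apply, ENNReal.toReal_ofReal]
  exact add_nonneg (mul_nonneg hp.1 (by split_ifs <;> norm_num))
    (mul_nonneg h1 (by split_ifs <;> norm_num))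

theorem toReal_jointLaw_bec (x : Bool) (y : Option Bool) :
    (jointLaw PX (bec p hp) (x, y)).toReal = (PX x).toReal *
      (p * (if y = none then 1 else 0) + (1 - p) * (if y = some x then 1 else 0)) := by
  rw [jointLaw_apply, ENNReal.toReal_mul, toReal_bec]

/-- The contribution of a non-erased output, with likelihood ratio `1/q`; the conventions at zero
also cover `q = 0` and `c = 0`. -/
theorem mul_log_inv_eq (c q : ℝ) : q * c * Real.log (q * c / (q * (q * c))) =
    c * Real.negMulLog q := by
  by_cases hq : q = 0
  · simp [hq]
  by_cases hc : c = 0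
  · simp [hc]
  have : q * c / (q * (q * c)) = q⁻¹ := by field_simp
  rw [this, Real.log_inv, Real.negMulLog]
  ring

/-- The erasure is independent of the input and contributes nothing, while a non-erased output
reveals the input completely. -/
theorem mutualInfo_jointLaw_bec :
    (mutualInfo (jointLaw PX (bec p hp)).toMeasure Prod.fst Prod.snd).toReal =
      (1 - p) * (Real.binEntropy (PX true).toReal / Real.log 2) := by
  classical
  set μ := (jointLaw PX (bec p hp)).toMeasure with hμ
  have hid : (μ.map fun ω => (ω.1, ω.2)) = μ := Measure.map_id
  have := Measure.isProbabilityMeasure_map (μ := μ) (measurable_fst (α := Bool)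
    (β := Option Bool)).aemeasurable
  have := Measure.isProbabilityMeasure_map (μ := μ) (measurable_snd (α := Bool)
    (β := Option Bool)).aemeasurable
  have hf : ∀ x y, ((μ.map Prod.fst).prod (μ.map Prod.snd)) {(x, y)} =
      μ (Prod.fst ⁻¹' {x}) * μ (Prod.snd ⁻¹' {y}) := by
    intro x y
    rw [← Set.singleton_prod_singleton, Measure.prod_prod,
      Measure.map_apply measurable_fst (measurableSet_singleton _),
      Measure.map_apply measurable_snd (measurableSet_singleton _)]
  have hac : μ ≪ (μ.map Prod.fst).prod (μ.map Prod.snd) := by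
    refine absolutelyContinuous_of_singleton ?_
    rintro ⟨x, y⟩ h
    rw [hf, mul_eq_zero] at h
    rcases h with h | h
    · exact measure_mono_null (by simp) h
    · exact measure_mono_null (by simp) h
  rw [mutualInfo, hid, ENNReal.toReal_div, toReal_klDiv_fintype _ _ hac,
    ENNReal.toReal_ofReal (Real.log_nonneg (by norm_num)), ← mul_div_assoc]
  congr 1
  have hν : ∀ x y, ((μ.map Prod.fst).prod (μ.map Prod.snd)).real {(x, y)} =
      μ.real (Prod.fst ⁻¹' {x}) * μ.real (Prod.snd ⁻¹' {y}) := by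
    intro x y
    rw [Measure.real, hf, ENNReal.toReal_mul]
    rfl
  rw [Fintype.sum_prod_type]
  simp only [Fintype.sum_bool, Fintype.sum_option, hν]
  simp only [hμ]
  simp only [toMeasure_real_eq_sum, Fintype.sum_prod_type, Fintype.sum_bool, Fintype.sum_option,
    toReal_jointLaw_bec, Set.mem_preimage, Set.mem_singleton_iff, toReal_false_eq]
  set q := (PX true).toReal
  simp only [Prod.mk.injEq, reduceCtorEq, and_false, and_true, if_true, if_false, mul_zero,
    mul_one, add_zero, zero_add, Option.some.injEq, Bool.false_eq_true, Bool.true_eq_false,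
    zero_mul, and_self]
  have e1 : ∀ r : ℝ, r * p + r * (1 - p) = r := fun r => by ring
  have e2 : q * p + (1 - q) * p = p := by ring
  have e3 : ∀ r : ℝ, r * p * Real.log (r * p / (r * p)) = 0 := by
    intro r
    by_cases h : r * p = 0
    · rw [h, zero_mul]
    · rw [div_self h, Real.log_one, mul_zero]
  simp only [e1, e2, e3, mul_log_inv_eq]
  rw [Real.binEntropy_eq_negMulLog_add_negMulLog_one_sub]
  ring

/-- A non-erased output leaves no uncertainty, and an erasure leaves the input with its prior law.
-/
theorem condEntropy_jointLaw_bec :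
    condEntropy (jointLaw PX (bec p hp)).toMeasure Prod.fst Prod.snd =
      p * (Real.binEntropy (PX true).toReal / Real.log 2) := by
  classical
  set μ := (jointLaw PX (bec p hp)).toMeasure with hμ
  rw [condEntropy]
  simp only [Fintype.sum_bool, Fintype.sum_option]
  simp only [Measure.real, cond_apply (MeasurableSet.of_discrete : MeasurableSet (Prod.snd ⁻¹' {_})),
    ENNReal.toReal_mul, ENNReal.toReal_inv]
  simp only [← Measure.real_def, hμ]
  simp only [toMeasure_real_eq_sum, Fintype.sum_prod_type, Fintype.sum_bool, Fintype.sum_option,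
    toReal_jointLaw_bec, Set.mem_preimage, Set.mem_singleton_iff, toReal_false_eq,
    Set.mem_inter_iff]
  set q := (PX true).toReal
  simp only [reduceCtorEq, and_false, and_true, if_true, if_false, mul_zero,
    mul_one, add_zero, zero_add, Option.some.injEq, Bool.false_eq_true, Bool.true_eq_false,
    and_self]
  have e2 : q * p + (1 - q) * p = p := by ring
  have e3 : ∀ r : ℝ, Real.negMulLog (r⁻¹ * r) = 0 := by
    intro r
    by_cases h : r = 0
    · simp [h]
    · rw [inv_mul_cancel₀ h, Real.negMulLog_one]
  simp only [e2, e3, Real.negMulLog_zero, zero_div, add_zero, mul_zero]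
  rw [Real.binEntropy_eq_negMulLog_add_negMulLog_one_sub]
  by_cases h : p = 0
  · simp [h]
  · have e4 : ∀ r : ℝ, p⁻¹ * (r * p) = r := fun r => by field_simp
    simp only [e4]
    ring

theorem otBound_jointLaw_bec (m : ℕ) :
    otBound m (jointLaw PX (bec p hp)) =
      min ((1 - p) * (Real.binEntropy (PX true).toReal / Real.log 2))
        (p * (Real.binEntropy (PX true).toReal / Real.log 2) / ((m : ℝ) - 1)) := by
  rw [otBound, mutualInfo_jointLaw_bec, condEntropy_jointLaw_bec]

theorem otBound_uniform (m : ℕ) :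
    otBound m (jointLaw (PMF.uniformOfFintype Bool) (bec p hp)) =
      min (1 - p) (p / ((m : ℝ) - 1)) := by
  have h2 : Real.log 2 ≠ 0 := (Real.log_pos (by norm_num)).ne'
  rw [otBound_jointLaw_bec]
  simp [Real.binEntropy_two_inv, h2]

theorem otBound_le_uniform {m : ℕ} (hm : 2 ≤ m) :
    otBound m (jointLaw PX (bec p hp)) ≤
      otBound m (jointLaw (PMF.uniformOfFintype Bool) (bec p hp)) := by
  have hm' : (2 : ℝ) ≤ m := by exact_mod_cast hm
  have hH : Real.binEntropy (PX true).toReal / Real.log 2 ≤ 1 :=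
    (div_le_one (Real.log_pos (by norm_num))).2 Real.binEntropy_le_log_two
  rw [otBound_uniform, otBound_jointLaw_bec]
  refine min_le_min ?_ (div_le_div_of_nonneg_right ?_ (by linarith))
  · exact mul_le_of_le_one_right (sub_nonneg.2 hp.2) hH
  · exact mul_le_of_le_one_right hp.1 hH

end OTBound

end SFC

theorem mainTheorem4 (m : ℕ) (hm : 2 ≤ m) (p : ℝ) (hp : p ∈ Set.Icc (0 : ℝ) 1) :
    -- the capacity of the binary erasure source and of the binary erasure channel
    SFC.IsOTSourceCapacity m (SFC.bes p hp) (min (1 - p) (p / ((m : ℝ) - 1))) ∧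
    SFC.IsOTChannelCapacity m (SFC.bec p hp) (min (1 - p) (p / ((m : ℝ) - 1))) ∧
    -- the SWOT protocol attains it, in both models
    SFC.AttainsRate
      (fun n k ε => (SFC.swotSource m n k).IsSecure (SFC.uniformSource m k) (SFC.bes p hp)
        SFC.otF SFC.otG ε)
      (min (1 - p) (p / ((m : ℝ) - 1))) ∧
    SFC.AttainsRate
      (fun n k ε => (SFC.swotChannel m n k).IsSecure (SFC.uniformSource m k) (SFC.bec p hp)
        SFC.otF SFC.otG ε)
      (min (1 - p) (p / ((m : ℝ) - 1))) ∧
    -- over all input distributions, the upper bound is largest at the uniform one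
    (∀ PX : PMF Bool, SFC.otBound m (SFC.jointLaw PX (SFC.bec p hp)) ≤
      SFC.otBound m (SFC.jointLaw (PMF.uniformOfFintype Bool) (SFC.bec p hp))) ∧
    SFC.otBound m (SFC.jointLaw (PMF.uniformOfFintype Bool) (SFC.bec p hp)) =
      min (1 - p) (p / ((m : ℝ) - 1)) := by
  have hm' : (2 : ℝ) ≤ m := by exact_mod_cast hm
  have hC : 0 ≤ min (1 - p) (p / ((m : ℝ) - 1)) :=
    le_min (sub_nonneg.2 hp.2) (div_nonneg hp.1 (by linarith))
  have hsource := SFC.attainsRate_swot hm hp fun n k ε hε h =>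
    SFC.swotSource_isSecure (n := n) (k := k) hm hp hε h
  have hchannel := SFC.attainsRate_swot hm hp fun n k ε hε h =>
    SFC.swotChannel_isSecure (n := n) (k := k) hm hp hε h
  refine ⟨⟨?_, ?_⟩, ⟨?_, ?_⟩, hsource, hchannel, fun PX => SFC.otBound_le_uniform hp PX hm,
    SFC.otBound_uniform hp m⟩
  -- A zero value belongs to the set by convention; a positive one is attained by the SWOT protocol.
  · rcases hC.eq_or_lt with h0 | h0
    · exact Or.inl h0.symm
    · refine Or.inr ⟨h0, fun ε hε => ?_⟩
      filter_upwards [hsource ε hε] with n ⟨k, hk, h⟩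
      exact ⟨k, hk, _, h⟩
  · rintro R (rfl | ⟨-, hR⟩)
    · exact hC
    · refine SFC.rate_le_of_card_bounds hm (fun n k ε h hε δ hδ hn hδn => ?_) hR
      obtain ⟨π, hπ⟩ := h
      exact π.card_bounds hm hp hπ hε hδ hn hδn
  · rcases hC.eq_or_lt with h0 | h0
    · exact Or.inl h0.symm
    · refine Or.inr ⟨h0, fun ε hε => ?_⟩
      filter_upwards [hchannel ε hε] with n ⟨k, hk, h⟩
      exact ⟨k, hk, _, h⟩
  · rintro R (rfl | ⟨-, hR⟩)
    · exact hC
    · refine SFC.rate_le_of_card_bounds hm (fun n k ε h hε δ hδ hn hδn => ?_) hR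
      obtain ⟨π, hπ⟩ := h
      exact π.card_bounds hm hp hπ hε hδ hn hδn
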